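/- Let $\Omega=\mathbb H_1\times\mathbb H_2\subset\mathbb C^2$, where $\mathbb H_j=\{z_j=x_j+iy_j: y_j>0\}$, and let $\mathcal S(\overline\Omega)$ be the space of restrictions to $\overline\Omega$ of Schwartz functions on $\mathbb R^4$. For $j\in\{1,2\}$ let $k\ne j$ be the other index. For $g\in\mathcal S(\overline\Omega)$ let $g^{oj}$ be the extension of $g|_\Omega$ to $\mathbb R^4$ that is odd in $y_j$ and zero for $y_k<0$, and for $\xi\in\mathbb R^2$, $\eta_j\in\mathbb R$, $c\in\mathbb C$ with $\operatorname{Im}c\le 0$ put $$\hat g^{oj}(\xi,\eta_j,c)=\int_{\mathbb R^4} g^{oj}\,e^{-i(x_1\xi_1+x_2\xi_2+y_j\eta_j+y_kc)}\,dx\,dy .$$ The $\bar\partial$-Neumann solution operator $N$ on $(0,1)$-forms on $\Omega$ is defined as follows. For $f=f_1d\bar z_1+f_2d\bar z_2$ with $f_1,f_2\in\mathcal S(\overline\Omega)$, $Nf=u_1d\bar z_1+u_2d\bar z_2$, where $u_j$ is the solution on $\Omega$ of $$\Delta u_j=g:=-2f_j,\qquad u_j=0\ \text{ on } y_j=0,\qquad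 \frac{\partial u_j}{\partial\bar z_k}=0\ \text{ on } y_k=0$$ given by the restriction to $\Omega$ of the inverse Fourier transform (in the sense of distributions) of $$\hat u_j^{oj}(\xi,\eta)=-\frac{\hat g^{oj}(\xi,\eta_j,\eta_k)}{|\xi|^2+|\eta|^2}+\frac{i\eta_k-\xi_k}{\zeta-\xi_k}\,\frac{\hat g^{oj}(\xi,\eta_j,-i\zeta)}{|\xi|^2+|\eta|^2},\qquad \zeta=\sqrt{\xi_1^2+\xi_2^2+\eta_j^2}.$$ Let $\bar\partial^*u=-2\left(\frac{\partial u_1}{\partial z_1}+\frac{\partial u_2}{\partial z_2}\right)$, with derivatives in the sense of distributions on $\Omega$. **Proposition.** If $f=f_1d\bar z_1+f_2d\bar z_2$ has coefficients in $\mathcal S(\overline\Omega)$ and $\bar\partial f=0$ in $\Omega$, then $\bar\partial^*Nf\in C^\infty(\overline\Omega)$; that is, there is a function $w$, smooth on $\Omega$ up to the boundary, such that $\bar\partial^*Nf=w$ as distributions on $\Omega$. -/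

import Mathlib

open scoped ContDiff SchwartzMap

noncomputable section

namespace BiHalfPlane

/-- `ℂ² = ℝ⁴`, with real coordinates `x₁, x₂` (indices `Sum.inl j`) and `y₁, y₂` (indices
`Sum.inr j`), where `z_j = x_j + i y_j`. The same type carries the dual variables `(ξ, η)`. -/
abbrev E : Type := EuclideanSpace ℝ (Fin 2 ⊕ Fin 2)

/-- The coordinate `x_j` (or `ξ_j`). -/
def X (p : E) (j : Fin 2) : ℝ := p (Sum.inl j)

/-- The coordinate `y_j` (or `η_j`). -/
def Y (p : E) (j : Fin 2) : ℝ := p (Sum.inr j)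

/-- The index different from `j`. -/
def other (j : Fin 2) : Fin 2 := 1 - j

/-- The product of two upper half-planes. -/
def Ω : Set E := {p | ∀ j, 0 < Y p j}

/-- `∂/∂x_j`. -/
def dx (j : Fin 2) (g : E → ℂ) (p : E) : ℂ :=
  fderiv ℝ g p (EuclideanSpace.single (Sum.inl j) 1)

/-- `∂/∂y_j`. -/
def dy (j : Fin 2) (g : E → ℂ) (p : E) : ℂ :=
  fderiv ℝ g p (EuclideanSpace.single (Sum.inr j) 1)

/-- `∂/∂z_j = (∂/∂x_j - i ∂/∂y_j) / 2`. -/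
def dz (j : Fin 2) (g : E → ℂ) (p : E) : ℂ := (dx j g p - Complex.I * dy j g p) / 2

/-- `∂/∂z̄_j = (∂/∂x_j + i ∂/∂y_j) / 2`. -/
def dzbar (j : Fin 2) (g : E → ℂ) (p : E) : ℂ := (dx j g p + Complex.I * dy j g p) / 2

/-- `g` is a Schwartz function on the closure of `Ω`: on that set it is the restriction of a
Schwartz function on `ℝ⁴`. -/
def IsSchwartz (g : E → ℂ) : Prop := ∃ G : 𝓢(E, ℂ), Set.EqOn g G (closure Ω)

/-- The `(0,1)`-form `f₁ dz̄₁ + f₂ dz̄₂` is `∂̄`-closed in `Ω`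
(the components `f₁, f₂` are `f 0, f 1`). -/
def DbarClosed (f : Fin 2 → E → ℂ) : Prop :=
  ∀ p ∈ Ω, dzbar 0 (f 1) p - dzbar 1 (f 0) p = 0

/-- The reflection `y_j ↦ -y_j`. -/
def reflect (j : Fin 2) (p : E) : E :=
  WithLp.toLp 2 (fun i => if i = Sum.inr j then - p i else p i)

open Classical in
/-- The extension of `g` from `Ω` to `ℝ⁴` that is odd in `y_j` and vanishes for `y_k < 0`, where
`k ≠ j` (set to `0` on the null set where `y_j = 0` or `y_k = 0`). -/
def oddExt (j : Fin 2) (g : E → ℂ) (p : E) : ℂ :=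
  if p ∈ Ω then g p else if reflect j p ∈ Ω then - g (reflect j p) else 0

/-- The Fourier transform `∫ g^{oj} exp(-i (x·ξ + y_j η_j + y_k c))` of the extension `g^{oj}`,
where the (complex) frequency dual to `y_k`, `k ≠ j`, is `c`. -/
def extFourier (j : Fin 2) (g : E → ℂ) (ξ : E) (c : ℂ) : ℂ :=
  ∫ p : E, oddExt j g p * Complex.exp (-Complex.I *
    ((X p 0 * X ξ 0 + X p 1 * X ξ 1 + Y p j * Y ξ j : ℝ) + (Y p (other j) : ℂ) * c))

/-- `ζ = √(ξ₁² + ξ₂² + η_j²)`. -/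
def zeta (j : Fin 2) (ξ : E) : ℝ := Real.sqrt (X ξ 0 ^ 2 + X ξ 1 ^ 2 + Y ξ j ^ 2)

/-- The Fourier transform of the extended solution `u^{oj}` of `Δ u = g` in `Ω` with `u = 0` on
`y_j = 0` and `∂u/∂z̄_k = 0` on `y_k = 0`, `k ≠ j`:
`-ĝ(ξ, η) / |(ξ, η)|² + (i η_k - ξ_k) / (ζ - ξ_k) * ĝ(ξ, η_j, η_k = -iζ) / |(ξ, η)|²`. -/
def solutionSymbol (j : Fin 2) (g : E → ℂ) (ξ : E) : ℂ :=
  - extFourier j g ξ (Y ξ (other j)) / (‖ξ‖ ^ 2 : ℝ)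
  + (Complex.I * Y ξ (other j) - X ξ (other j)) / ((zeta j ξ - X ξ (other j) : ℝ) : ℂ)
    * (extFourier j g ξ (-Complex.I * zeta j ξ) / (‖ξ‖ ^ 2 : ℝ))

/-- The inverse Fourier transform of `a`, as a distribution: the pairing of
`(2π)⁻⁴ ∫ a(ξ) exp(i x·ξ) dξ` with the test function `φ`. -/
def invFourierPairing (a φ : E → ℂ) : ℂ :=
  ((2 * Real.pi) ^ 4 : ℝ)⁻¹ *
    ∫ ξ : E, a ξ * ∫ p : E, φ p * Complex.exp (Complex.I * (inner ℝ p ξ : ℝ))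

/-- The solution `N f = u₁ dz̄₁ + u₂ dz̄₂` of the `∂̄`-Neumann problem on `Ω` with data `f`
(so that `Δ u_j = -2 f_j`); the component `u_j` is given as a distribution, `φ ↦ ⟨u_j, φ⟩`. -/
def N (f : Fin 2 → E → ℂ) (j : Fin 2) (φ : E → ℂ) : ℂ :=
  invFourierPairing (solutionSymbol j (fun p => -2 * f j p)) φ

/-- `∂̄* u = -2 (∂u₁/∂z₁ + ∂u₂/∂z₂)` for a `(0,1)`-form `u` with distribution coefficients. The
factor comes from `|dz̄_j|² = 2`; the minus sign is absorbed in the distributional derivative. -/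
def dbarStar (u : Fin 2 → (E → ℂ) → ℂ) (φ : E → ℂ) : ℂ :=
  2 * ∑ j, u j (dz j φ)

/-- `φ ∈ C_c^∞(Ω)`. -/
structure IsTest (φ : E → ℂ) : Prop where
  smooth : ContDiff ℝ ∞ φ
  compact : HasCompactSupport φ
  supp : tsupport φ ⊆ Ω

/-- The distribution `T` on `Ω` is (given by) a function in `C^∞` of the closure of `Ω`. -/
def SmoothUpToBoundary (T : (E → ℂ) → ℂ) : Prop :=
  ∃ w : E → ℂ, ContDiffOn ℝ ∞ w (closure Ω) ∧ ∀ φ, IsTest φ → T φ = ∫ p in Ω, w p * φ p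

end BiHalfPlane

end

open scoped ContDiff SchwartzMap

noncomputable section

namespace BiHalfPlane

open MeasureTheory Set Filter Topology Complex

section

/-! ### Slicing along a coordinate -/

/-! Write `r_j = ξ_j + iη_j` and `s_j = ξ_j - iη_j` for `j = 0, 1` (`rr j`, `rb j`). Pairing with a
test function `φ` and moving `∂/∂z_j` onto it turns `∂̄*Nf` into integrals of `û_j s_j` against the
Fourier integral `ift φ`. Since `φ` lives in `y_0, y_1 > 0`, `ift φ` continues holomorphically to
the upper half-plane in each `η_j`. Integrals in `η_j` are thus residue computations: for `a > 0` a
factor `1/(a - iη_j)` gives nothing, and `1/(a + iη_j)` gives the value at `η_j = ia`. Hence many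
symbols define the same distribution on `Ω`, and the given one is exchanged for a harmless one.

By `|(ξ, η)|² = r_0 s_0 + r_1 s_1` the kernel of each term splits as `W + R + Z` (`kernel_algebra₁`,
`kernel_algebra₂`). The two `Z` terms are transforms of `∂f_0/∂z̄_1` and `∂f_1/∂z̄_0` and cancel
because `∂̄f = 0` (`integral_closed`). The `R` terms contain everything that involves `ζ`; their
residues cancel (`integral_R₁`, `integral_R₂`). What is left, `W`, is the canonical solution in
`z_0` with datum `f_0`, plus the Bergman projection in `z_0` of the canonical solution in `z_1` with
datum `f_1`.

In `W` the reflected wave `e^{iη_j y_j}` may be replaced, again by residues, by the factor `e^{-ξ_j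
|y_j|}` restricted to `ξ_j > 0`. The resulting kernels `K` give zero against `ift φ` for almost
every `q` outside `Ω`, so the integral of `f` over `Ω` becomes an integral of a Schwartz extension
`G` over all of `ℝ⁴` (`integral_K_eq_indicator`).

Finally each piece of `K` is rewritten as a superposition `∫ M(ξ) Ĝ(ξ) H(ξ, p) dξ`
(`represented_of_tame`). Here `Ĝ` is Schwartz, `M` has only the locally integrable singularities
`1/|r_j|`, and the `p`-derivatives of `H` grow polynomially in `ξ`. Such an integral can be
differentiated in `p` any number of times (`contDiff_integral_smul`), so it is smooth up to the
boundary. -/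

/-- The index set of the real coordinates. -/
abbrev Idx : Type := Fin 2 ⊕ Fin 2

/-- Replace the `i`-th coordinate of `ξ` by `t`. -/
def upd (ξ : E) (i : Idx) (t : ℝ) : E := WithLp.toLp 2 (Function.update ξ.ofLp i t)

@[simp] lemma upd_same (ξ : E) (i : Idx) (t : ℝ) : upd ξ i t i = t := by simp [upd]

lemma upd_ne (ξ : E) {i j : Idx} (t : ℝ) (h : j ≠ i) : upd ξ i t j = ξ j := by
  simp [upd, Function.update_of_ne h]

lemma upd_apply (ξ : E) (i j : Idx) (t : ℝ) : upd ξ i t j = if j = i then t else ξ j := by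
  by_cases h : j = i
  · subst h; simp
  · simp [upd_ne ξ t h, h]

@[simp] lemma upd_upd (ξ : E) (i : Idx) (s t : ℝ) : upd (upd ξ i s) i t = upd ξ i t := by
  ext j; by_cases h : j = i <;> simp [upd_apply, h]

lemma upd_comm (ξ : E) {i j : Idx} (h : i ≠ j) (s t : ℝ) :
    upd (upd ξ i s) j t = upd (upd ξ j t) i s := by
  ext k; by_cases hi : k = i <;> by_cases hj : k = j <;> simp_all [upd_apply]

lemma neg_upd (ξ : E) (i : Idx) (t : ℝ) : -upd ξ i t = upd (-ξ) i (-t) := by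
  ext j; by_cases h : j = i <;> simp [upd_apply, h]

@[fun_prop] lemma continuous_upd (i : Idx) : Continuous fun z : E × ℝ => upd z.1 i z.2 := by
  unfold upd
  apply (PiLp.continuous_toLp 2 _).comp
  exact (PiLp.continuous_ofLp 2 _ |>.comp continuous_fst).update i continuous_snd

lemma continuous_upd_right (ξ : E) (i : Idx) : Continuous fun t : ℝ => upd ξ i t :=
  (continuous_upd i).comp (by fun_prop : Continuous fun t : ℝ => (ξ, t))

/-- The remaining coordinates. -/
abbrev Rest (i : Idx) : Type := {j : Idx // ¬ j = i} → ℝ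

/-- Splitting off the `i`-th coordinate. -/
def sliceEquiv (i : Idx) : E ≃ᵐ ℝ × Rest i :=
  (MeasurableEquiv.toLp 2 (Idx → ℝ)).symm.trans
    ((MeasurableEquiv.piEquivPiSubtypeProd (fun _ : Idx => ℝ) (fun j => j = i)).trans
      (MeasurableEquiv.prodCongr (MeasurableEquiv.funUnique {j : Idx // j = i} ℝ)
        (MeasurableEquiv.refl _)))

lemma sliceEquiv_measurePreserving (i : Idx) : MeasurePreserving (sliceEquiv i) := by
  unfold sliceEquiv
  refine MeasurePreserving.trans (EuclideanSpace.volume_preserving_symm_measurableEquiv_toLp _) ?_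
  refine MeasurePreserving.trans (volume_preserving_piEquivPiSubtypeProd (fun _ : Idx => ℝ)
    (fun j => j = i)) ?_
  -- The product measure depends on the `Fintype` instance of the one-point subtype, which need not
  -- be syntactically `Unique.fintype`.
  have h (inst : Fintype {j : Idx // j = i}) :
      MeasurePreserving (MeasurableEquiv.funUnique {j : Idx // j = i} ℝ)
        (@volume _ (@MeasureSpace.pi _ inst (fun _ => ℝ) _)) volume := by
    obtain rfl : inst = Unique.fintype := Subsingleton.elim _ _
    exact volume_preserving_funUnique {j : Idx // j = i} ℝ
  exact MeasurePreserving.prod (h _) (MeasurePreserving.id volume)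

/-- The point with `i`-th coordinate `t` and other coordinates `r`. -/
def ins (i : Idx) (t : ℝ) (r : Rest i) : E :=
  WithLp.toLp 2 fun j => if h : j = i then t else r ⟨j, h⟩

@[simp] lemma ins_same (i : Idx) (t : ℝ) (r : Rest i) : ins i t r i = t := by simp [ins]

lemma ins_ne (i : Idx) (t : ℝ) (r : Rest i) {j : Idx} (h : ¬ j = i) :
    ins i t r j = r ⟨j, h⟩ := by simp [ins, h]

@[simp] lemma upd_ins (i : Idx) (s t : ℝ) (r : Rest i) : upd (ins i s r) i t = ins i t r := by
  ext j; by_cases h : j = i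
  · subst h; simp
  · simp [upd_apply, h, ins_ne]

lemma sliceEquiv_ins (i : Idx) (t : ℝ) (r : Rest i) : sliceEquiv i (ins i t r) = (t, r) := by
  refine Prod.ext ?_ ?_
  · exact ins_same i t r
  · funext j; exact ins_ne i t r j.2

lemma sliceEquiv_symm (i : Idx) (z : ℝ × Rest i) : (sliceEquiv i).symm z = ins i z.1 z.2 := by
  rw [MeasurableEquiv.symm_apply_eq, sliceEquiv_ins]

lemma integrable_ins {F : Type*} [NormedAddCommGroup F] (i : Idx) {u : E → F} :
    Integrable (fun z : ℝ × Rest i => u (ins i z.1 z.2)) ↔ Integrable u := by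
  rw [← ((sliceEquiv_measurePreserving i).symm _).integrable_comp_emb
    (sliceEquiv i).symm.measurableEmbedding]
  simp only [Function.comp_def, sliceEquiv_symm]

lemma integral_ins {F : Type*} [NormedAddCommGroup F] [NormedSpace ℝ F] (i : Idx) (u : E → F) :
    ∫ z : ℝ × Rest i, u (ins i z.1 z.2) = ∫ ξ, u ξ := by
  rw [← ((sliceEquiv_measurePreserving i).symm _).integral_comp
    (sliceEquiv i).symm.measurableEmbedding]
  simp only [sliceEquiv_symm]

lemma measurable_ins (i : Idx) : Measurable fun z : ℝ × Rest i => ins i z.1 z.2 := by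
  have h := (sliceEquiv i).symm.measurable
  rwa [show ⇑(sliceEquiv i).symm = fun z => ins i z.1 z.2 from funext (sliceEquiv_symm i)] at h

/-- The integral over the whole space as an iterated integral. -/
lemma integral_slice {F : Type*} [NormedAddCommGroup F] [NormedSpace ℝ F] (i : Idx)
    {u : E → F} (hu : Integrable u) :
    ∫ ξ, u ξ = ∫ r : Rest i, ∫ t : ℝ, u (ins i t r) := by
  rw [← integral_ins i u]
  exact integral_prod_symm _ ((integrable_ins i).2 hu)

lemma ae_rest_ne_zero (i : Idx) : ∀ᵐ r : Rest i, ∀ j, r j ≠ 0 := by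
  rw [ae_all_iff]
  intro j
  exact Measure.ae_eval_ne (fun _ => volume) j 0

lemma ae_ne_zero : ∀ᵐ ξ : E, ∀ j, ξ j ≠ 0 := by
  rw [ae_all_iff]
  intro j
  exact (PiLp.volume_preserving_ofLp Idx).quasiMeasurePreserving.ae
    (p := fun x : Idx → ℝ => x j ≠ 0) (Measure.ae_eval_ne (fun _ => volume) j 0)

/-- Two integrable functions whose slices along the `i`-th coordinate have the same integral have
the same integral. -/
lemma integral_eq_of_slices (i : Idx) {u v : E → ℂ} (hu : Integrable u) (hv : Integrable v)
    (h : ∀ ξ : E, (∀ j, j ≠ i → ξ j ≠ 0) → ∫ t, u (upd ξ i t) = ∫ t, v (upd ξ i t)) :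
    ∫ ξ, u ξ = ∫ ξ, v ξ := by
  rw [integral_slice i hu, integral_slice i hv]
  refine integral_congr_ae ?_
  filter_upwards [ae_rest_ne_zero i] with r hr
  have := h (ins i 0 r) (fun j hj => by rw [ins_ne i 0 r hj]; exact hr _)
  simpa only [upd_ins] using this

/-- No integrability is assumed, because the integral of a non-integrable function is `0` by
convention. -/
lemma integral_eq_zero_of_slices (i : Idx) {u : E → ℂ}
    (h : ∀ ξ : E, (∀ j, j ≠ i → ξ j ≠ 0) → ∫ t, u (upd ξ i t) = 0) :
    ∫ ξ, u ξ = 0 := by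
  by_cases hu : Integrable u
  · simpa using integral_eq_of_slices i hu (integrable_zero E ℂ volume)
      (fun ξ hξ => by simpa using h ξ hξ)
  · exact integral_undef hu

/-- The two-variable version of `integral_eq_of_slices`. -/
lemma integral_eq_of_slices₂ {i j : Idx} (hij : i ≠ j) {u v : E → ℂ} (hu : Integrable u)
    (hv : Integrable v)
    (h : ∀ ξ : E, (∀ k, k ≠ i → k ≠ j → ξ k ≠ 0) →
      ∫ s, ∫ t, u (upd (upd ξ j s) i t) = ∫ s, ∫ t, v (upd (upd ξ j s) i t)) :
    ∫ ξ, u ξ = ∫ ξ, v ξ := by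
  -- The Cauchy probability density spreads the integral over the `i`-th coordinate back over a full
  -- line. This gives again an integrable function on `E` with the same total integral, to which the
  -- one-coordinate lemma applies along `j`.
  let γ : ℝ → ℝ := fun t => Real.pi⁻¹ * (1 + t ^ 2)⁻¹
  have hγ : Integrable γ := integrable_inv_one_add_sq.const_mul _
  have hγ1 : ∫ t, γ t = 1 := by
    simp only [γ, integral_const_mul, integral_univ_inv_one_add_sq]
    exact inv_mul_cancel₀ Real.pi_ne_zero
  have key : ∀ u : E → ℂ, Integrable u →
      Integrable (fun ξ : E => (γ (ξ i) : ℂ) * ∫ t, u (upd ξ i t)) ∧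
      ∫ ξ : E, (γ (ξ i) : ℂ) * ∫ t, u (upd ξ i t) = ∫ ξ, u ξ := by
    intro u hu
    have h1 : Integrable (fun ξ : E => (γ (ξ i) : ℂ) * ∫ t, u (upd ξ i t)) := by
      rw [← integrable_ins i]
      simp only [ins_same, upd_ins]
      exact (hγ.ofReal (𝕜 := ℂ)).mul_prod ((integrable_ins i).2 hu).integral_prod_right
    refine ⟨h1, integral_eq_of_slices i h1 hu fun ξ _ => ?_⟩
    simp only [upd_same, upd_upd]
    rw [integral_mul_const, integral_complex_ofReal, hγ1]
    simp
  rw [← (key u hu).2, ← (key v hv).2]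
  refine integral_eq_of_slices j (key u hu).1 (key v hv).1 fun ξ hξ => ?_
  simp only [upd_ne _ _ hij, integral_const_mul]
  by_cases h0 : ∀ k, k ≠ i → k ≠ j → ξ k ≠ 0
  · rw [h ξ h0]
  · push Not at h0
    obtain ⟨k, _, hk, hk'⟩ := h0
    exact absurd hk' (hξ k hk)

/-! ### Weights -/

/-- A product of integrable one-variable weights. -/
def decay (ξ : E) : ℝ := ∏ i, (1 + ξ i ^ 2)⁻¹

lemma decay_pos (ξ : E) : 0 < decay ξ :=
  Finset.prod_pos fun i _ => by positivity

@[fun_prop] lemma continuous_decay : Continuous decay := by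
  unfold decay
  refine continuous_finsetProd _ fun i _ => Continuous.inv₀ (by fun_prop) fun x => by positivity

lemma integrable_prod_coord {f : Idx → ℝ → ℝ} (hf : ∀ i, Integrable (f i)) :
    Integrable fun ξ : E => ∏ i, f i (ξ i) := by
  have := Integrable.fintype_prod (f := f) (μ := fun _ => volume) hf
  exact ((PiLp.volume_preserving_ofLp Idx).integrable_comp_emb
    (MeasurableEquiv.toLp 2 (Idx → ℝ)).symm.measurableEmbedding).2 this

lemma integrable_decay : Integrable decay :=
  integrable_prod_coord (f := fun _ t => (1 + t ^ 2)⁻¹) fun _ => integrable_inv_one_add_sq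

/-- The exponent 8 is four coordinates times the square in each factor. -/
lemma one_add_norm_pow_le_decay (ξ : E) : ((1 + ‖ξ‖) ^ 8)⁻¹ ≤ decay ξ := by
  unfold decay
  rw [Finset.prod_inv_distrib]
  refine inv_anti₀ (Finset.prod_pos fun i _ => by positivity) ?_
  calc ∏ i, (1 + ξ i ^ 2) ≤ ∏ _i : Idx, (1 + ‖ξ‖) ^ 2 := by
        refine Finset.prod_le_prod (fun i _ => by positivity) fun i _ => ?_
        have h1 : |ξ i| ≤ ‖ξ‖ := by simpa using PiLp.norm_apply_le ξ i
        have h2 : ξ i ^ 2 ≤ ‖ξ‖ ^ 2 := by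
          rw [← sq_abs]; gcongr
        nlinarith [norm_nonneg ξ]
    _ = (1 + ‖ξ‖) ^ 8 := by
        rw [Finset.prod_const, ← pow_mul]; rfl

lemma exists_bound_schwartz (G : 𝓢(E, ℂ)) (n : ℕ) :
    ∃ C, 0 ≤ C ∧ ∀ ξ, (1 + ‖ξ‖) ^ n * ‖G ξ‖ ≤ C * decay ξ := by
  obtain ⟨C, hC⟩ : ∃ C, ∀ ξ, (1 + ‖ξ‖) ^ (n + 8) * ‖G ξ‖ ≤ C := by
    have := SchwartzMap.one_add_le_sup_seminorm_apply (𝕜 := ℝ) (m := (n + 8, 0)) le_rfl le_rfl G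
    exact ⟨_, fun ξ => by simpa only [norm_iteratedFDeriv_zero] using this ξ⟩
  have hC0 : 0 ≤ C := le_trans (by positivity) (hC 0)
  refine ⟨C, hC0, fun ξ => ?_⟩
  have hp : 0 < (1 + ‖ξ‖) ^ 8 := by positivity
  calc (1 + ‖ξ‖) ^ n * ‖G ξ‖ = ((1 + ‖ξ‖) ^ (n + 8) * ‖G ξ‖) * ((1 + ‖ξ‖) ^ 8)⁻¹ := by
        rw [pow_add]; field_simp
    _ ≤ C * decay ξ := by
        refine mul_le_mul (hC ξ) (one_add_norm_pow_le_decay ξ) (by positivity) hC0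

/-- `ξ_j + i η_j`. -/
def rr (j : Fin 2) (ξ : E) : ℂ := (X ξ j : ℂ) + Complex.I * Y ξ j

/-- `ξ_j - i η_j`. -/
def rb (j : Fin 2) (ξ : E) : ℂ := (X ξ j : ℂ) - Complex.I * Y ξ j

lemma norm_rr_sq (j : Fin 2) (ξ : E) : ‖rr j ξ‖ ^ 2 = X ξ j ^ 2 + Y ξ j ^ 2 := by
  rw [← Complex.normSq_eq_norm_sq, rr, Complex.normSq_apply]; simp; ring

lemma norm_rb (j : Fin 2) (ξ : E) : ‖rb j ξ‖ = ‖rr j ξ‖ := by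
  have : rb j ξ = (starRingEnd ℂ) (rr j ξ) := by
    simp [rr, rb, sub_eq_add_neg]
  rw [this, Complex.norm_conj]

@[fun_prop] lemma continuous_X (j : Fin 2) : Continuous fun ξ : E => X ξ j := by
  unfold X; fun_prop

@[fun_prop] lemma continuous_Y (j : Fin 2) : Continuous fun ξ : E => Y ξ j := by
  unfold Y; fun_prop

@[fun_prop] lemma continuous_rr (j : Fin 2) : Continuous (rr j) := by
  unfold rr; fun_prop

@[fun_prop] lemma continuous_rb (j : Fin 2) : Continuous (rb j) := by
  unfold rb; fun_prop

lemma integrable_rpow_weight :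
    Integrable fun t : ℝ => |t| ^ (-(1 / 2) : ℝ) * (1 + t ^ 2)⁻¹ := by
  have h : IntegrableOn (fun t : ℝ => |t| ^ (-(1 / 2) : ℝ) * (1 + t ^ 2)⁻¹) (Ioi 0) := by
    rw [← Ioc_union_Ioi_eq_Ioi zero_le_one]
    refine IntegrableOn.union ?_ ?_
    · have h1 : IntegrableOn (fun t : ℝ => t ^ (-(1 / 2) : ℝ)) (Ioc 0 1) :=
        (intervalIntegrable_iff_integrableOn_Ioc_of_le zero_le_one).1
          (intervalIntegral.intervalIntegrable_rpow' (by norm_num))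
      refine Integrable.mono' h1 (by fun_prop) ?_
      refine (ae_restrict_iff' measurableSet_Ioc).2 (ae_of_all _ fun t ht => ?_)
      have ht0 : 0 < t := ht.1
      rw [abs_of_pos ht0, Real.norm_of_nonneg (by positivity)]
      refine mul_le_of_le_one_right (by positivity) (inv_le_one_of_one_le₀ (by nlinarith))
    · refine Integrable.mono' integrable_inv_one_add_sq.integrableOn (by fun_prop) ?_
      refine (ae_restrict_iff' measurableSet_Ioi).2 (ae_of_all _ fun t ht => ?_)
      have ht1 : (1 : ℝ) < t := ht
      rw [abs_of_pos (by linarith), Real.norm_of_nonneg (by positivity)]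
      refine mul_le_of_le_one_left (by positivity) ?_
      exact Real.rpow_le_one_of_one_le_of_nonpos ht1.le (by norm_num)
  have h' : IntegrableOn (fun t : ℝ => |t| ^ (-(1 / 2) : ℝ) * (1 + t ^ 2)⁻¹) (Iic 0) := by
    rw [integrableOn_Iic_iff_integrableOn_Iio]
    have := h.comp_neg
    simpa using this
  have := h'.union h
  rwa [Iic_union_Ioi, integrableOn_univ] at this

/-- From `|x||y| ≤ x² + y²`. The planar singularity `1/|r_j|` is dominated by a product of
one-variable singularities `|t|^{-1/2}`, each integrable at the origin. -/
lemma inv_norm_rr_le (j : Fin 2) (ξ : E) (hx : X ξ j ≠ 0) (hy : Y ξ j ≠ 0) :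
    ‖rr j ξ‖⁻¹ ≤ |X ξ j| ^ (-(1 / 2) : ℝ) * |Y ξ j| ^ (-(1 / 2) : ℝ) := by
  have hx' := abs_pos.2 hx
  have hy' := abs_pos.2 hy
  rw [← Real.mul_rpow hx'.le hy'.le, Real.rpow_neg (by positivity), ← Real.sqrt_eq_rpow]
  refine inv_anti₀ (Real.sqrt_pos.2 (by positivity)) ?_
  refine Real.sqrt_le_iff.2 ⟨norm_nonneg _, ?_⟩
  rw [norm_rr_sq, ← sq_abs (X ξ j), ← sq_abs (Y ξ j)]
  nlinarith [sq_nonneg (|X ξ j| - |Y ξ j|)]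

lemma integrable_inv_rr_mul_decay (j : Fin 2) :
    Integrable fun ξ : E => ‖rr j ξ‖⁻¹ * decay ξ := by
  let f : Idx → ℝ → ℝ := fun i t =>
    if i = Sum.inl j ∨ i = Sum.inr j then |t| ^ (-(1 / 2) : ℝ) * (1 + t ^ 2)⁻¹ else (1 + t ^ 2)⁻¹
  have hf : ∀ i, Integrable (f i) := by
    intro i
    by_cases h : i = Sum.inl j ∨ i = Sum.inr j
    · simpa only [f, h, if_true] using integrable_rpow_weight
    · simpa only [f, h, if_false] using integrable_inv_one_add_sq
  refine Integrable.mono' (integrable_prod_coord hf)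
    ((by fun_prop : Measurable fun ξ : E => ‖rr j ξ‖⁻¹ * decay ξ)).aestronglyMeasurable ?_
  filter_upwards [ae_ne_zero] with ξ hξ
  rw [Real.norm_of_nonneg (mul_nonneg (by positivity) (decay_pos ξ).le)]
  have h1 := inv_norm_rr_le j ξ (hξ _) (hξ _)
  have h2 : ∏ i, f i (ξ i) =
      (|X ξ j| ^ (-(1 / 2) : ℝ) * |Y ξ j| ^ (-(1 / 2) : ℝ)) * decay ξ := by
    have e : ∀ i, f i (ξ i) = (if i = Sum.inl j then |X ξ j| ^ (-(1 / 2) : ℝ) else 1) *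
        (if i = Sum.inr j then |Y ξ j| ^ (-(1 / 2) : ℝ) else 1) * (1 + ξ i ^ 2)⁻¹ := by
      intro i
      by_cases ha : i = Sum.inl j
      · subst ha; simp [f, X]
      · by_cases hb : i = Sum.inr j
        · subst hb; simp [f, Y]
        · simp [f, ha, hb]
    simp only [e, Finset.prod_mul_distrib, decay, Finset.prod_ite_eq', Finset.mem_univ, if_true]
  rw [h2]
  exact mul_le_mul_of_nonneg_right h1 (decay_pos ξ).le

/-- The singular weight that dominates all kernels. -/
def wt (ξ : E) : ℝ := ‖rr 0 ξ‖⁻¹ + ‖rr 1 ξ‖⁻¹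

lemma wt_nonneg (ξ : E) : 0 ≤ wt ξ := by unfold wt; positivity

lemma inv_le_wt (j : Fin 2) (ξ : E) : ‖rr j ξ‖⁻¹ ≤ wt ξ := by
  unfold wt
  fin_cases j
  · exact le_add_of_nonneg_right (by positivity)
  · exact le_add_of_nonneg_left (by positivity)

lemma integrable_wt_mul_decay : Integrable fun ξ : E => wt ξ * decay ξ := by
  simp only [wt, add_mul]
  exact (integrable_inv_rr_mul_decay 0).add (integrable_inv_rr_mul_decay 1)

end

section

open scoped FourierTransform

/-! ### One-variable Fourier integrals -/

/-- The Fourier integral `∫ ψ(t) e^{i t η} dt`. -/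
def hat (ψ : ℝ → ℂ) (η : ℝ) : ℂ := ∫ t, ψ t * cexp (I * (t * η))

lemma norm_cexp_I_mul (x : ℝ) : ‖cexp (I * x)‖ = 1 := by
  rw [mul_comm]; exact norm_exp_ofReal_mul_I x

lemma norm_cexp_neg_I_mul (x : ℝ) : ‖cexp (-I * x)‖ = 1 := by
  have := norm_cexp_I_mul (-x)
  rwa [ofReal_neg, mul_neg, ← neg_mul] at this

lemma hat_eq (ψ : ℝ → ℂ) (w : ℝ) : hat ψ (2 * Real.pi * w) = 𝓕⁻ ψ w := by
  rw [Real.fourierInv_eq']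
  refine integral_congr_ae (ae_of_all _ fun t => ?_)
  simp only [smul_eq_mul, RCLike.inner_apply, conj_trivial]
  rw [mul_comm]
  congr 2
  push_cast; ring

/-- Fourier inversion on the line. -/
lemma integral_hat_mul_cexp {ψ : ℝ → ℂ} (hc : Continuous ψ) (hi : Integrable ψ)
    (hh : Integrable (hat ψ)) (s : ℝ) :
    ∫ η, hat ψ η * cexp (-I * (η * s)) = 2 * Real.pi * ψ s := by
  have h2 : (2 * Real.pi) ≠ 0 := by positivity
  have hF : Integrable (𝓕⁻ ψ) := by
    have := hh.comp_mul_left' h2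
    refine this.congr (ae_of_all _ fun w => hat_eq ψ w)
  have hF' : Integrable (𝓕 ψ) := by
    refine hF.comp_neg.congr (ae_of_all _ fun w => ?_)
    simp only [Real.fourierInv_eq_fourier_neg, neg_neg]
  have h1 : 𝓕 (𝓕⁻ ψ) s = ψ s := by rw [hc.fourier_fourierInv_eq hi hF']
  rw [← h1, Real.fourier_eq']
  have h3 := Measure.integral_comp_mul_left (fun η => hat ψ η * cexp (-I * (η * s))) (2 * Real.pi)
  rw [abs_of_pos (by positivity), eq_inv_smul_iff₀ h2] at h3
  rw [← h3, real_smul]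
  push_cast
  congr 1
  refine integral_congr_ae (ae_of_all _ fun w => ?_)
  simp only [smul_eq_mul, RCLike.inner_apply, conj_trivial, ← hat_eq]
  rw [mul_comm]
  congr 2
  push_cast; ring

/-- The kernel `e^{-a(t-s)}` for `t > s`, zero for `t ≤ s`. -/
def expR (a s t : ℝ) : ℂ := if s < t then cexp (-(a * (t - s) : ℝ)) else 0

lemma norm_expR_le {a : ℝ} (ha : 0 ≤ a) (s t : ℝ) : ‖expR a s t‖ ≤ 1 := by
  unfold expR
  split_ifs with h
  · rw [norm_exp, ← ofReal_neg, ofReal_re, Real.exp_le_one_iff]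
    nlinarith
  · simp

@[fun_prop] lemma measurable_expR : Measurable fun z : ℝ × ℝ × ℝ => expR z.1 z.2.1 z.2.2 := by
  unfold expR
  refine Measurable.ite (measurableSet_lt (by fun_prop) (by fun_prop)) (by fun_prop) (by fun_prop)

lemma integral_expR_mul (a s : ℝ) (ψ : ℝ → ℂ) :
    ∫ t, expR a s t * ψ t = ∫ τ in Ioi (0 : ℝ), cexp (-(a * τ)) * ψ (s + τ) := by
  rw [← integral_indicator measurableSet_Ioi, ← integral_add_left_eq_self _ s]
  refine integral_congr_ae (ae_of_all _ fun t => ?_)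
  by_cases h : 0 < t <;> simp [expR, indicator, h]

lemma integral_cexp_Ioi {a : ℝ} (ha : 0 < a) (η : ℝ) :
    ∫ τ in Ioi (0 : ℝ), cexp (-(a * τ)) * cexp (-I * (η * τ)) = (a + I * η : ℂ)⁻¹ := by
  have h := integral_exp_mul_complex_Ioi (a := -(a + I * η)) (by simpa using ha) 0
  simp only [ofReal_zero, mul_zero, exp_zero, neg_div_neg_eq, one_div] at h
  rw [← h]
  refine integral_congr_ae (ae_of_all _ fun τ => ?_)
  simp only [← Complex.exp_add]
  congr 1; ring

lemma integrableOn_cexp_Ioi {a : ℝ} (ha : 0 < a) :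
    IntegrableOn (fun τ : ℝ => cexp (-(a * τ))) (Ioi 0) := by
  have h := integrableOn_exp_mul_complex_Ioi (a := -(a : ℂ)) (by simpa using ha) 0
  refine h.congr (ae_of_all _ fun τ => ?_)
  simp

/-- This replaces the residue theorem. Writing `1/(a + iη)` as the Laplace integral of `e^{-aτ}
e^{-iητ}` over `τ > 0` and exchanging integrals leaves Fourier inversion at the points `s + τ`. -/
lemma integral_hat_div_add {ψ : ℝ → ℂ} (hc : Continuous ψ) (hi : Integrable ψ)
    (hh : Integrable (hat ψ)) {a : ℝ} (ha : 0 < a) (s : ℝ) :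
    ∫ η, hat ψ η * cexp (-I * (η * s)) / (a + I * η) = 2 * Real.pi * ∫ t, expR a s t * ψ t := by
  have h1 : ∀ η : ℝ, hat ψ η * cexp (-I * (η * s)) / (a + I * η) =
      ∫ τ in Ioi (0 : ℝ), cexp (-(a * τ)) * (hat ψ η * cexp (-I * (η * (s + τ : ℝ)))) := by
    intro η
    rw [div_eq_mul_inv, ← integral_cexp_Ioi ha, ← integral_const_mul]
    refine integral_congr_ae (ae_of_all _ fun τ => ?_)
    have e : cexp (-I * (η * (s + τ : ℝ))) = cexp (-I * (η * s)) * cexp (-I * (η * τ)) := by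
      rw [← Complex.exp_add]; congr 1; push_cast; ring
    simp only [e]; ring
  simp only [h1]
  rw [integral_integral_swap]
  · rw [integral_expR_mul, ← integral_const_mul]
    refine integral_congr_ae (ae_of_all _ fun τ => ?_)
    simp only [integral_const_mul, integral_hat_mul_cexp hc hi hh]
    ring
  · have h2 : Integrable (fun z : ℝ × ℝ => hat ψ z.1 * cexp (-(a * z.2)))
        (volume.prod (volume.restrict (Ioi 0))) := hh.mul_prod (integrableOn_cexp_Ioi ha)
    have h3 : Continuous fun z : ℝ × ℝ => cexp (-I * (z.1 * (s + z.2 : ℝ))) := by fun_prop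
    refine (h2.bdd_mul (c := 1) h3.aestronglyMeasurable (ae_of_all _ fun z => ?_)).congr
      (ae_of_all _ fun z => ?_)
    · have := norm_cexp_neg_I_mul (z.1 * (s + z.2))
      push_cast at this ⊢
      exact this.le
    · simp only [Function.uncurry]; ring

lemma hat_neg (ψ : ℝ → ℂ) (η : ℝ) : hat (fun t => ψ (-t)) η = hat ψ (-η) := by
  unfold hat
  rw [← integral_neg_eq_self]
  simp

lemma integral_hat_div_sub {ψ : ℝ → ℂ} (hc : Continuous ψ) (hi : Integrable ψ)
    (hh : Integrable (hat ψ)) {a : ℝ} (ha : 0 < a) (s : ℝ) :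
    ∫ η, hat ψ η * cexp (-I * (η * s)) / (a - I * η) =
      2 * Real.pi * ∫ t, expR a (-s) (-t) * ψ t := by
  have hh' : Integrable (hat fun t => ψ (-t)) :=
    hh.comp_neg.congr (ae_of_all _ fun η => (hat_neg ψ η).symm)
  have := integral_hat_div_add (ψ := fun t => ψ (-t)) (by fun_prop) hi.comp_neg hh' ha (-s)
  rw [← integral_neg_eq_self, ← integral_neg_eq_self (fun t => expR a (-s) (-t) * ψ t)]
  simp only [hat_neg] at this
  simpa [sub_eq_add_neg] using this

/-! ### Slices of Fourier integrals -/

/-- The Fourier integral `∫ g(p) e^{i p·ξ} dp`. -/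
def ift (g : E → ℂ) (ξ : E) : ℂ := ∫ p : E, g p * cexp (I * (inner ℝ p ξ : ℝ))

lemma inner_eq_sum (p ξ : E) : inner ℝ p ξ = ∑ i, p i * ξ i := by
  simp [PiLp.inner_apply, mul_comm]

lemma inner_upd (p ξ : E) (i : Idx) (η : ℝ) :
    inner ℝ p (upd ξ i η) = inner ℝ p (upd ξ i 0) + p i * η := by
  simp only [inner_eq_sum, upd_apply]
  rw [← Finset.add_sum_erase _ _ (Finset.mem_univ i),
    ← Finset.add_sum_erase (f := fun j => p j * if j = i then 0 else ξ j) _ (Finset.mem_univ i)]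
  have : ∀ c : ℝ, ∑ x ∈ Finset.univ.erase i, p x * (if x = i then c else ξ x) =
      ∑ x ∈ Finset.univ.erase i, p x * ξ x := fun c =>
    Finset.sum_congr rfl fun x hx => by rw [if_neg (Finset.ne_of_mem_erase hx)]
  rw [this, this]
  simp [add_comm]

lemma inner_upd_zero_ins (i : Idx) (t : ℝ) (r : Rest i) (ξ : E) :
    inner ℝ (ins i t r) (upd ξ i 0) = inner ℝ (ins i 0 r) (upd ξ i 0) := by
  simp only [inner_eq_sum]
  refine Finset.sum_congr rfl fun j _ => ?_
  by_cases h : j = i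
  · subst h; simp
  · simp [ins_ne, h]

lemma decay_ins (i : Idx) (t : ℝ) (r : Rest i) :
    decay (ins i t r) = (1 + t ^ 2)⁻¹ * decay (ins i 0 r) := by
  unfold decay
  rw [← Finset.mul_prod_erase _ _ (Finset.mem_univ i),
    ← Finset.mul_prod_erase (f := fun j => (1 + ins i 0 r j ^ 2)⁻¹) _ (Finset.mem_univ i)]
  simp only [ins_same]
  have : ∀ c : ℝ, ∏ x ∈ Finset.univ.erase i, (1 + (ins i c r) x ^ 2)⁻¹ =
      ∏ x ∈ Finset.univ.erase i, (1 + (ins i 0 r) x ^ 2)⁻¹ := fun c =>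
    Finset.prod_congr rfl fun x hx => by
      rw [ins_ne _ _ _ (Finset.ne_of_mem_erase hx), ins_ne _ _ _ (Finset.ne_of_mem_erase hx)]
  rw [this]; simp

lemma decay_ins_le (i : Idx) (t : ℝ) (r : Rest i) : decay (ins i t r) ≤ decay (ins i 0 r) := by
  rw [decay_ins]
  exact mul_le_of_le_one_left (decay_pos _).le
    (inv_le_one_of_one_le₀ (by nlinarith [sq_nonneg t]))

lemma integrable_decay_ins (i : Idx) : Integrable fun r : Rest i => decay (ins i 0 r) := by
  -- Fubini gives integrability on some slice, and all slices of `decay` are proportional.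
  obtain ⟨t, ht⟩ := ((integrable_ins i).2 integrable_decay).prod_right_ae.exists
  simp only [decay_ins i t] at ht
  have h := ht.const_mul (1 + t ^ 2)
  refine h.congr (ae_of_all _ fun r => ?_)
  have : (1 + t ^ 2) ≠ 0 := by positivity
  field_simp

/-- Functions that can be sliced along the `i`-th coordinate. -/
structure Sliceable (i : Idx) (g : E → ℂ) : Prop where
  meas : Measurable g
  bound : ∃ C, ∀ p, ‖g p‖ ≤ C * decay p
  -- Continuity is required along the `i`-th coordinate only: `damp a G` jumps across `y_0 = 0` but
  -- still has to be sliced along `y_1`.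
  cont : ∀ r : Rest i, Continuous fun t => g (ins i t r)

namespace Sliceable

variable {i : Idx} {g : E → ℂ}

lemma integrable (hg : Sliceable i g) : Integrable g := by
  obtain ⟨C, hC⟩ := hg.bound
  exact Integrable.mono' (integrable_decay.const_mul C) hg.meas.aestronglyMeasurable
    (ae_of_all _ hC)

/-- The Fourier integral over all variables but the `i`-th. -/
def part (i : Idx) (g : E → ℂ) (ξ : E) (t : ℝ) : ℂ :=
  ∫ r : Rest i, g (ins i t r) * cexp (I * (inner ℝ (ins i 0 r) (upd ξ i 0) : ℝ))

lemma continuous_part (hg : Sliceable i g) (ξ : E) : Continuous (part i g ξ) := by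
  obtain ⟨C, hC⟩ := hg.bound
  have hm := measurable_ins i
  unfold part
  refine continuous_of_dominated (bound := fun r => |C| * decay (ins i 0 r)) (fun t => ?_)
    (fun t => ae_of_all _ fun r => ?_) ((integrable_decay_ins i).const_mul _)
    (ae_of_all _ fun r => (hg.cont r).mul continuous_const)
  · have h1 : Measurable fun r : Rest i => g (ins i t r) :=
      hg.meas.comp (hm.comp measurable_prodMk_left)
    have h2 : Measurable fun r : Rest i => ins i 0 r := hm.comp measurable_prodMk_left
    exact (h1.mul (by fun_prop)).aestronglyMeasurable
  · rw [norm_mul, norm_cexp_I_mul, mul_one]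
    refine (hC _).trans (mul_le_mul (le_abs_self C) (decay_ins_le i t r) (decay_pos _).le
      (abs_nonneg C))

lemma integrable_aux (hg : Sliceable i g) (ξ : E) (θ : ℝ → ℂ) (hθ : Measurable θ)
    (hθ1 : ∀ t, ‖θ t‖ ≤ 1) :
    Integrable fun p : E => θ (p i) * (g p * cexp (I * (inner ℝ p (upd ξ i 0) : ℝ))) := by
  refine (hg.integrable.bdd_mul (f := fun p : E =>
    θ (p i) * cexp (I * (inner ℝ p (upd ξ i 0) : ℝ))) (c := 1)
    (Measurable.aestronglyMeasurable (by fun_prop)) (ae_of_all _ fun p => ?_)).congr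
    (ae_of_all _ fun p => ?_)
  · rw [norm_mul, norm_cexp_I_mul, mul_one]; exact hθ1 _
  · ring

lemma integral_mul (hg : Sliceable i g) (ξ : E) (θ : ℝ → ℂ) (hθ : Measurable θ)
    (hθ1 : ∀ t, ‖θ t‖ ≤ 1) :
    ∫ p : E, θ (p i) * (g p * cexp (I * (inner ℝ p (upd ξ i 0) : ℝ))) =
      ∫ t, θ t * part i g ξ t := by
  have h := hg.integrable_aux ξ θ hθ hθ1
  rw [← integral_ins i, Measure.volume_eq_prod, integral_prod _ ((integrable_ins i).2 h)]
  refine integral_congr_ae (ae_of_all _ fun t => ?_)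
  simp only [ins_same, part, inner_upd_zero_ins i t, integral_const_mul]

lemma integrable_part (hg : Sliceable i g) (ξ : E) : Integrable (part i g ξ) := by
  have h := hg.integrable_aux ξ (fun _ => 1) measurable_const (fun _ => by simp)
  have := ((integrable_ins i).2 h).integral_prod_left
  refine this.congr (ae_of_all _ fun t => ?_)
  simp only [one_mul, part, inner_upd_zero_ins i t]

/-- By Fubini, `ift g` on a line parallel to an axis is a one-variable Fourier integral, so the
one-variable formulas apply line by line. -/
lemma ift_upd (hg : Sliceable i g) (ξ : E) (η : ℝ) :
    ift g (upd ξ i η) = hat (part i g ξ) η := by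
  have := hg.integral_mul ξ (fun t => cexp (I * (t * η))) (by fun_prop) (fun t => by
    rw [← ofReal_mul, norm_cexp_I_mul])
  unfold ift hat
  simp only [mul_comm (part i g ξ _)]
  rw [← this]
  refine integral_congr_ae (ae_of_all _ fun p => ?_)
  simp only []
  rw [inner_upd, ofReal_add, mul_add, Complex.exp_add, ofReal_mul]
  ring

lemma integrable_hat (hg : Sliceable i g) {ξ : E} (hh : Integrable fun η => ift g (upd ξ i η)) :
    Integrable (hat (part i g ξ)) :=
  hh.congr (ae_of_all _ fun η => hg.ift_upd ξ η)

/-- Fourier inversion in one variable vanishes off the support. -/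
lemma integral_ift_eq_zero (hg : Sliceable i g) {ξ : E}
    (hh : Integrable fun η => ift g (upd ξ i η)) {s : ℝ} (hs : ∀ p, p i = s → g p = 0) :
    ∫ η, ift g (upd ξ i η) * cexp (-I * (η * s)) = 0 := by
  simp only [hg.ift_upd]
  rw [integral_hat_mul_cexp (hg.continuous_part ξ) (hg.integrable_part ξ) (hg.integrable_hat hh)]
  have : part i g ξ s = 0 := by
    unfold part
    simp [hs (ins i s _) (ins_same i s _)]
  rw [this, mul_zero]

lemma integral_ift_div_add (hg : Sliceable i g) {ξ : E}
    (hh : Integrable fun η => ift g (upd ξ i η)) {a : ℝ} (ha : 0 < a) (s : ℝ) :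
    ∫ η, ift g (upd ξ i η) * cexp (-I * (η * s)) / (a + I * η) =
      2 * Real.pi * ∫ p : E, expR a s (p i) * (g p * cexp (I * (inner ℝ p (upd ξ i 0) : ℝ))) := by
  simp only [hg.ift_upd]
  rw [integral_hat_div_add (hg.continuous_part ξ) (hg.integrable_part ξ) (hg.integrable_hat hh) ha,
    hg.integral_mul ξ (expR a s) (by fun_prop) (norm_expR_le ha.le s)]

lemma integral_ift_div_sub (hg : Sliceable i g) {ξ : E}
    (hh : Integrable fun η => ift g (upd ξ i η)) {a : ℝ} (ha : 0 < a) (s : ℝ) :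
    ∫ η, ift g (upd ξ i η) * cexp (-I * (η * s)) / (a - I * η) =
      2 * Real.pi * ∫ p : E, expR a (-s) (-(p i)) *
        (g p * cexp (I * (inner ℝ p (upd ξ i 0) : ℝ))) := by
  simp only [hg.ift_upd]
  rw [integral_hat_div_sub (hg.continuous_part ξ) (hg.integrable_part ξ) (hg.integrable_hat hh) ha,
    hg.integral_mul ξ (fun t => expR a (-s) (-t)) (by fun_prop)
      (fun t => norm_expR_le ha.le (-s) (-t))]

end Sliceable

lemma continuous_ins (i : Idx) (r : Rest i) : Continuous fun t => ins i t r := by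
  have : (fun t => ins i t r) = fun t => upd (ins i 0 r) i t := by
    funext t; rw [upd_ins]
  rw [this]; exact continuous_upd_right _ i

lemma sliceable_schwartz (i : Idx) (G : 𝓢(E, ℂ)) : Sliceable i G where
  meas := G.continuous.measurable
  bound := by
    obtain ⟨C, _, hC⟩ := exists_bound_schwartz G 0
    exact ⟨C, by simpa using hC⟩
  cont r := G.continuous.comp (continuous_ins i r)

/-- The Fourier integral of a Schwartz function is a Schwartz function. -/
lemma exists_schwartz_ift (G : 𝓢(E, ℂ)) : ∃ H : 𝓢(E, ℂ), ∀ ξ, ift G ξ = H ξ := by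
  have h2 : (2 * Real.pi)⁻¹ ≠ 0 := by positivity
  let e : E ≃L[ℝ] E := (LinearEquiv.smulOfNeZero ℝ E (2 * Real.pi)⁻¹ h2).toContinuousLinearEquiv
  refine ⟨SchwartzMap.compCLMOfContinuousLinearEquiv ℝ e (𝓕⁻ G), fun ξ => ?_⟩
  simp only [SchwartzMap.compCLMOfContinuousLinearEquiv_apply, Function.comp_apply]
  rw [SchwartzMap.fourierInv_coe, Real.fourierInv_eq']
  refine integral_congr_ae (ae_of_all _ fun p => ?_)
  have : e ξ = (2 * Real.pi)⁻¹ • ξ := rfl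
  simp only [this, inner_smul_right, smul_eq_mul]
  rw [mul_inv_cancel_left₀ (by positivity), mul_comm, mul_comm I]

lemma decay_upd (ξ : E) (i : Idx) (t : ℝ) : decay (upd ξ i t) = (1 + t ^ 2)⁻¹ * decay (upd ξ i 0) := by
  have : ∀ s, upd ξ i s = ins i s (fun j => ξ j) := fun s => by
    ext j
    by_cases h : j = i
    · subst h; simp
    · simp [upd_apply, ins_ne, h]
  rw [this, this, decay_ins]

lemma integrable_slice_of_le_decay {u : E → ℂ} (hu : Measurable u) {C : ℝ}
    (h : ∀ ξ, ‖u ξ‖ ≤ C * decay ξ) (ξ : E) (i : Idx) : Integrable fun η => u (upd ξ i η) := by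
  refine Integrable.mono' ((integrable_inv_one_add_sq.mul_const (decay (upd ξ i 0))).const_mul C)
    (hu.comp (continuous_upd_right ξ i).measurable).aestronglyMeasurable (ae_of_all _ fun η => ?_)
  rw [← decay_upd]
  exact h _

end

section

variable {φ : E → ℂ}

open scoped FourierTransform

/-! ### Calculus of one-variable integrals against a test function -/

/-- `u` is integrable with integral `v`. -/
structure HasInt (u : ℝ → ℂ) (v : ℂ) : Prop where
  int : Integrable u
  eq : ∫ t, u t = v

namespace HasInt

variable {u₁ u₂ : ℝ → ℂ} {v₁ v₂ : ℂ}

lemma add (h₁ : HasInt u₁ v₁) (h₂ : HasInt u₂ v₂) : HasInt (fun t => u₁ t + u₂ t) (v₁ + v₂) :=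
  ⟨h₁.int.add h₂.int, by rw [integral_add h₁.int h₂.int, h₁.eq, h₂.eq]⟩

lemma sub (h₁ : HasInt u₁ v₁) (h₂ : HasInt u₂ v₂) : HasInt (fun t => u₁ t - u₂ t) (v₁ - v₂) :=
  ⟨h₁.int.sub h₂.int, by rw [integral_sub h₁.int h₂.int, h₁.eq, h₂.eq]⟩

lemma const_mul (c : ℂ) (h : HasInt u₁ v₁) : HasInt (fun t => c * u₁ t) (c * v₁) :=
  ⟨h.int.const_mul c, by rw [integral_const_mul, h.eq]⟩

end HasInt


/-- A test function as a Schwartz function. -/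
lemma IsTest.exists_schwartz (hφ : IsTest φ) : ∃ F : 𝓢(E, ℂ), ⇑F = φ :=
  ⟨hφ.compact.toSchwartzMap hφ.smooth, rfl⟩

lemma IsTest.eq_zero (hφ : IsTest φ) {p : E} {j : Fin 2} (h : Y p j ≤ 0) : φ p = 0 := by
  by_contra h0
  exact absurd (hφ.supp (subset_tsupport φ h0) j) (not_lt.2 h)

lemma IsTest.sliceable (hφ : IsTest φ) (i : Idx) : Sliceable i φ := by
  obtain ⟨F, rfl⟩ := hφ.exists_schwartz
  exact sliceable_schwartz i F

lemma IsTest.ift_bound (hφ : IsTest φ) : ∃ C, 0 ≤ C ∧ ∀ ξ, ‖ift φ ξ‖ ≤ C * decay ξ := by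
  obtain ⟨F, rfl⟩ := hφ.exists_schwartz
  obtain ⟨H, hH⟩ := exists_schwartz_ift F
  obtain ⟨C, hC0, hC⟩ := exists_bound_schwartz H 0
  exact ⟨C, hC0, fun ξ => by simpa [hH] using hC ξ⟩

lemma IsTest.continuous_ift (hφ : IsTest φ) : Continuous (ift φ) := by
  obtain ⟨F, rfl⟩ := hφ.exists_schwartz
  obtain ⟨H, hH⟩ := exists_schwartz_ift F
  rw [funext hH]; exact H.continuous

lemma IsTest.integrable_slice (hφ : IsTest φ) (ξ : E) (i : Idx) :
    Integrable fun η => ift φ (upd ξ i η) := by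
  obtain ⟨C, _, hC⟩ := hφ.ift_bound
  exact integrable_slice_of_le_decay hφ.continuous_ift.measurable hC ξ i

lemma add_I_mul_ne_zero {a : ℝ} (ha : a ≠ 0) (t : ℝ) : (a + I * t : ℂ) ≠ 0 := by
  intro h
  have := congrArg Complex.re h
  simp at this
  exact ha this

lemma sub_I_mul_ne_zero {a : ℝ} (ha : a ≠ 0) (t : ℝ) : (a - I * t : ℂ) ≠ 0 := by
  intro h
  have := congrArg Complex.re h
  simp at this
  exact ha this

lemma abs_le_norm_add_I_mul (a t : ℝ) : |a| ≤ ‖(a + I * t : ℂ)‖ := by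
  simpa using Complex.abs_re_le_norm (a + I * t : ℂ)

lemma abs_le_norm_sub_I_mul (a t : ℝ) : |a| ≤ ‖(a - I * t : ℂ)‖ := by
  simpa using Complex.abs_re_le_norm (a - I * t : ℂ)

lemma integrable_mul_div {u : ℝ → ℂ} (hu : Integrable u) {a : ℝ} (ha : a ≠ 0) (y : ℝ) (ε : ℂ)
    (hε : ε = I ∨ ε = -I) :
    Integrable fun t => u t * cexp (I * (t * y)) / (a + ε * t) := by
  have hm : Measurable fun t : ℝ => cexp (I * (t * y)) / (a + ε * t) := by fun_prop
  refine (hu.bdd_mul (c := |a|⁻¹) hm.aestronglyMeasurable (ae_of_all _ fun t => ?_)).congr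
    (ae_of_all _ fun t => ?_)
  · rw [norm_div, ← ofReal_mul, norm_cexp_I_mul, one_div]
    refine inv_anti₀ (abs_pos.2 ha) ?_
    rcases hε with rfl | rfl
    · exact abs_le_norm_add_I_mul a t
    · rw [neg_mul, ← sub_eq_add_neg]; exact abs_le_norm_sub_I_mul a t
  · simp only []; ring

/-- The Fourier–Laplace integral of `g`: the variable `η_i` takes the value `i a`. -/
def half (i : Idx) (a : ℝ) (g : E → ℂ) (ξ : E) : ℂ :=
  ∫ p : E, expR a 0 (p i) * (g p * cexp (I * (inner ℝ p (upd ξ i 0) : ℝ)))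

lemma expR_neg {a y t : ℝ} (hy : 0 ≤ y) (ht : 0 < t) :
    expR a (-y) t = cexp (-(a * y : ℝ)) * expR a 0 t := by
  rw [expR, expR, if_pos (by linarith), if_pos ht, ← Complex.exp_add]
  congr 1; push_cast; ring

/-- The pole `η_j = ia` lies in the upper half-plane, where `ift φ` is holomorphic. Its residue
consists of `e^{-ay}` and the value `half` of `ift φ` there. -/
lemma IsTest.hasInt_add (hφ : IsTest φ) (ξ : E) (j : Fin 2) {a y : ℝ} (ha : 0 < a) (hy : 0 ≤ y) :
    HasInt (fun t : ℝ => ift φ (upd ξ (Sum.inr j) t) * cexp (I * (t * y)) / (a + I * t))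
      (2 * Real.pi * (cexp (-(a * y : ℝ)) * half (Sum.inr j) a φ ξ)) := by
  refine ⟨integrable_mul_div (hφ.integrable_slice ξ _) ha.ne' y I (Or.inl rfl), ?_⟩
  have h := (hφ.sliceable (Sum.inr j)).integral_ift_div_add (hφ.integrable_slice ξ _) ha (-y)
  have e : ∀ p : E, expR a (-y) (p (Sum.inr j)) *
      (φ p * cexp (I * (inner ℝ p (upd ξ (Sum.inr j) 0) : ℝ))) = cexp (-(a * y : ℝ)) *
      (expR a 0 (p (Sum.inr j)) * (φ p * cexp (I * (inner ℝ p (upd ξ (Sum.inr j) 0) : ℝ)))) := by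
    intro p
    by_cases hp : 0 < p (Sum.inr j)
    · rw [expR_neg hy hp]; ring
    · rw [hφ.eq_zero (j := j) (not_lt.1 hp)]; ring
  simp only [e, integral_const_mul] at h
  rw [half, ← h]
  simp

/-- The pole `η_j = -ia` is in the lower half-plane; equivalently, the kernel only sees the
half-line `y_j < -y`, where `φ` vanishes. -/
lemma IsTest.hasInt_sub (hφ : IsTest φ) (ξ : E) (j : Fin 2) {a y : ℝ} (ha : 0 < a) (hy : 0 ≤ y) :
    HasInt (fun t : ℝ => ift φ (upd ξ (Sum.inr j) t) * cexp (I * (t * y)) / (a - I * t)) 0 := by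
  refine ⟨?_, ?_⟩
  · simpa [sub_eq_add_neg] using
      integrable_mul_div (hφ.integrable_slice ξ (Sum.inr j)) ha.ne' y (-I) (Or.inr rfl)
  have h := (hφ.sliceable (Sum.inr j)).integral_ift_div_sub (hφ.integrable_slice ξ _) ha (-y)
  have e : ∀ p : E, expR a (- -y) (-p (Sum.inr j)) *
      (φ p * cexp (I * (inner ℝ p (upd ξ (Sum.inr j) 0) : ℝ))) = 0 := by
    intro p
    by_cases hp : 0 < p (Sum.inr j)
    · rw [expR, if_neg (by linarith), zero_mul]
    · rw [hφ.eq_zero (j := j) (not_lt.1 hp)]; ring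
  simp only [e, integral_zero, mul_zero] at h
  rw [← h]
  simp

/-- Fourier inversion evaluates `φ` on `y_j = -y ≤ 0`, outside its support. -/
lemma IsTest.hasInt_exp (hφ : IsTest φ) (ξ : E) (j : Fin 2) {y : ℝ} (hy : 0 ≤ y) :
    HasInt (fun t : ℝ => ift φ (upd ξ (Sum.inr j) t) * cexp (I * (t * y))) 0 := by
  refine ⟨?_, ?_⟩
  · refine ((hφ.integrable_slice ξ (Sum.inr j)).bdd_mul (f := fun t : ℝ => cexp (I * (t * y)))
      (c := 1) (Continuous.aestronglyMeasurable (by fun_prop)) (ae_of_all _ fun t => ?_)).congr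
      (ae_of_all _ fun t => mul_comm _ _)
    rw [← ofReal_mul, norm_cexp_I_mul]
  have h := (hφ.sliceable (Sum.inr j)).integral_ift_eq_zero (hφ.integrable_slice ξ _)
    (s := -y) (fun p hp => hφ.eq_zero (j := j) (by rw [Y, hp]; linarith))
  rw [← h]
  simp

/-! ### Kernels -/

/-- `e^{-i x·ξ}`. -/
def ex (q ξ : E) : ℂ := cexp (-I * ((X q 0 * X ξ 0 + X q 1 * X ξ 1 : ℝ)))

/-- `e^{-i y_j η_j}`. -/
def ep (j : Fin 2) (q ξ : E) : ℂ := cexp (-I * ((Y ξ j * Y q j : ℝ)))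

/-- `e^{i y_j η_j}`. -/
def em (j : Fin 2) (q ξ : E) : ℂ := cexp (I * ((Y ξ j * Y q j : ℝ)))

/-- `e^{-ξ_j |y_j|}` for `ξ_j > 0`, zero otherwise. -/
def pe (j : Fin 2) (q ξ : E) : ℂ := if 0 < X ξ j then cexp (-(X ξ j * |Y q j| : ℝ)) else 0

/-- `2 ξ_j e^{-ξ_j y_j}` for `ξ_j > 0` and `y_j > 0`, zero otherwise. -/
def be (j : Fin 2) (q ξ : E) : ℂ := if 0 < X ξ j then 2 * X ξ j * expR (X ξ j) 0 (Y q j) else 0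

@[simp] lemma X_upd (ξ : E) (j k : Fin 2) (t : ℝ) : X (upd ξ (Sum.inr k) t) j = X ξ j := by
  simp [X, upd_apply]

@[simp] lemma Y_upd_same (ξ : E) (k : Fin 2) (t : ℝ) : Y (upd ξ (Sum.inr k) t) k = t := by
  simp [Y]

@[simp] lemma Y_upd_zero_one (ξ : E) (t : ℝ) : Y (upd ξ (Sum.inr 1) t) 0 = Y ξ 0 := by
  simp [Y, upd_apply]

@[simp] lemma Y_upd_one_zero (ξ : E) (t : ℝ) : Y (upd ξ (Sum.inr 0) t) 1 = Y ξ 1 := by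
  simp [Y, upd_apply]

lemma norm_sq_eq (ξ : E) : ‖ξ‖ ^ 2 = X ξ 0 ^ 2 + X ξ 1 ^ 2 + Y ξ 0 ^ 2 + Y ξ 1 ^ 2 := by
  rw [EuclideanSpace.norm_sq_eq, Fintype.sum_sum_type]
  simp [Fin.sum_univ_two, X, Y]
  ring

lemma zeta_sq (j : Fin 2) (ξ : E) : zeta j ξ ^ 2 = X ξ 0 ^ 2 + X ξ 1 ^ 2 + Y ξ j ^ 2 := by
  rw [zeta, Real.sq_sqrt (by positivity)]

lemma zeta_nonneg (j : Fin 2) (ξ : E) : 0 ≤ zeta j ξ := Real.sqrt_nonneg _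

/-- The part of the first kernel that vanishes after integration over `η_2`. -/
def R₁ (q ξ : E) : ℂ :=
  ex q ξ * (ep 0 q ξ - em 0 q ξ) * rb 1 ξ / (rr 0 ξ * (‖ξ‖ ^ 2 : ℝ)) *
    ((zeta 0 ξ + X ξ 1) * cexp (-(zeta 0 ξ * Y q 1 : ℝ)) - rb 1 ξ * em 1 q ξ)

/-- The part of the second kernel that vanishes after integration over `η_1`. -/
def R₂ (q ξ : E) : ℂ :=
  ex q ξ * (ep 1 q ξ - em 1 q ξ) * rb 1 ξ *
    (rb 0 ξ / ((zeta 1 ξ - X ξ 0) * (‖ξ‖ ^ 2 : ℝ)) * cexp (-(zeta 1 ξ * Y q 0 : ℝ)) +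
      rb 0 ξ / (rr 0 ξ * (‖ξ‖ ^ 2 : ℝ)) * em 0 q ξ -
      be 0 q ξ / (rr 0 ξ * (‖rr 1 ξ‖ ^ 2 : ℝ)))

lemma zeta_upd_zero (ξ : E) (t : ℝ) : zeta 0 (upd ξ (Sum.inr 1) t) = zeta 0 ξ := by
  simp [zeta]

lemma zeta_upd_one (ξ : E) (t : ℝ) : zeta 1 (upd ξ (Sum.inr 0) t) = zeta 1 ξ := by
  simp [zeta]

lemma normSq_upd_zero (ξ : E) (t : ℝ) :
    ((‖upd ξ (Sum.inr 1) t‖ ^ 2 : ℝ) : ℂ) = (zeta 0 ξ - I * t) * (zeta 0 ξ + I * t) := by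
  have : ‖upd ξ (Sum.inr 1) t‖ ^ 2 = zeta 0 ξ ^ 2 + t ^ 2 := by
    rw [norm_sq_eq, zeta_sq]; simp
  rw [this]; push_cast
  ring_nf; rw [I_sq]; ring

lemma normSq_upd_one (ξ : E) (t : ℝ) :
    ((‖upd ξ (Sum.inr 0) t‖ ^ 2 : ℝ) : ℂ) = (zeta 1 ξ - I * t) * (zeta 1 ξ + I * t) := by
  have : ‖upd ξ (Sum.inr 0) t‖ ^ 2 = zeta 1 ξ ^ 2 + t ^ 2 := by
    rw [norm_sq_eq, zeta_sq]; simp; ring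
  rw [this]; push_cast
  ring_nf; rw [I_sq]; ring

lemma zeta_pos {j k : Fin 2} {ξ : E} (h : X ξ k ≠ 0) : 0 < zeta j ξ := by
  refine Real.sqrt_pos.2 ?_
  have := sq_pos_of_ne_zero (a := X ξ k) h
  fin_cases k <;> simp at this <;> nlinarith [sq_nonneg (X ξ 0), sq_nonneg (X ξ 1), sq_nonneg (Y ξ j)]

/-! ### Partial fractions and the vanishing of the remainder kernels. -/

lemma partialFraction₁ {x z u : ℂ} (hz : z ≠ 0) (h1 : z - u ≠ 0) (h2 : z + u ≠ 0) :
    (x - u) / ((z - u) * (z + u)) =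
      (x - z) / (2 * z) / (z - u) + (x + z) / (2 * z) / (z + u) := by
  field_simp; ring

lemma partialFraction₂ {x z u : ℂ} (hz : z ≠ 0) (h1 : z - u ≠ 0) (h2 : z + u ≠ 0) :
    (x - u) ^ 2 / ((z - u) * (z + u)) =
      -1 + (x - z) ^ 2 / (2 * z) / (z - u) + (x + z) ^ 2 / (2 * z) / (z + u) := by
  field_simp; ring

lemma partialFraction₃ {x z u : ℂ} (hz : z ≠ 0) (h1 : z - u ≠ 0) (h2 : z + u ≠ 0)
    (h3 : x + u ≠ 0) (h4 : x - z ≠ 0) (h5 : x + z ≠ 0) :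
    (x - u) / ((x + u) * ((z - u) * (z + u))) =
      2 * x / ((z - x) * (z + x)) / (x + u) + (x + z) / ((x - z) * (2 * z)) / (z + u) +
        (x - z) / ((x + z) * (2 * z)) / (z - u) := by
  have h6 : z - x ≠ 0 := by rw [← neg_sub]; exact neg_ne_zero.2 h4
  have h7 : z + x ≠ 0 := by rwa [add_comm]
  have e : z - x = -(x - z) := by ring
  rw [e, add_comm z x]
  field_simp
  ring

/-- Along `η_1` the only pole in the upper half-plane is `η_1 = iζ`. Both terms of the bracket have
the residue coefficient `(x + z)²/(2z) · e^{-zy}` there, so they cancel. -/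
lemma integral_R₁ (hφ : IsTest φ) {q : E} (hq : 0 ≤ Y q 1) : ∫ ξ, R₁ q ξ * ift φ ξ = 0 := by
  refine integral_eq_zero_of_slices (Sum.inr 1) fun ξ hξ => ?_
  have hx1 : X ξ 1 ≠ 0 := hξ _ (by simp)
  have hx0 : X ξ 0 ≠ 0 := hξ _ (by simp)
  have hz : 0 < zeta 0 ξ := zeta_pos hx0
  set z := zeta 0 ξ with hzdef
  set x := X ξ 1 with hxdef
  set y := Y q 1 with hydef
  set c := ex q ξ * (ep 0 q ξ - em 0 q ξ) / rr 0 ξ with hc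
  -- The term with `e^{-ζy}` does not oscillate in `η_1`, so it is evaluated with `y = 0`
  -- (`le_rfl`). The term with `em 1` carries the actual `y`.
  have p1 := (hφ.hasInt_sub ξ 1 hz le_rfl).const_mul ((z + x) * cexp (-(z * y : ℝ)) * ((x - z) / (2 * z)))
  have p2 := (hφ.hasInt_add ξ 1 hz le_rfl).const_mul ((z + x) * cexp (-(z * y : ℝ)) * ((x + z) / (2 * z)))
  have p3 := hφ.hasInt_exp ξ 1 hq
  have p4 := (hφ.hasInt_sub ξ 1 hz hq).const_mul ((x - z) ^ 2 / (2 * z) : ℂ)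
  have p5 := (hφ.hasInt_add ξ 1 hz hq).const_mul ((x + z) ^ 2 / (2 * z) : ℂ)
  have p := ((((p1.add p2).add p3).sub p4).sub p5).const_mul c
  refine Eq.trans (integral_congr_ae (ae_of_all _ fun t => ?_)) (p.eq.trans ?_)
  · have f1 := partialFraction₁ (x := x) (ofReal_ne_zero.2 hz.ne') (sub_I_mul_ne_zero hz.ne' t)
      (add_I_mul_ne_zero hz.ne' t)
    have f2 := partialFraction₂ (x := x) (ofReal_ne_zero.2 hz.ne') (sub_I_mul_ne_zero hz.ne' t)
      (add_I_mul_ne_zero hz.ne' t)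
    have e : R₁ q (upd ξ (Sum.inr 1) t) = c * ((z + x) * cexp (-(z * y : ℝ)) *
        ((x - I * t) / ((z - I * t) * (z + I * t))) -
        (x - I * t) ^ 2 / ((z - I * t) * (z + I * t)) * cexp (I * (t * y))) := by
      simp only [R₁, ex, ep, em, rb, rr, normSq_upd_zero, zeta_upd_zero, X_upd, Y_upd_same,
        Y_upd_zero_one, hc, hzdef, hxdef, hydef, ofReal_mul]
      field_simp
    simp only [e]
    rw [f1, f2]
    simp only [ofReal_zero, mul_zero, Complex.exp_zero]
    ring
  · simp only [mul_zero, ofReal_zero, neg_zero, Complex.exp_zero]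
    have hz' : (z : ℂ) ≠ 0 := ofReal_ne_zero.2 hz.ne'
    field_simp
    ring

/-- `(x + i t)⁻¹` against a test function, for either sign of `x`. -/
lemma IsTest.hasInt_signed (hφ : IsTest φ) (ξ : E) (j : Fin 2) {x y : ℝ} (hx : x ≠ 0)
    (hy : 0 ≤ y) :
    HasInt (fun t : ℝ => ift φ (upd ξ (Sum.inr j) t) * cexp (I * (t * y)) / (x + I * t))
      (if 0 < x then 2 * Real.pi * (cexp (-(x * y : ℝ)) * half (Sum.inr j) x φ ξ) else 0) := by
  split_ifs with h
  · exact hφ.hasInt_add ξ j h hy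
  · have hx' : 0 < -x := by
      rcases lt_or_gt_of_ne hx with h' | h'
      · linarith
      · exact absurd h' h
    have h1 := (hφ.hasInt_sub ξ j hx' hy).const_mul (-1)
    convert h1 using 1
    · funext t
      have e : ((-x : ℝ) - I * t : ℂ) = -(x + I * t) := by push_cast; ring
      rw [e, div_neg, neg_mul, one_mul, neg_neg]
    · simp

/-- There are two possible poles in the upper half-plane of `η_0`. At `iζ` the first two terms
cancel. At `iξ_0`, present only if `ξ_0 > 0`, the residue `2ξ_0 e^{-ξ_0 y}/(ζ² - ξ_0²)` of the
second term is cancelled by the term with `be`; this dictates the definition of `be`, and `ζ² - ξ_0²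
= |r_1|²`. -/
lemma integral_R₂ (hφ : IsTest φ) {q : E} (hq : 0 < Y q 0) : ∫ ξ, R₂ q ξ * ift φ ξ = 0 := by
  refine integral_eq_zero_of_slices (Sum.inr 0) fun ξ hξ => ?_
  have hx1 : X ξ 1 ≠ 0 := hξ _ (by simp)
  have hx : X ξ 0 ≠ 0 := hξ _ (by simp)
  have hz : 0 < zeta 1 ξ := zeta_pos hx
  have hzx : ‖rr 1 ξ‖ ^ 2 = zeta 1 ξ ^ 2 - X ξ 0 ^ 2 := by
    rw [norm_rr_sq, zeta_sq]; ring
  have hzx0 : 0 < zeta 1 ξ ^ 2 - X ξ 0 ^ 2 := by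
    rw [← hzx, norm_rr_sq]; have := sq_pos_of_ne_zero hx1; positivity
  set z := zeta 1 ξ with hzdef
  set x := X ξ 0 with hxdef
  set y := Y q 0 with hydef
  have hxz : x - z ≠ 0 := by rintro h; apply hzx0.ne'; linear_combination -(x + z) * h
  have hxz' : x + z ≠ 0 := by rintro h; apply hzx0.ne'; linear_combination -(x - z) * h
  have gxz : (x - z : ℂ) ≠ 0 := by exact_mod_cast hxz
  have gxz' : (x + z : ℂ) ≠ 0 := by exact_mod_cast hxz'
  have gz : (z : ℂ) ≠ 0 := ofReal_ne_zero.2 hz.ne'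
  have gzx : (z - x : ℂ) ≠ 0 := by rw [← neg_sub]; exact neg_ne_zero.2 gxz
  have gzx' : (z + x : ℂ) ≠ 0 := by rwa [add_comm]
  set c := ex q ξ * (ep 1 q ξ - em 1 q ξ) * rb 1 ξ with hc
  have p1 := (hφ.hasInt_sub ξ 0 hz le_rfl).const_mul (cexp (-(z * y : ℝ)) / (z - x) * ((x - z) / (2 * z)))
  have p2 := (hφ.hasInt_add ξ 0 hz le_rfl).const_mul (cexp (-(z * y : ℝ)) / (z - x) * ((x + z) / (2 * z)))
  have p3 := (hφ.hasInt_signed ξ 0 hx hq.le).const_mul (2 * x / ((z - x) * (z + x)) : ℂ)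
  have p4 := (hφ.hasInt_add ξ 0 hz hq.le).const_mul ((x + z) / ((x - z) * (2 * z)) : ℂ)
  have p5 := (hφ.hasInt_sub ξ 0 hz hq.le).const_mul ((x - z) / ((x + z) * (2 * z)) : ℂ)
  -- Evaluated with `y = 0`: the exponential is already contained in `be`.
  have p6 := (hφ.hasInt_signed ξ 0 hx le_rfl).const_mul
    ((if 0 < x then 2 * x * cexp (-(x * y : ℝ)) else 0) / ((z - x) * (z + x)) : ℂ)
  have p := ((((((p1.add p2).add p3).add p4).add p5)).sub p6).const_mul c
  refine Eq.trans (integral_congr_ae (ae_of_all _ fun t => ?_)) (p.eq.trans ?_)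
  · have f1 := partialFraction₁ (x := x) gz (sub_I_mul_ne_zero hz.ne' t)
      (add_I_mul_ne_zero hz.ne' t)
    have f3 := partialFraction₃ (x := x) gz (sub_I_mul_ne_zero hz.ne' t)
      (add_I_mul_ne_zero hz.ne' t) (add_I_mul_ne_zero hx t) gxz gxz'
    have e0 : be 0 q (upd ξ (Sum.inr 0) t) = if 0 < x then 2 * x * cexp (-(x * y : ℝ)) else 0 := by
      simp only [be, X_upd, expR]
      rw [if_pos hq, sub_zero]
    have e1 : ((‖rr 1 (upd ξ (Sum.inr 0) t)‖ ^ 2 : ℝ) : ℂ) = (z - x) * (z + x) := by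
      have : rr 1 (upd ξ (Sum.inr 0) t) = rr 1 ξ := by simp [rr]
      rw [this, hzx]; push_cast; ring
    have e : R₂ q (upd ξ (Sum.inr 0) t) = c * (cexp (-(z * y : ℝ)) / (z - x) *
        ((x - I * t) / ((z - I * t) * (z + I * t))) +
        (x - I * t) / ((x + I * t) * ((z - I * t) * (z + I * t))) * cexp (I * (t * y)) -
        (if 0 < x then 2 * x * cexp (-(x * y : ℝ)) else 0) / ((z - x) * (z + x)) /
          (x + I * t)) := by
      simp only [R₂, e0, e1]
      simp only [ex, ep, em, rb, rr, normSq_upd_one, zeta_upd_one, X_upd, Y_upd_same,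
        Y_upd_one_zero, hc, ofReal_mul]
      simp only [div_eq_mul_inv, mul_inv]
      ring
    simp only [e]
    rw [f1, f3]
    simp only [ofReal_zero, mul_zero, Complex.exp_zero]
    ring
  · by_cases hx0 : 0 < x
    · simp only [hx0, if_true, mul_zero, ofReal_zero, neg_zero, Complex.exp_zero]
      have : (x - z : ℂ) = -(z - x) := by ring
      rw [this]
      field_simp
      ring
    · simp only [hx0, if_false, mul_zero, ofReal_zero, neg_zero, Complex.exp_zero]
      have : (x - z : ℂ) = -(z - x) := by ring
      rw [this]
      field_simp
      ring

/-- `e^{i η_j |y_j|} - e^{-ξ_j |y_j|}` divided by `ξ_j + i η_j` vanishes against a test function. -/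
lemma IsTest.hasInt_cancel (hφ : IsTest φ) (ξ : E) (j : Fin 2) {x y : ℝ} (hx : x ≠ 0)
    (hy : 0 ≤ y) :
    HasInt (fun t : ℝ => (cexp (I * (t * y)) - if 0 < x then cexp (-(x * y : ℝ)) else 0) /
      (x + I * t) * ift φ (upd ξ (Sum.inr j) t)) 0 := by
  have h := (hφ.hasInt_signed ξ j hx hy).sub ((hφ.hasInt_signed ξ j hx le_rfl).const_mul
    (if 0 < x then cexp (-(x * y : ℝ)) else 0))
  convert h using 1
  · funext t; simp only [ofReal_zero, mul_zero, Complex.exp_zero]; ring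
  · split_ifs
    · simp only [mul_zero, ofReal_zero, neg_zero, Complex.exp_zero]; ring
    · simp

/-- The kernels of the regular representation. -/
def K₁ (q ξ : E) : ℂ := ex q ξ * ep 1 q ξ * (ep 0 q ξ - pe 0 q ξ) / rr 0 ξ

/-- The second kernel of the regular representation. -/
def K₂ (q ξ : E) : ℂ := be 0 q ξ * ex q ξ * (ep 1 q ξ - pe 1 q ξ) / (rr 0 ξ * rr 1 ξ)

/-- The kernels of the canonical solution. -/
def W₁ (q ξ : E) : ℂ := ex q ξ * (ep 0 q ξ - em 0 q ξ) * ep 1 q ξ / rr 0 ξ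

/-- The second kernel of the canonical solution. -/
def W₂ (q ξ : E) : ℂ := be 0 q ξ * ex q ξ * (ep 1 q ξ - em 1 q ξ) / (rr 0 ξ * rr 1 ξ)

end

/-! ### Comparison of the canonical kernels with the regular ones. -/

section

variable {φ : E → ℂ}

lemma integral_W₁_sub_K₁ (hφ : IsTest φ) {q : E} (hq : 0 < Y q 0) :
    ∫ ξ, (W₁ q ξ - K₁ q ξ) * ift φ ξ = 0 := by
  refine integral_eq_zero_of_slices (Sum.inr 0) fun ξ hξ => ?_
  have hx : X ξ 0 ≠ 0 := hξ _ (by simp)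
  have p := (hφ.hasInt_cancel ξ 0 hx hq.le).const_mul (-(ex q ξ * ep 1 q ξ))
  refine Eq.trans (integral_congr_ae (ae_of_all _ fun t => ?_)) (p.eq.trans (mul_zero _))
  simp only [W₁, K₁, ex, ep, em, pe, rr, X_upd, Y_upd_same, Y_upd_one_zero, abs_of_pos hq,
    ofReal_mul]
  ring

/-- For `y_0 < 0` the wave `ep 0` is itself `e^{iη_0 |y_0|}`, with the same residue as `pe 0`. The
absolute value in `pe` is there for this cancellation. -/
lemma integral_K₁_of_neg_zero (hφ : IsTest φ) {q : E} (hq : Y q 0 < 0) :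
    ∫ ξ, K₁ q ξ * ift φ ξ = 0 := by
  refine integral_eq_zero_of_slices (Sum.inr 0) fun ξ hξ => ?_
  have hx : X ξ 0 ≠ 0 := hξ _ (by simp)
  have p := (hφ.hasInt_cancel ξ 0 (y := -Y q 0) hx (by linarith)).const_mul (ex q ξ * ep 1 q ξ)
  refine Eq.trans (integral_congr_ae (ae_of_all _ fun t => ?_)) (p.eq.trans (mul_zero _))
  simp only [K₁, ex, ep, pe, rr, X_upd, Y_upd_same, Y_upd_one_zero, abs_of_neg hq,
    ofReal_mul, ofReal_neg, mul_neg, neg_mul]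
  ring

lemma integral_K₁_of_neg_one (hφ : IsTest φ) {q : E} (hq : Y q 1 < 0) :
    ∫ ξ, K₁ q ξ * ift φ ξ = 0 := by
  refine integral_eq_zero_of_slices (Sum.inr 1) fun ξ hξ => ?_
  have p := (hφ.hasInt_exp ξ 1 (y := -Y q 1) (by linarith)).const_mul
    (ex q ξ * (ep 0 q ξ - pe 0 q ξ) / rr 0 ξ)
  refine Eq.trans (integral_congr_ae (ae_of_all _ fun t => ?_)) (p.eq.trans (mul_zero _))
  simp only [K₁, ex, ep, pe, rr, X_upd, Y_upd_same, Y_upd_zero_one,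
    ofReal_mul, ofReal_neg, mul_neg, neg_mul]
  ring

lemma integral_W₂_sub_K₂ (hφ : IsTest φ) {q : E} (hq : 0 < Y q 1) :
    ∫ ξ, (W₂ q ξ - K₂ q ξ) * ift φ ξ = 0 := by
  refine integral_eq_zero_of_slices (Sum.inr 1) fun ξ hξ => ?_
  have hx : X ξ 1 ≠ 0 := hξ _ (by simp)
  have p := (hφ.hasInt_cancel ξ 1 hx hq.le).const_mul (-(be 0 q ξ * ex q ξ / rr 0 ξ))
  refine Eq.trans (integral_congr_ae (ae_of_all _ fun t => ?_)) (p.eq.trans (mul_zero _))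
  simp only [W₂, K₂, be, ex, ep, em, pe, rr, X_upd, Y_upd_same, Y_upd_zero_one, abs_of_pos hq,
    ofReal_mul, div_eq_mul_inv, mul_inv]
  ring

lemma integral_K₂_of_neg (hφ : IsTest φ) {q : E} (hq : Y q 1 < 0) :
    ∫ ξ, K₂ q ξ * ift φ ξ = 0 := by
  refine integral_eq_zero_of_slices (Sum.inr 1) fun ξ hξ => ?_
  have hx : X ξ 1 ≠ 0 := hξ _ (by simp)
  have p := (hφ.hasInt_cancel ξ 1 (y := -Y q 1) hx (by linarith)).const_mul
    (be 0 q ξ * ex q ξ / rr 0 ξ)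
  refine Eq.trans (integral_congr_ae (ae_of_all _ fun t => ?_)) (p.eq.trans (mul_zero _))
  simp only [K₂, be, ex, ep, pe, rr, X_upd, Y_upd_same, Y_upd_zero_one, abs_of_neg hq,
    ofReal_mul, ofReal_neg, mul_neg, neg_mul, div_eq_mul_inv, mul_inv]
  ring

/-! ### Measurability and bounds of the kernels -/

@[fun_prop] lemma measurable_zeta (j : Fin 2) : Measurable (zeta j) := by
  unfold zeta; fun_prop

@[fun_prop] lemma measurable_ex : Measurable fun z : E × E => ex z.1 z.2 := by
  unfold ex; fun_prop

@[fun_prop] lemma measurable_ep (j : Fin 2) : Measurable fun z : E × E => ep j z.1 z.2 := by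
  unfold ep; fun_prop

@[fun_prop] lemma measurable_em (j : Fin 2) : Measurable fun z : E × E => em j z.1 z.2 := by
  unfold em; fun_prop

@[fun_prop] lemma measurable_pe (j : Fin 2) : Measurable fun z : E × E => pe j z.1 z.2 := by
  unfold pe
  exact Measurable.ite (measurableSet_lt (by fun_prop) (by fun_prop)) (by fun_prop) (by fun_prop)

@[fun_prop] lemma measurable_be (j : Fin 2) : Measurable fun z : E × E => be j z.1 z.2 := by
  unfold be
  refine Measurable.ite (measurableSet_lt (by fun_prop) (by fun_prop)) ?_ (by fun_prop)
  have h : Measurable fun z : E × E => expR (X z.2 j) 0 (Y z.1 j) :=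
    measurable_expR.comp
      (by fun_prop : Measurable fun z : E × E => (X z.2 j, ((0 : ℝ), Y z.1 j)))
  have h2 : Measurable fun z : E × E => (2 * X z.2 j : ℂ) := by fun_prop
  exact h2.mul h

lemma measurable_R₁ : Measurable fun z : E × E => R₁ z.1 z.2 := by
  unfold R₁; fun_prop

lemma measurable_R₂ : Measurable fun z : E × E => R₂ z.1 z.2 := by
  unfold R₂; fun_prop

lemma measurable_W₁ : Measurable fun z : E × E => W₁ z.1 z.2 := by
  unfold W₁; fun_prop

lemma measurable_W₂ : Measurable fun z : E × E => W₂ z.1 z.2 := by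
  unfold W₂; fun_prop

lemma measurable_K₁ : Measurable fun z : E × E => K₁ z.1 z.2 := by
  unfold K₁; fun_prop

lemma measurable_K₂ : Measurable fun z : E × E => K₂ z.1 z.2 := by
  unfold K₂; fun_prop

@[simp] lemma norm_ex (q ξ : E) : ‖ex q ξ‖ = 1 := norm_cexp_neg_I_mul _
@[simp] lemma norm_ep (j : Fin 2) (q ξ : E) : ‖ep j q ξ‖ = 1 := norm_cexp_neg_I_mul _
@[simp] lemma norm_em (j : Fin 2) (q ξ : E) : ‖em j q ξ‖ = 1 := norm_cexp_I_mul _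

lemma norm_cexp_neg_le {x : ℝ} (hx : 0 ≤ x) : ‖cexp (-(x : ℂ))‖ ≤ 1 := by
  rw [norm_exp, ← ofReal_neg, ofReal_re, Real.exp_le_one_iff]; linarith

lemma norm_pe_le (j : Fin 2) (q ξ : E) : ‖pe j q ξ‖ ≤ 1 := by
  unfold pe
  split_ifs with h
  · exact norm_cexp_neg_le (by positivity)
  · simp

lemma norm_odd_le (j : Fin 2) (q ξ : E) : ‖ep j q ξ - em j q ξ‖ ≤ 2 := by
  refine (norm_sub_le _ _).trans ?_; simp; norm_num

lemma norm_ep_sub_pe_le (j : Fin 2) (q ξ : E) : ‖ep j q ξ - pe j q ξ‖ ≤ 2 := by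
  refine (norm_sub_le _ _).trans ?_
  have := norm_pe_le j q ξ
  simp; linarith

lemma abs_X_le (j : Fin 2) (ξ : E) : |X ξ j| ≤ ‖rr j ξ‖ := abs_le_norm_add_I_mul _ _

lemma norm_be_le (j : Fin 2) (q ξ : E) : ‖be j q ξ‖ ≤ 2 * ‖rr j ξ‖ := by
  unfold be
  split_ifs with h
  · rw [norm_mul, norm_mul, norm_real, Real.norm_eq_abs]
    have h1 := norm_expR_le h.le 0 (Y q j)
    have h2 := abs_X_le j ξ
    have h3 : ‖(2 : ℂ)‖ = 2 := by simp
    rw [h3]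
    nlinarith [abs_nonneg (X ξ j), norm_nonneg (expR (X ξ j) 0 (Y q j))]
  · simp

lemma norm_W₁_le (q ξ : E) : ‖W₁ q ξ‖ ≤ 10 * wt ξ := by
  have h1 := norm_odd_le 0 q ξ
  have h2 := inv_le_wt 0 ξ
  have h3 : 0 ≤ ‖rr 0 ξ‖⁻¹ := by positivity
  simp only [W₁, norm_inv, norm_mul, norm_ex, norm_ep, one_mul, mul_one, div_eq_mul_inv]
  nlinarith

lemma norm_K₁_le (q ξ : E) : ‖K₁ q ξ‖ ≤ 10 * wt ξ := by
  have h1 := norm_ep_sub_pe_le 0 q ξ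
  have h2 := inv_le_wt 0 ξ
  have h3 : 0 ≤ ‖rr 0 ξ‖⁻¹ := by positivity
  simp only [K₁, norm_inv, norm_mul, norm_ex, norm_ep, one_mul, mul_one, div_eq_mul_inv]
  nlinarith

/-- `be 0` is of size `2|r_0|` and cancels the pole at `r_0 = 0`; only `1/|r_1|` remains. -/
lemma norm_be_mul_le (q ξ : E) {c : ℂ} (hc : ‖c‖ ≤ 2) :
    ‖be 0 q ξ * ex q ξ * c / (rr 0 ξ * rr 1 ξ)‖ ≤ 10 * wt ξ := by
  have h1 := norm_be_le 0 q ξ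
  have h2 := inv_le_wt 1 ξ
  have h3 : 0 ≤ ‖rr 1 ξ‖⁻¹ := by positivity
  have h5 : ‖rr 0 ξ‖ * ‖rr 0 ξ‖⁻¹ ≤ 1 := mul_inv_le_one
  rw [norm_div, norm_mul, norm_mul, norm_mul, norm_ex, div_eq_mul_inv, mul_inv]
  calc ‖be 0 q ξ‖ * 1 * ‖c‖ * (‖rr 0 ξ‖⁻¹ * ‖rr 1 ξ‖⁻¹)
      ≤ (2 * ‖rr 0 ξ‖) * 1 * 2 * (‖rr 0 ξ‖⁻¹ * ‖rr 1 ξ‖⁻¹) := by gcongr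
    _ = 4 * (‖rr 0 ξ‖ * ‖rr 0 ξ‖⁻¹) * ‖rr 1 ξ‖⁻¹ := by ring
    _ ≤ 4 * 1 * wt ξ := by gcongr
    _ ≤ 10 * wt ξ := by linarith [wt_nonneg ξ]

lemma norm_W₂_le (q ξ : E) : ‖W₂ q ξ‖ ≤ 10 * wt ξ := norm_be_mul_le q ξ (norm_odd_le 1 q ξ)

lemma norm_K₂_le (q ξ : E) : ‖K₂ q ξ‖ ≤ 10 * wt ξ := norm_be_mul_le q ξ (norm_ep_sub_pe_le 1 q ξ)

lemma norm_sq_eq_rr (ξ : E) : ‖ξ‖ ^ 2 = ‖rr 0 ξ‖ ^ 2 + ‖rr 1 ξ‖ ^ 2 := by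
  rw [norm_sq_eq, norm_rr_sq, norm_rr_sq]; ring

lemma norm_rr_le (j : Fin 2) (ξ : E) : ‖rr j ξ‖ ≤ ‖ξ‖ := by
  refine abs_le_of_sq_le_sq' ?_ (norm_nonneg _) |>.2
  rw [norm_sq_eq_rr]
  fin_cases j <;> simp

lemma zeta_le (j : Fin 2) (ξ : E) : zeta j ξ ≤ ‖ξ‖ := by
  refine abs_le_of_sq_le_sq' ?_ (norm_nonneg _) |>.2
  rw [norm_sq_eq, zeta_sq]
  fin_cases j <;> simp <;> nlinarith [sq_nonneg (Y ξ 0), sq_nonneg (Y ξ 1)]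

lemma abs_X_le_norm (j : Fin 2) (ξ : E) : |X ξ j| ≤ ‖ξ‖ := (abs_X_le j ξ).trans (norm_rr_le j ξ)

/-- The numerators have degree two and absorb `|ξ|²`, leaving `1/|r_0|`. Membership in `Ω` bounds
`e^{-ζ y_1}` by `1`. -/
lemma norm_R₁_le {q : E} (hq : q ∈ Ω) (ξ : E) : ‖R₁ q ξ‖ ≤ 20 * wt ξ := by
  have h1 := norm_odd_le 0 q ξ
  have h2 := inv_le_wt 0 ξ
  have h5 : ‖ξ‖ ^ 2 * (‖ξ‖ ^ 2)⁻¹ ≤ 1 := mul_inv_le_one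
  have hA : ‖(zeta 0 ξ + X ξ 1) * cexp (-(zeta 0 ξ * Y q 1 : ℝ)) - rb 1 ξ * em 1 q ξ‖ ≤
      3 * ‖ξ‖ := by
    refine (norm_sub_le _ _).trans ?_
    rw [norm_mul, norm_mul, norm_em, norm_rb, mul_one]
    have e1 : ‖(zeta 0 ξ + X ξ 1 : ℂ)‖ ≤ 2 * ‖ξ‖ := by
      refine (norm_add_le _ _).trans ?_
      rw [norm_real, norm_real, Real.norm_eq_abs, Real.norm_eq_abs, abs_of_nonneg (zeta_nonneg 0 ξ)]
      linarith [zeta_le 0 ξ, abs_X_le_norm 1 ξ]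
    have e2 : ‖cexp (-(zeta 0 ξ * Y q 1 : ℝ))‖ ≤ 1 :=
      norm_cexp_neg_le (mul_nonneg (zeta_nonneg 0 ξ) (hq 1).le)
    have e3 := norm_rr_le 1 ξ
    nlinarith [norm_nonneg (zeta 0 ξ + X ξ 1 : ℂ)]
  have e3 := norm_rr_le 1 ξ
  have hn : ‖((‖ξ‖ ^ 2 : ℝ) : ℂ)‖ = ‖ξ‖ ^ 2 := by
    rw [norm_real, Real.norm_of_nonneg (by positivity)]
  rw [R₁, norm_mul, norm_div, norm_mul, norm_mul, norm_mul, norm_ex, norm_rb, hn, div_eq_mul_inv,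
    mul_inv]
  calc _ ≤ 1 * 2 * ‖ξ‖ * (‖rr 0 ξ‖⁻¹ * (‖ξ‖ ^ 2)⁻¹) * (3 * ‖ξ‖) := by gcongr
    _ = 6 * (‖ξ‖ ^ 2 * (‖ξ‖ ^ 2)⁻¹) * ‖rr 0 ξ‖⁻¹ := by ring
    _ ≤ 6 * 1 * wt ξ := by gcongr
    _ ≤ 20 * wt ξ := by linarith [wt_nonneg ξ]

/-- From `(ζ - ξ_0)(ζ + ξ_0) = |r_1|²`. The denominator `ζ - ξ_0` degenerates quadratically at `r_1
= 0` when `ξ_0 > 0`, and the spare factor `r_1` reduces this to an integrable singularity. -/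
lemma rr_one_mul_inv_le (ξ : E) : ‖rr 1 ξ‖ * |zeta 1 ξ - X ξ 0|⁻¹ ≤ 2 * ‖ξ‖ * ‖rr 1 ξ‖⁻¹ := by
  by_cases h : ‖rr 1 ξ‖ = 0
  · simp [h]
  have e : ‖rr 1 ξ‖ ^ 2 = (zeta 1 ξ - X ξ 0) * (zeta 1 ξ + X ξ 0) := by
    have := zeta_sq 1 ξ
    rw [norm_rr_sq]; linear_combination -this
  have h0 : zeta 1 ξ - X ξ 0 ≠ 0 := by
    intro h0; rw [h0, zero_mul] at e; exact h (pow_eq_zero_iff (two_ne_zero) |>.1 e)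
  have hp : 0 < ‖rr 1 ξ‖ := lt_of_le_of_ne (norm_nonneg _) (Ne.symm h)
  have hp' : 0 < |zeta 1 ξ - X ξ 0| := abs_pos.2 h0
  rw [← div_eq_mul_inv, ← div_eq_mul_inv, div_le_div_iff₀ hp' hp]
  calc ‖rr 1 ξ‖ * ‖rr 1 ξ‖ = |(zeta 1 ξ - X ξ 0) * (zeta 1 ξ + X ξ 0)| := by
        rw [← e, abs_of_nonneg (by positivity), sq]
    _ = |zeta 1 ξ + X ξ 0| * |zeta 1 ξ - X ξ 0| := by rw [abs_mul, mul_comm]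
    _ ≤ 2 * ‖ξ‖ * |zeta 1 ξ - X ξ 0| := by
        gcongr
        refine (abs_add_le _ _).trans ?_
        rw [abs_of_nonneg (zeta_nonneg 1 ξ)]
        linarith [zeta_le 1 ξ, abs_X_le_norm 0 ξ]

lemma norm_R₂_le {q : E} (hq : q ∈ Ω) (ξ : E) : ‖R₂ q ξ‖ ≤ 20 * wt ξ := by
  have h1 := norm_odd_le 1 q ξ
  have h2 := inv_le_wt 1 ξ
  have h5 : ‖ξ‖ ^ 2 * (‖ξ‖ ^ 2)⁻¹ ≤ 1 := mul_inv_le_one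
  have h6 : ‖rr 0 ξ‖ * ‖rr 0 ξ‖⁻¹ ≤ 1 := mul_inv_le_one
  have h7 := rr_one_mul_inv_le ξ
  have h8 := norm_rr_le 0 ξ
  have h9 := norm_rr_le 1 ξ
  have e2 : ‖cexp (-(zeta 1 ξ * Y q 0 : ℝ))‖ ≤ 1 :=
    norm_cexp_neg_le (mul_nonneg (zeta_nonneg 1 ξ) (hq 0).le)
  have hn : ‖((‖ξ‖ ^ 2 : ℝ) : ℂ)‖ = ‖ξ‖ ^ 2 := by
    rw [norm_real, Real.norm_of_nonneg (by positivity)]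
  have hn' : ‖((‖rr 1 ξ‖ ^ 2 : ℝ) : ℂ)‖ = ‖rr 1 ξ‖ ^ 2 := by
    rw [norm_real, Real.norm_of_nonneg (by positivity)]
  have hz : ‖(zeta 1 ξ - X ξ 0 : ℂ)‖ = |zeta 1 ξ - X ξ 0| := by
    rw [← ofReal_sub, norm_real, Real.norm_eq_abs]
  have hinv : ‖rr 1 ξ‖ * (‖ξ‖ ^ 2)⁻¹ ≤ ‖rr 1 ξ‖⁻¹ := by
    by_cases h : ‖rr 1 ξ‖ = 0
    · simp [h]
    have hp : 0 < ‖rr 1 ξ‖ := lt_of_le_of_ne (norm_nonneg _) (Ne.symm h)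
    have hp' : 0 < ‖ξ‖ := hp.trans_le h9
    rw [← div_eq_mul_inv, div_le_iff₀ (by positivity), inv_mul_eq_div, le_div_iff₀ hp]
    nlinarith
  have t1 : ‖rr 1 ξ‖ * ‖rb 0 ξ / ((zeta 1 ξ - X ξ 0) * (‖ξ‖ ^ 2 : ℝ)) *
      cexp (-(zeta 1 ξ * Y q 0 : ℝ))‖ ≤ 2 * wt ξ := by
    rw [norm_mul, norm_div, norm_mul, hn, hz, norm_rb, div_eq_mul_inv, mul_inv]
    calc _ ≤ ‖rr 1 ξ‖ * (‖ξ‖ * (|zeta 1 ξ - X ξ 0|⁻¹ * (‖ξ‖ ^ 2)⁻¹) * 1) := by gcongr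
      _ = (‖rr 1 ξ‖ * |zeta 1 ξ - X ξ 0|⁻¹) * (‖ξ‖ * (‖ξ‖ ^ 2)⁻¹) := by ring
      _ ≤ (2 * ‖ξ‖ * ‖rr 1 ξ‖⁻¹) * (‖ξ‖ * (‖ξ‖ ^ 2)⁻¹) := by gcongr
      _ = 2 * (‖ξ‖ ^ 2 * (‖ξ‖ ^ 2)⁻¹) * ‖rr 1 ξ‖⁻¹ := by ring
      _ ≤ 2 * 1 * wt ξ := by gcongr
      _ = 2 * wt ξ := by ring
  have t2 : ‖rr 1 ξ‖ * ‖rb 0 ξ / (rr 0 ξ * (‖ξ‖ ^ 2 : ℝ)) * em 0 q ξ‖ ≤ wt ξ := by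
    rw [norm_mul, norm_div, norm_mul, hn, norm_em, norm_rb, div_eq_mul_inv, mul_inv]
    calc _ = (‖rr 0 ξ‖ * ‖rr 0 ξ‖⁻¹) * (‖rr 1 ξ‖ * (‖ξ‖ ^ 2)⁻¹) := by ring
      _ ≤ 1 * wt ξ := by gcongr; exact hinv.trans h2
      _ = wt ξ := one_mul _
  have t3 : ‖rr 1 ξ‖ * ‖be 0 q ξ / (rr 0 ξ * (‖rr 1 ξ‖ ^ 2 : ℝ))‖ ≤ 2 * wt ξ := by
    rw [norm_div, norm_mul, hn', div_eq_mul_inv, mul_inv]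
    have h10 : ‖rr 1 ξ‖ * (‖rr 1 ξ‖ ^ 2)⁻¹ ≤ ‖rr 1 ξ‖⁻¹ := by
      by_cases h : ‖rr 1 ξ‖ = 0
      · simp [h]
      · rw [sq, mul_inv, mul_inv_cancel_left₀ h]
    calc _ ≤ ‖rr 1 ξ‖ * (2 * ‖rr 0 ξ‖ * (‖rr 0 ξ‖⁻¹ * (‖rr 1 ξ‖ ^ 2)⁻¹)) := by
          gcongr; exact norm_be_le 0 q ξ
      _ = 2 * (‖rr 0 ξ‖ * ‖rr 0 ξ‖⁻¹) * (‖rr 1 ξ‖ * (‖rr 1 ξ‖ ^ 2)⁻¹) := by ring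
      _ ≤ 2 * 1 * wt ξ := by gcongr; exact h10.trans h2
      _ = 2 * wt ξ := by ring
  rw [R₂, norm_mul, norm_mul, norm_mul, norm_ex, norm_rb, one_mul]
  have t := norm_sub_le (rb 0 ξ / ((zeta 1 ξ - X ξ 0) * (‖ξ‖ ^ 2 : ℝ)) *
      cexp (-(zeta 1 ξ * Y q 0 : ℝ)) + rb 0 ξ / (rr 0 ξ * (‖ξ‖ ^ 2 : ℝ)) * em 0 q ξ)
      (be 0 q ξ / (rr 0 ξ * (‖rr 1 ξ‖ ^ 2 : ℝ)))
  have t' := t.trans (add_le_add_left (norm_add_le _ _) _)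
  calc _ ≤ 2 * ‖rr 1 ξ‖ * _ := mul_le_mul (mul_le_mul_of_nonneg_right h1 (norm_nonneg _)) t'
        (norm_nonneg _) (by positivity)
    _ ≤ 20 * wt ξ := by linarith [wt_nonneg ξ]

/-! ### Integrability of the kernels -/

lemma integrable_kernel {κ : E → ℂ} (hm : Measurable κ) {C : ℝ} (hb : ∀ ξ, ‖κ ξ‖ ≤ C * wt ξ)
    {Φ : E → ℂ} (hΦm : Measurable Φ) {D : ℝ} (hΦ : ∀ ξ, ‖Φ ξ‖ ≤ D * decay ξ) :
    Integrable fun ξ => κ ξ * Φ ξ := by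
  refine Integrable.mono' (integrable_wt_mul_decay.const_mul (C * D))
    (hm.mul hΦm).aestronglyMeasurable (ae_of_all _ fun ξ => ?_)
  rw [norm_mul]
  calc ‖κ ξ‖ * ‖Φ ξ‖ ≤ (C * wt ξ) * (D * decay ξ) :=
        mul_le_mul (hb ξ) (hΦ ξ) (norm_nonneg _) ((norm_nonneg _).trans (hb ξ))
    _ = C * D * (wt ξ * decay ξ) := by ring

lemma integrable_kernel_prod {κ : E → E → ℂ} (hm : Measurable fun z : E × E => κ z.1 z.2)
    {S : Set E} (hS : MeasurableSet S) {C : ℝ} (hb : ∀ q ∈ S, ∀ ξ, ‖κ q ξ‖ ≤ C * wt ξ)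
    (G : 𝓢(E, ℂ)) {Φ : E → ℂ} (hΦm : Measurable Φ) {D : ℝ} (hΦ : ∀ ξ, ‖Φ ξ‖ ≤ D * decay ξ) :
    Integrable (fun z : E × E => G z.1 * (κ z.1 z.2 * Φ z.2))
      ((volume.restrict S).prod volume) := by
  have h1 : Integrable (fun z : E × E => ‖G z.1‖ * (C * D * (wt z.2 * decay z.2)))
      ((volume.restrict S).prod volume) :=
    (G.integrable.norm.restrict (s := S)).mul_prod (integrable_wt_mul_decay.const_mul (C * D))
  refine Integrable.mono' h1 (Measurable.aestronglyMeasurable ?_) ?_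
  · exact (G.continuous.measurable.comp measurable_fst).mul (hm.mul (hΦm.comp measurable_snd))
  · have : ∀ᵐ z : E × E ∂((volume.restrict S).prod volume), z.1 ∈ S :=
      Measure.quasiMeasurePreserving_fst.ae (ae_restrict_mem hS)
    filter_upwards [this] with z hz
    rw [norm_mul, norm_mul]
    refine mul_le_mul_of_nonneg_left ?_ (norm_nonneg _)
    calc ‖κ z.1 z.2‖ * ‖Φ z.2‖ ≤ (C * wt z.2) * (D * decay z.2) :=
          mul_le_mul (hb _ hz _) (hΦ _) (norm_nonneg _) ((norm_nonneg _).trans (hb _ hz _))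
      _ = C * D * (wt z.2 * decay z.2) := by ring

/-- Fubini, with the product majorant `|G(q)| · wt ξ · decay ξ`. Afterwards a kernel can be studied
for one fixed `q` at a time. -/
lemma integral_kernel_swap {κ : E → E → ℂ} (hm : Measurable fun z : E × E => κ z.1 z.2)
    {S : Set E} (hS : MeasurableSet S) {C : ℝ} (hb : ∀ q ∈ S, ∀ ξ, ‖κ q ξ‖ ≤ C * wt ξ)
    (G : 𝓢(E, ℂ)) {Φ : E → ℂ} (hΦm : Measurable Φ) {D : ℝ} (hΦ : ∀ ξ, ‖Φ ξ‖ ≤ D * decay ξ) :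
    Integrable (fun ξ => (∫ q in S, G q * κ q ξ) * Φ ξ) ∧
    ∫ ξ, (∫ q in S, G q * κ q ξ) * Φ ξ = ∫ q in S, G q * ∫ ξ, κ q ξ * Φ ξ := by
  have h := integrable_kernel_prod hm hS hb G hΦm hΦ
  have e : ∀ ξ, (∫ q in S, G q * κ q ξ) * Φ ξ = ∫ q in S, G q * (κ q ξ * Φ ξ) := by
    intro ξ
    rw [← integral_mul_const]
    simp only [mul_assoc]
  simp only [e]
  refine ⟨h.integral_prod_right, ?_⟩
  rw [← integral_integral_swap h]
  simp only [integral_const_mul]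

/-! ### Passage from integrals over the domain to integrals over the whole space. -/

lemma isOpen_Ω : IsOpen Ω := by
  have : Ω = ⋂ j, {p : E | 0 < Y p j} := by ext p; simp [Ω]
  rw [this]
  exact isOpen_iInter_of_finite fun j => isOpen_lt continuous_const (continuous_Y j)

lemma measurableSet_Ω : MeasurableSet Ω := isOpen_Ω.measurableSet

lemma mem_Ω {q : E} : q ∈ Ω ↔ 0 < Y q 0 ∧ 0 < Y q 1 := by
  simp [Ω, Fin.forall_fin_two]

/-- For `q ∈ Ω` the kernels `K`, `W` and `W + R` have the same pairing with `ift φ`, and for almost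
every other `q` the pairing of `K` is zero. So the cut-off of `G` to `Ω`, which would destroy the
decay of its transform, may be dropped. -/
lemma integral_K_eq_indicator {K W R : E → E → ℂ}
    (hKm : Measurable fun z : E × E => K z.1 z.2) (hWm : Measurable fun z : E × E => W z.1 z.2)
    (hRm : Measurable fun z : E × E => R z.1 z.2)
    (hK : ∀ q ξ, ‖K q ξ‖ ≤ 10 * wt ξ) (hW : ∀ q ξ, ‖W q ξ‖ ≤ 10 * wt ξ)
    (hR : ∀ q ∈ Ω, ∀ ξ, ‖R q ξ‖ ≤ 20 * wt ξ) (hφ : IsTest φ)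
    (h1 : ∀ q ∈ Ω, ∫ ξ, R q ξ * ift φ ξ = 0)
    (h2 : ∀ q ∈ Ω, ∫ ξ, (W q ξ - K q ξ) * ift φ ξ = 0)
    (h3 : ∀ q, q ∉ Ω → (∀ j, q j ≠ 0) → ∫ ξ, K q ξ * ift φ ξ = 0) (G : 𝓢(E, ℂ)) :
    ∫ ξ, (∫ q, G q * K q ξ) * ift φ ξ =
      ∫ ξ, (∫ q in Ω, G q * (W q ξ + R q ξ)) * ift φ ξ := by
  obtain ⟨C, _, hC⟩ := hφ.ift_bound
  have hm := hφ.continuous_ift.measurable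
  have s1 := (integral_kernel_swap hKm MeasurableSet.univ (fun q _ => hK q) G hm hC).2
  have s2 := (integral_kernel_swap (κ := fun q ξ => W q ξ + R q ξ) (C := 30) (hWm.add hRm)
    measurableSet_Ω (fun q hq ξ => (norm_add_le _ _).trans
      (by linarith [hW q ξ, hR q hq ξ])) G hm hC).2
  simp only [Measure.restrict_univ] at s1
  rw [s1, s2, ← integral_indicator measurableSet_Ω]
  refine integral_congr_ae ?_
  filter_upwards [ae_ne_zero] with q hq
  by_cases hqΩ : q ∈ Ω
  · rw [indicator_of_mem hqΩ]
    congr 1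
    have iK := integrable_kernel (κ := fun ξ => K q ξ) (hKm.comp measurable_prodMk_left) (hK q) hm hC
    have iW := integrable_kernel (κ := fun ξ => W q ξ) (hWm.comp measurable_prodMk_left) (hW q) hm hC
    have iR := integrable_kernel (κ := fun ξ => R q ξ) (hRm.comp measurable_prodMk_left) (hR q hqΩ) hm hC
    have a2 := h2 q hqΩ
    simp only [sub_mul] at a2
    rw [integral_sub iW iK, sub_eq_zero] at a2
    simp only [add_mul]
    rw [integral_add iW iR, h1 q hqΩ, add_zero, a2]
  · rw [indicator_of_notMem hqΩ, h3 q hqΩ hq, mul_zero]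

lemma integral_K₁_eq (hφ : IsTest φ) (G : 𝓢(E, ℂ)) :
    ∫ ξ, (∫ q, G q * K₁ q ξ) * ift φ ξ =
      ∫ ξ, (∫ q in Ω, G q * (W₁ q ξ + R₁ q ξ)) * ift φ ξ := by
  refine integral_K_eq_indicator measurable_K₁ measurable_W₁ measurable_R₁ norm_K₁_le norm_W₁_le
    (fun q hq => norm_R₁_le hq) hφ (fun q hq => integral_R₁ hφ (hq 1).le)
    (fun q hq => integral_W₁_sub_K₁ hφ (hq 0)) (fun q hq h0 => ?_) G
  rcases lt_or_gt_of_ne (h0 (Sum.inr 0)) with h | h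
  · exact integral_K₁_of_neg_zero hφ h
  · rcases lt_or_gt_of_ne (h0 (Sum.inr 1)) with h' | h'
    · exact integral_K₁_of_neg_one hφ h'
    · exact absurd (mem_Ω.2 ⟨h, h'⟩) hq

lemma integral_K₂_eq (hφ : IsTest φ) (G : 𝓢(E, ℂ)) :
    ∫ ξ, (∫ q, G q * K₂ q ξ) * ift φ ξ =
      ∫ ξ, (∫ q in Ω, G q * (W₂ q ξ + R₂ q ξ)) * ift φ ξ := by
  refine integral_K_eq_indicator measurable_K₂ measurable_W₂ measurable_R₂ norm_K₂_le norm_W₂_le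
    (fun q hq => norm_R₂_le hq) hφ (fun q hq => integral_R₂ hφ (hq 0))
    (fun q hq => integral_W₂_sub_K₂ hφ (hq 1)) (fun q hq h0 => ?_) G
  rcases lt_or_gt_of_ne (h0 (Sum.inr 0)) with h | h
  -- The cut-off to `y_0 > 0` is built into `be`.
  · have : ∀ ξ, K₂ q ξ = 0 := fun ξ => by
      have : ¬ 0 < Y q 0 := not_lt.2 (le_of_lt h)
      simp [K₂, be, expR, this]
    simp [this]
  · rcases lt_or_gt_of_ne (h0 (Sum.inr 1)) with h' | h'
    · exact integral_K₂_of_neg hφ h'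
    · exact absurd (mem_Ω.2 ⟨h, h'⟩) hq

end

section

open scoped LineDeriv

/-! ### Integration by parts -/

/-- The partial derivative along the `i`-th coordinate. -/
def pd (i : Idx) (g : E → ℂ) (p : E) : ℂ := fderiv ℝ g p (EuclideanSpace.single i 1)

/-- `u'` is the derivative of `u` along the `i`-th coordinate, and both decay. -/
structure SliceDeriv (i : Idx) (u u' : E → ℂ) : Prop where
  meas : Measurable u
  meas' : Measurable u'
  bound : ∃ C, ∀ p, ‖u p‖ ≤ C * decay p
  bound' : ∃ C, ∀ p, ‖u' p‖ ≤ C * decay p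
  deriv : ∀ q t, HasDerivAt (fun t => u (upd q i t)) (u' (upd q i t)) t

namespace SliceDeriv

variable {i : Idx} {u u' : E → ℂ}

lemma integrable_slice (h : SliceDeriv i u u') (q : E) : Integrable fun t => u (upd q i t) := by
  obtain ⟨C, hC⟩ := h.bound
  exact integrable_slice_of_le_decay h.meas hC q i

lemma integrable_slice' (h : SliceDeriv i u u') (q : E) : Integrable fun t => u' (upd q i t) := by
  obtain ⟨C, hC⟩ := h.bound'
  exact integrable_slice_of_le_decay h.meas' hC q i

lemma integral_eq_zero (h : SliceDeriv i u u') : ∫ p, u' p = 0 :=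
  integral_eq_zero_of_slices i fun q _ => integral_eq_zero_of_hasDerivAt_of_integrable
    (h.deriv q) (h.integrable_slice' q) (h.integrable_slice q)

lemma integral_Ω_inl {j : Fin 2} (h : SliceDeriv (Sum.inl j) u u') : ∫ p in Ω, u' p = 0 := by
  rw [← integral_indicator measurableSet_Ω]
  refine integral_eq_zero_of_slices (Sum.inl j) fun q _ => ?_
  have e : ∀ t, upd q (Sum.inl j) t ∈ Ω ↔ q ∈ Ω := fun t => by simp [Ω, Y, upd_apply]
  by_cases hq : q ∈ Ω
  · simp only [indicator, e, hq, if_true]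
    exact integral_eq_zero_of_hasDerivAt_of_integrable
      (h.deriv q) (h.integrable_slice' q) (h.integrable_slice q)
  · simp only [indicator, e, hq, if_false, integral_zero]

/-- Each slice meets `Ω` in a half-line or not at all; the boundary term of the fundamental theorem
is the value at `y_j = 0`, which is zero by `h0`. -/
lemma integral_Ω_inr {j : Fin 2} (h : SliceDeriv (Sum.inr j) u u')
    (h0 : ∀ q, Y q j = 0 → u q = 0) : ∫ p in Ω, u' p = 0 := by
  rw [← integral_indicator measurableSet_Ω]
  refine integral_eq_zero_of_slices (Sum.inr j) fun q _ => ?_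
  have e : ∀ t, upd q (Sum.inr j) t ∈ Ω ↔ 0 < t ∧ ∀ k, k ≠ j → 0 < Y q k := fun t => by
    simp only [Ω, mem_ofPred_eq]
    constructor
    · intro hh
      refine ⟨by simpa using hh j, fun k hk => ?_⟩
      have := hh k
      rwa [Y, upd_ne _ _ (by simpa using hk)] at this
    · rintro ⟨h1, h2⟩ k
      by_cases hk : k = j
      · subst hk; simpa using h1
      · rw [Y, upd_ne _ _ (by simpa using hk)]; exact h2 k hk
  by_cases hq : ∀ k, k ≠ j → 0 < Y q k
  · have : (fun t => Ω.indicator u' (upd q (Sum.inr j) t)) =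
        (Ioi (0 : ℝ)).indicator fun t => u' (upd q (Sum.inr j) t) := by
      funext t
      simp only [indicator, e, mem_Ioi]
      simp only [eq_true hq, and_true]
    rw [this, integral_indicator measurableSet_Ioi]
    have hi := (h.integrable_slice' q).integrableOn (s := Ioi 0)
    rw [integral_Ioi_of_hasDerivAt_of_tendsto' (fun t _ => h.deriv q t) hi
      (tendsto_zero_of_hasDerivAt_of_integrableOn_Ioi (fun t _ => h.deriv q t) hi
        (h.integrable_slice q).integrableOn), h0 _ (by simp), sub_zero]
  · simp only [indicator, e, hq, and_false, if_false, integral_zero]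

end SliceDeriv

lemma hasDerivAt_upd (q : E) (i : Idx) (t : ℝ) :
    HasDerivAt (fun t => upd q i t) (EuclideanSpace.single i 1) t := by
  have e : (fun t => upd q i t) = fun t => upd q i 0 + t • EuclideanSpace.single i (1 : ℝ) := by
    funext t; ext j
    by_cases h : j = i
    · subst h; simp
    · simp [upd_apply, h]
  rw [e]
  simpa using ((hasDerivAt_id t).smul_const (EuclideanSpace.single i (1 : ℝ))).const_add (upd q i 0)

lemma sliceDeriv_mul (i : Idx) (G : 𝓢(E, ℂ)) {e e' : E → ℂ} (he : Measurable e)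
    (he' : Measurable e') {C : ℝ} (hC : ∀ q, ‖e q‖ ≤ C) (hC' : ∀ q, ‖e' q‖ ≤ C)
    (hd : ∀ q t, HasDerivAt (fun t => e (upd q i t)) (e' (upd q i t)) t) :
    SliceDeriv i (fun q => G q * e q) (fun q => pd i G q * e q + G q * e' q) := by
  have hpd : ∀ q, pd i G q = (∂_{EuclideanSpace.single i (1 : ℝ)} G) q := fun q =>
    (SchwartzMap.lineDerivOp_apply_eq_fderiv _ G q).symm
  have hpdm : Measurable (pd i G) := by
    rw [funext hpd]; exact (∂_{EuclideanSpace.single i (1 : ℝ)} G).continuous.measurable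
  have hGm := G.continuous.measurable
  obtain ⟨A, hA0, hA⟩ := exists_bound_schwartz G 0
  obtain ⟨B, hB0, hB⟩ := exists_bound_schwartz (∂_{EuclideanSpace.single i (1 : ℝ)} G) 0
  simp only [pow_zero, one_mul] at hA hB
  refine ⟨hGm.mul he, (hpdm.mul he).add (hGm.mul he'), ⟨A * C, fun p => ?_⟩,
    ⟨B * C + A * C, fun p => ?_⟩, fun q t => ?_⟩
  · rw [norm_mul]
    have := mul_le_mul (hA p) (hC p) (norm_nonneg _) (mul_nonneg hA0 (decay_pos p).le)
    linarith
  · refine (norm_add_le _ _).trans ?_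
    rw [norm_mul, norm_mul, hpd]
    have h1 := mul_le_mul (hB p) (hC p) (norm_nonneg _) (mul_nonneg hB0 (decay_pos p).le)
    have h2 := mul_le_mul (hA p) (hC' p) (norm_nonneg _) (mul_nonneg hA0 (decay_pos p).le)
    linarith
  · have h1 : HasDerivAt (fun t => G (upd q i t)) (pd i G (upd q i t)) t :=
      (G.differentiableAt.hasFDerivAt (x := upd q i t)).comp_hasDerivAt t (hasDerivAt_upd q i t)
    exact h1.mul (hd q t)

lemma hasDerivAt_cexp_mul (c : ℂ) (t : ℝ) :
    HasDerivAt (fun t : ℝ => cexp (c * t)) (c * cexp (c * t)) t := by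
  have h1 : HasDerivAt (fun t : ℝ => c * (t : ℂ)) c t := by
    simpa using (hasDerivAt_id t).ofReal_comp.const_mul c
  convert h1.cexp using 1
  ring

lemma hasDerivAt_ex (j : Fin 2) (ξ q : E) (t : ℝ) :
    HasDerivAt (fun t => ex (upd q (Sum.inl j) t) ξ)
      (-I * X ξ j * ex (upd q (Sum.inl j) t) ξ) t := by
  have e : ∀ t, ex (upd q (Sum.inl j) t) ξ =
      cexp (-I * X ξ j * t) * ex (upd q (Sum.inl j) 0) ξ := by
    intro t
    rw [ex, ex, ← Complex.exp_add]
    congr 1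
    fin_cases j <;> simp [X, upd_apply] <;> ring
  refine (((hasDerivAt_cexp_mul (-I * X ξ j) t).mul_const
    (ex (upd q (Sum.inl j) 0) ξ)).congr_deriv ?_).congr_of_eventuallyEq (Eventually.of_forall e)
  rw [e t]; ring

lemma hasDerivAt_odd (j : Fin 2) (ξ q : E) (t : ℝ) :
    HasDerivAt (fun t => ep j (upd q (Sum.inr j) t) ξ - em j (upd q (Sum.inr j) t) ξ)
      (-I * Y ξ j * (ep j (upd q (Sum.inr j) t) ξ + em j (upd q (Sum.inr j) t) ξ)) t := by
  simp only [ep, em, Y_upd_same]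
  have h1 := hasDerivAt_cexp_mul (-I * Y ξ j) t
  have h2 := hasDerivAt_cexp_mul (I * Y ξ j) t
  refine ((h1.sub h2).congr_deriv ?_).congr_of_eventuallyEq (Eventually.of_forall fun t => ?_)
  · push_cast; simp only [mul_assoc, neg_mul]; ring
  · simp only [Pi.sub_apply]; push_cast; simp only [mul_assoc]

lemma ex_upd_inr (q ξ : E) (j : Fin 2) (t : ℝ) : ex (upd q (Sum.inr j) t) ξ = ex q ξ := by
  simp [ex]

lemma Y_upd_inl (q : E) (j k : Fin 2) (t : ℝ) : Y (upd q (Sum.inl j) t) k = Y q k := by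
  simp [Y, upd_apply]

lemma ep_upd_inl (q ξ : E) (j k : Fin 2) (t : ℝ) : ep k (upd q (Sum.inl j) t) ξ = ep k q ξ := by
  simp [ep, Y_upd_inl]

lemma em_upd_inl (q ξ : E) (j k : Fin 2) (t : ℝ) : em k (upd q (Sum.inl j) t) ξ = em k q ξ := by
  simp [em, Y_upd_inl]

lemma ep_upd_inr (q ξ : E) {j k : Fin 2} (h : k ≠ j) (t : ℝ) :
    ep k (upd q (Sum.inr j) t) ξ = ep k q ξ := by
  simp [ep, Y, upd_apply, h]

lemma em_upd_inr (q ξ : E) {j k : Fin 2} (h : k ≠ j) (t : ℝ) :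
    em k (upd q (Sum.inr j) t) ξ = em k q ξ := by
  simp [em, Y, upd_apply, h]

@[fun_prop] lemma measurable_ex_left (ξ : E) : Measurable fun q : E => ex q ξ := by
  unfold ex; fun_prop

@[fun_prop] lemma measurable_ep_left (j : Fin 2) (ξ : E) : Measurable fun q : E => ep j q ξ := by
  unfold ep; fun_prop

@[fun_prop] lemma measurable_em_left (j : Fin 2) (ξ : E) : Measurable fun q : E => em j q ξ := by
  unfold em; fun_prop

/-- The exponential that is odd in both `y_1` and `y_2`. -/
def oo (q ξ : E) : ℂ := ex q ξ * (ep 0 q ξ - em 0 q ξ) * (ep 1 q ξ - em 1 q ξ)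

lemma norm_oo_le (q ξ : E) : ‖oo q ξ‖ ≤ 4 := by
  rw [oo, norm_mul, norm_mul, norm_ex]
  nlinarith [norm_odd_le 0 q ξ, norm_odd_le 1 q ξ, norm_nonneg (ep 0 q ξ - em 0 q ξ),
    norm_nonneg (ep 1 q ξ - em 1 q ξ)]

/-- The derivative of `oo` along `y_j`, where `k` is the other index. -/
def ooY (j k : Fin 2) (q ξ : E) : ℂ :=
  ex q ξ * (-I * Y ξ j * (ep j q ξ + em j q ξ)) * (ep k q ξ - em k q ξ)

lemma oo_eq {j k : Fin 2} (h : k ≠ j) (q ξ : E) :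
    oo q ξ = ex q ξ * (ep j q ξ - em j q ξ) * (ep k q ξ - em k q ξ) := by
  unfold oo
  fin_cases j <;> fin_cases k <;> first | exact absurd rfl h | (simp; try ring)

/-- Integration by parts: `∂/∂x_j + i ∂/∂y_j` applied to `oo` gives `-i` times the bracket on the
left with its prefactor. `oo` is odd in `y_j`, hence zero on `y_j = 0`, so no boundary term appears.
-/
lemma integral_dbar_oo (G : 𝓢(E, ℂ)) {j k : Fin 2} (h : k ≠ j) (ξ : E) :
    ∫ q in Ω, G q * (ex q ξ * (ep k q ξ - em k q ξ) *
      (rr j ξ * ep j q ξ - rb j ξ * em j q ξ)) =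
    -I * ∫ q in Ω, (pd (Sum.inl j) G q + I * pd (Sum.inr j) G q) * oo q ξ := by
  have hm : Measurable fun q => oo q ξ := by unfold oo; fun_prop
  have hb : ∀ q, ‖ooY j k q ξ‖ ≤ 4 * |Y ξ j| := by
    intro q
    have h1 : ‖ep j q ξ + em j q ξ‖ ≤ 2 := (norm_add_le _ _).trans (by simp; norm_num)
    have h2 := norm_odd_le k q ξ
    rw [ooY, norm_mul, norm_mul, norm_mul, norm_mul, norm_ex, norm_neg, norm_I, norm_real,
      Real.norm_eq_abs]
    calc _ ≤ 1 * (1 * |Y ξ j| * 2) * 2 := by gcongr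
      _ = 4 * |Y ξ j| := by ring
  have s1 : SliceDeriv (Sum.inl j) (fun q => G q * oo q ξ)
      (fun q => pd (Sum.inl j) G q * oo q ξ + G q * (-I * X ξ j * oo q ξ)) := by
    refine sliceDeriv_mul (C := 4 + 4 * |X ξ j|) _ G hm (by fun_prop)
      (fun q => (norm_oo_le q ξ).trans (by linarith [abs_nonneg (X ξ j)])) (fun q => ?_)
      (fun q t => ?_)
    · rw [norm_mul, norm_mul, norm_neg, norm_I, norm_real, Real.norm_eq_abs]
      nlinarith [norm_oo_le q ξ, abs_nonneg (X ξ j)]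
    · simp only [oo, ep_upd_inl, em_upd_inl]
      refine (((hasDerivAt_ex j ξ q t).mul_const (ep 0 q ξ - em 0 q ξ)).mul_const
        (ep 1 q ξ - em 1 q ξ)).congr_deriv ?_
      ring
  have s2 : SliceDeriv (Sum.inr j) (fun q => G q * oo q ξ)
      (fun q => pd (Sum.inr j) G q * oo q ξ + G q * ooY j k q ξ) := by
    refine sliceDeriv_mul (C := 4 + 4 * |Y ξ j|) _ G hm (by unfold ooY; fun_prop)
      (fun q => (norm_oo_le q ξ).trans (by linarith [abs_nonneg (Y ξ j)]))
      (fun q => (hb q).trans (by linarith)) (fun q t => ?_)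
    simp only [oo_eq h, ooY, ex_upd_inr, ep_upd_inr _ _ h, em_upd_inr _ _ h]
    exact ((hasDerivAt_odd j ξ q t).const_mul (ex q ξ)).mul_const _
  have z1 := s1.integral_Ω_inl
  have z2 := s2.integral_Ω_inr (fun q hq => by simp [oo_eq h, ep, em, hq])
  obtain ⟨C1, hC1⟩ := s1.bound'
  obtain ⟨C2, hC2⟩ := s2.bound'
  have i1 := Integrable.mono' (μ := volume) (integrable_decay.const_mul C1)
    s1.meas'.aestronglyMeasurable (ae_of_all _ hC1)
  have i2 := Integrable.mono' (μ := volume) (integrable_decay.const_mul C2)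
    s2.meas'.aestronglyMeasurable (ae_of_all _ hC2)
  have z : ∫ q in Ω, ((pd (Sum.inl j) G q * oo q ξ + G q * (-I * X ξ j * oo q ξ)) +
      I * (pd (Sum.inr j) G q * oo q ξ + G q * ooY j k q ξ)) = 0 := by
    rw [integral_add i1.integrableOn (i2.integrableOn.const_mul I), integral_const_mul, z1, z2]
    simp
  have iA : IntegrableOn (fun q => G q * (ex q ξ * (ep k q ξ - em k q ξ) *
      (rr j ξ * ep j q ξ - rb j ξ * em j q ξ))) Ω := by
    refine Integrable.integrableOn ?_
    refine (G.integrable.bdd_mul (f := fun q => ex q ξ * (ep k q ξ - em k q ξ) *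
      (rr j ξ * ep j q ξ - rb j ξ * em j q ξ)) (c := 2 * (‖rr j ξ‖ + ‖rr j ξ‖))
      (Measurable.aestronglyMeasurable (by fun_prop)) (ae_of_all _ fun q => ?_)).congr
      (ae_of_all _ fun q => mul_comm _ _)
    rw [norm_mul, norm_mul, norm_ex, one_mul]
    refine mul_le_mul (norm_odd_le k q ξ) ((norm_sub_le _ _).trans ?_) (norm_nonneg _) (by norm_num)
    simp [norm_rb]
  have key : ∀ q, (pd (Sum.inl j) G q + I * pd (Sum.inr j) G q) * oo q ξ =
      ((pd (Sum.inl j) G q * oo q ξ + G q * (-I * X ξ j * oo q ξ)) +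
      I * (pd (Sum.inr j) G q * oo q ξ + G q * ooY j k q ξ)) +
      I * (G q * (ex q ξ * (ep k q ξ - em k q ξ) *
      (rr j ξ * ep j q ξ - rb j ξ * em j q ξ))) := by
    intro q
    rw [oo_eq h, ooY, rr, rb]
    ring_nf
  have i3 : Integrable fun q => (pd (Sum.inl j) G q * oo q ξ + G q * (-I * X ξ j * oo q ξ)) +
      I * (pd (Sum.inr j) G q * oo q ξ + G q * ooY j k q ξ) := i1.add (i2.const_mul I)
  simp only [key]
  rw [integral_add i3.integrableOn (iA.const_mul I), z, zero_add,
    integral_const_mul, ← mul_assoc, neg_mul, I_mul_I, neg_neg, one_mul]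

/-- Both sides are transforms, against the same `oo`, of the two mixed derivatives that `∂̄f = 0`
equates. -/
lemma integral_closed {f : Fin 2 → E → ℂ} (hclosed : DbarClosed f) {G : Fin 2 → 𝓢(E, ℂ)}
    (hG : ∀ j, EqOn (f j) (G j) (closure Ω)) (ξ : E) :
    ∫ q in Ω, G 1 q * (ex q ξ * (ep 1 q ξ - em 1 q ξ) *
      (rr 0 ξ * ep 0 q ξ - rb 0 ξ * em 0 q ξ)) =
    ∫ q in Ω, G 0 q * (ex q ξ * (ep 0 q ξ - em 0 q ξ) *
      (rr 1 ξ * ep 1 q ξ - rb 1 ξ * em 1 q ξ)) := by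
  rw [integral_dbar_oo (G 1) (j := 0) (k := 1) (by decide) ξ,
    integral_dbar_oo (G 0) (j := 1) (k := 0) (by decide) ξ]
  congr 1
  refine setIntegral_congr_fun measurableSet_Ω fun q hq => ?_
  have hfd : ∀ j, fderiv ℝ (f j) q = fderiv ℝ (G j) q := fun j =>
    Filter.EventuallyEq.fderiv_eq (by
      filter_upwards [isOpen_Ω.mem_nhds hq] with p hp using hG j (subset_closure hp))
  have hc := hclosed q hq
  simp only [dzbar, dx, dy, hfd] at hc
  have hc' : pd (Sum.inl 0) (G 1) q + I * pd (Sum.inr 0) (G 1) q =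
      pd (Sum.inl 1) (G 0) q + I * pd (Sum.inr 1) (G 0) q := by
    simp only [pd]
    linear_combination 2 * hc
  simp only [hc']

end

section

variable {φ : E → ℂ}

/-! ### The solution operator in terms of kernels -/

lemma ift_pd (F : 𝓢(E, ℂ)) (i : Idx) (ξ : E) : ift (pd i F) ξ = -I * ξ i * ift F ξ := by
  have hd : ∀ (q : E) (t : ℝ), HasDerivAt (fun t => cexp (I * (inner ℝ (upd q i t) ξ : ℝ)))
      (I * ξ i * cexp (I * (inner ℝ (upd q i t) ξ : ℝ))) t := by
    intro q t
    have e : ∀ t : ℝ, cexp (I * (inner ℝ (upd q i t) ξ : ℝ)) =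
        cexp (I * ξ i * t) * cexp (I * (inner ℝ (upd q i 0) ξ : ℝ)) := by
      intro t
      rw [← Complex.exp_add, real_inner_comm, inner_upd, real_inner_comm]
      congr 1; push_cast; ring
    refine (((hasDerivAt_cexp_mul (I * ξ i) t).mul_const _).congr_deriv ?_).congr_of_eventuallyEq
      (Eventually.of_forall e)
    rw [e t]; ring
  have hm : Measurable fun q : E => cexp (I * (inner ℝ q ξ : ℝ)) := by fun_prop
  have s := sliceDeriv_mul (C := 1 + |ξ i|) i F hm (hm.const_mul (I * ξ i))
    (fun q => by rw [norm_cexp_I_mul]; linarith [abs_nonneg (ξ i)])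
    (fun q => by
      rw [norm_mul, norm_cexp_I_mul, norm_mul, norm_I, norm_real, Real.norm_eq_abs]
      linarith) hd
  have z := s.integral_eq_zero
  obtain ⟨C, hC⟩ := s.bound'
  have i1 := Integrable.mono' (μ := volume) (integrable_decay.const_mul C)
    s.meas'.aestronglyMeasurable (ae_of_all _ hC)
  have i2 : Integrable fun q => F q * (I * ξ i * cexp (I * (inner ℝ q ξ : ℝ))) := by
    refine (F.integrable.bdd_mul (c := |ξ i|) (hm.const_mul (I * ξ i)).aestronglyMeasurable
      (ae_of_all _ fun q => ?_)).congr (ae_of_all _ fun q => mul_comm _ _)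
    rw [norm_mul, norm_cexp_I_mul, norm_mul, norm_I, norm_real, Real.norm_eq_abs]
    simp
  have e : ∀ q, pd i F q * cexp (I * (inner ℝ q ξ : ℝ)) =
      (pd i F q * cexp (I * (inner ℝ q ξ : ℝ)) +
        F q * (I * ξ i * cexp (I * (inner ℝ q ξ : ℝ)))) +
      -(F q * (I * ξ i * cexp (I * (inner ℝ q ξ : ℝ)))) := fun q => by ring
  unfold ift
  have i3 : Integrable fun q => -(F q * (I * ξ i * cexp (I * (inner ℝ q ξ : ℝ)))) := i2.neg
  rw [integral_congr_ae (ae_of_all _ e), integral_add i1 i3, z, zero_add, ← integral_const_mul]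
  refine integral_congr_ae (ae_of_all _ fun q => ?_)
  simp only []
  ring

lemma IsTest.ift_dz (hφ : IsTest φ) (j : Fin 2) (ξ : E) :
    ift (dz j φ) ξ = -(I / 2) * rb j ξ * ift φ ξ := by
  obtain ⟨F, rfl⟩ := hφ.exists_schwartz
  have h1 := ift_pd F (Sum.inl j) ξ
  have h2 := ift_pd F (Sum.inr j) ξ
  have hI : ∀ i, Integrable fun q => pd i F q * cexp (I * (inner ℝ q ξ : ℝ)) := by
    intro i
    have hpd : pd i F = LineDeriv.lineDerivOp (EuclideanSpace.single i (1 : ℝ)) F :=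
      funext fun q => (SchwartzMap.lineDerivOp_apply_eq_fderiv _ F q).symm
    rw [hpd]
    refine ((SchwartzMap.integrable _).bdd_mul (c := 1) (f := fun q : E =>
      cexp (I * (inner ℝ q ξ : ℝ))) (Measurable.aestronglyMeasurable (by fun_prop))
      (ae_of_all _ fun q => ?_)).congr (ae_of_all _ fun q => mul_comm _ _)
    rw [norm_cexp_I_mul]
  have e : ift (dz j F) ξ = (ift (pd (Sum.inl j) F) ξ - I * ift (pd (Sum.inr j) F) ξ) / 2 := by
    unfold ift
    rw [← integral_const_mul, ← integral_sub (hI _) ((hI _).const_mul I), ← integral_div]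
    refine integral_congr_ae (ae_of_all _ fun q => ?_)
    simp only [dz, dx, dy, pd]
    ring
  rw [e, h1, h2, rb, X, Y]
  ring_nf

lemma reflect_apply (j : Fin 2) (p : E) (i : Idx) :
    reflect j p i = if i = Sum.inr j then -p i else p i := rfl

lemma reflect_reflect (j : Fin 2) (p : E) : reflect j (reflect j p) = p := by
  ext i; by_cases h : i = Sum.inr j <;> simp [reflect_apply, h]

lemma measurePreserving_reflect (j : Fin 2) : MeasurePreserving (reflect j) := by
  have h1 : MeasurePreserving fun (x : Idx → ℝ) (i : Idx) =>
      (if i = Sum.inr j then -x i else x i) := by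
    have : ∀ i : Idx, MeasurePreserving fun t : ℝ => if i = Sum.inr j then -t else t := by
      intro i
      by_cases h : i = Sum.inr j
      · simpa only [h, if_true] using Measure.measurePreserving_neg (volume : Measure ℝ)
      · simp only [h, if_false]
        exact MeasurePreserving.id (volume : Measure ℝ)
    exact volume_preserving_pi this
  exact (PiLp.volume_preserving_toLp Idx).comp (h1.comp (PiLp.volume_preserving_ofLp Idx))

lemma integral_reflect (j : Fin 2) (u : E → ℂ) : ∫ p, u (reflect j p) = ∫ p, u p := by
  have h := measurePreserving_reflect j
  let e : E ≃ᵐ E := ⟨⟨reflect j, reflect j, reflect_reflect j, reflect_reflect j⟩, h.measurable,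
    h.measurable⟩
  exact h.integral_comp e.measurableEmbedding u

/-- Folding the reflected half back onto `Ω` turns `e^{-iy_jη_j}` into the odd combination `ep j -
em j`. The hypothesis on `c` gives integrability; it holds for real `c` and for `c = -iζ`. -/
lemma extFourier_eq (j : Fin 2) {f : E → ℂ} {G : 𝓢(E, ℂ)} (hG : EqOn f G (closure Ω)) (ξ : E)
    (c : ℂ) (hc : ∀ p ∈ Ω, ‖cexp (-I * (Y p (other j) * c))‖ ≤ 1) :
    extFourier j (fun p => -2 * f p) ξ c =
      -2 * ∫ p in Ω, G p * (ex p ξ * (ep j p ξ - em j p ξ) *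
        cexp (-I * (Y p (other j) * c))) := by
  set A : E → ℂ := fun p => G p * (ex p ξ * ep j p ξ * cexp (-I * (Y p (other j) * c))) with hA
  set B : E → ℂ := fun p => G p * (ex p ξ * em j p ξ * cexp (-I * (Y p (other j) * c))) with hB
  have hint : ∀ e : E → ℂ, Measurable e → (∀ p, ‖e p‖ ≤ 1) →
      IntegrableOn (fun p => G p * (e p * cexp (-I * (Y p (other j) * c)))) Ω := by
    intro e he he1
    refine ((G.integrable.restrict (s := Ω)).bdd_mul (c := 1) (f := fun p =>
      e p * cexp (-I * (Y p (other j) * c))) (Measurable.aestronglyMeasurable (by fun_prop))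
      ((ae_restrict_iff' measurableSet_Ω).2 (ae_of_all _ fun p hp => ?_))).congr
      (ae_of_all _ fun q => mul_comm _ _)
    rw [norm_mul]
    exact mul_le_one₀ (he1 p) (norm_nonneg _) (hc p hp)
  have iA : IntegrableOn A Ω := hint (fun p => ex p ξ * ep j p ξ) (by fun_prop) (by simp)
  have iB : IntegrableOn B Ω := hint (fun p => ex p ξ * em j p ξ) (by fun_prop) (by simp)
  have hk : (Sum.inr (other j) : Idx) ≠ Sum.inr j := by
    fin_cases j <;> simp [other]
  have key : ∀ p, oddExt j (fun p => -2 * f p) p * cexp (-I *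
      ((X p 0 * X ξ 0 + X p 1 * X ξ 1 + Y p j * Y ξ j : ℝ) + (Y p (other j) : ℂ) * c)) =
      -2 * (Ω.indicator A p - Ω.indicator B (reflect j p)) := by
    intro p
    have hexp : cexp (-I *
        ((X p 0 * X ξ 0 + X p 1 * X ξ 1 + Y p j * Y ξ j : ℝ) + (Y p (other j) : ℂ) * c)) =
        ex p ξ * ep j p ξ * cexp (-I * (Y p (other j) * c)) := by
      rw [ex, ep, ← Complex.exp_add, ← Complex.exp_add]
      congr 1; push_cast; ring
    rw [hexp, oddExt]
    by_cases h1 : p ∈ Ω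
    · have h2 : reflect j p ∉ Ω := by
        intro h2
        have a := h1 j
        have b := h2 j
        simp only [Y, reflect_apply, if_true] at a b
        linarith
      rw [if_pos h1, indicator_of_mem h1, indicator_of_notMem h2, hA, hG (subset_closure h1)]
      simp only []
      ring
    · rw [if_neg h1, indicator_of_notMem h1]
      by_cases h2 : reflect j p ∈ Ω
      · rw [if_pos h2, indicator_of_mem h2, hB, hG (subset_closure h2)]
        have e1 : ex (reflect j p) ξ = ex p ξ := by simp [ex, X, reflect_apply]
        have e2 : em j (reflect j p) ξ = ep j p ξ := by simp [em, ep, Y, reflect_apply]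
        have e3 : Y (reflect j p) (other j) = Y p (other j) := by
          simp only [Y, reflect_apply, if_neg hk]
        simp only [e1, e2, e3]
        ring
      · rw [if_neg h2, indicator_of_notMem h2]
        ring
  unfold extFourier
  simp only [key]
  have hBr : Integrable fun p => Ω.indicator B (reflect j p) :=
    (measurePreserving_reflect j).integrable_comp_of_integrable
      ((integrable_indicator_iff measurableSet_Ω).2 iB)
  rw [integral_const_mul, integral_sub ((integrable_indicator_iff measurableSet_Ω).2 iA) hBr,
    integral_reflect j (Ω.indicator B), integral_indicator measurableSet_Ω,
    integral_indicator measurableSet_Ω, ← integral_sub iA iB]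
  congr 1
  refine integral_congr_ae (ae_of_all _ fun p => ?_)
  simp only [hA, hB]
  ring

/-! ### Splitting of the solution symbol. -/

/-- The part of the kernels that vanishes for `∂̄`-closed forms. -/
def Z₁ (q ξ : E) : ℂ := rb 1 ξ / (rr 0 ξ * (‖ξ‖ ^ 2 : ℝ)) *
  -(ex q ξ * (ep 0 q ξ - em 0 q ξ) * (rr 1 ξ * ep 1 q ξ - rb 1 ξ * em 1 q ξ))

/-- The part of the second kernel that cancels against `Z₁` for `∂̄`-closed forms. -/
def Z₂ (q ξ : E) : ℂ := rb 1 ξ / (rr 0 ξ * (‖ξ‖ ^ 2 : ℝ)) *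
  (ex q ξ * (ep 1 q ξ - em 1 q ξ) * (rr 0 ξ * ep 0 q ξ - rb 0 ξ * em 0 q ξ))

lemma measurable_Z₁ : Measurable fun z : E × E => Z₁ z.1 z.2 := by
  unfold Z₁; fun_prop

lemma measurable_Z₂ : Measurable fun z : E × E => Z₂ z.1 z.2 := by
  unfold Z₂; fun_prop

lemma norm_normSq (ξ : E) : ‖((‖ξ‖ ^ 2 : ℝ) : ℂ)‖ = ‖ξ‖ ^ 2 := by
  rw [norm_real, Real.norm_of_nonneg (by positivity)]

lemma norm_rr_sub_le (j : Fin 2) (q ξ : E) :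
    ‖rr j ξ * ep j q ξ - rb j ξ * em j q ξ‖ ≤ 2 * ‖rr j ξ‖ := by
  refine (norm_sub_le _ _).trans ?_
  simp [norm_rb]; linarith

lemma norm_Z₁_le (q ξ : E) : ‖Z₁ q ξ‖ ≤ 10 * wt ξ := by
  have h2 := inv_le_wt 0 ξ
  have h5 : ‖ξ‖ ^ 2 * (‖ξ‖ ^ 2)⁻¹ ≤ 1 := mul_inv_le_one
  rw [Z₁, norm_mul, norm_div, norm_mul, norm_neg, norm_mul, norm_mul, norm_ex, norm_rb,
    norm_normSq, div_eq_mul_inv, mul_inv]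
  calc _ ≤ ‖rr 1 ξ‖ * (‖rr 0 ξ‖⁻¹ * (‖ξ‖ ^ 2)⁻¹) * (1 * 2 * (2 * ‖rr 1 ξ‖)) := by
        gcongr
        · exact norm_odd_le 0 q ξ
        · exact norm_rr_sub_le 1 q ξ
    _ ≤ ‖ξ‖ * (‖rr 0 ξ‖⁻¹ * (‖ξ‖ ^ 2)⁻¹) * (1 * 2 * (2 * ‖ξ‖)) := by
        gcongr <;> exact norm_rr_le 1 ξ
    _ = 4 * (‖ξ‖ ^ 2 * (‖ξ‖ ^ 2)⁻¹) * ‖rr 0 ξ‖⁻¹ := by ring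
    _ ≤ 4 * 1 * wt ξ := by gcongr
    _ ≤ 10 * wt ξ := by linarith [wt_nonneg ξ]

lemma rr_one_mul_inv_normSq_le (ξ : E) : ‖rr 1 ξ‖ * (‖ξ‖ ^ 2)⁻¹ ≤ ‖rr 1 ξ‖⁻¹ := by
  by_cases h : ‖rr 1 ξ‖ = 0
  · simp [h]
  have hp : 0 < ‖rr 1 ξ‖ := lt_of_le_of_ne (norm_nonneg _) (Ne.symm h)
  have h9 := norm_rr_le 1 ξ
  have hp' : 0 < ‖ξ‖ := hp.trans_le h9
  rw [← div_eq_mul_inv, div_le_iff₀ (by positivity), inv_mul_eq_div, le_div_iff₀ hp]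
  nlinarith

lemma norm_Z₂_le (q ξ : E) : ‖Z₂ q ξ‖ ≤ 10 * wt ξ := by
  have h2 := inv_le_wt 1 ξ
  have h5 : ‖rr 0 ξ‖ * ‖rr 0 ξ‖⁻¹ ≤ 1 := mul_inv_le_one
  rw [Z₂, norm_mul, norm_div, norm_mul, norm_mul, norm_mul, norm_ex, norm_rb,
    norm_normSq, div_eq_mul_inv, mul_inv]
  calc _ ≤ ‖rr 1 ξ‖ * (‖rr 0 ξ‖⁻¹ * (‖ξ‖ ^ 2)⁻¹) * (1 * 2 * (2 * ‖rr 0 ξ‖)) := by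
        gcongr
        · exact norm_odd_le 1 q ξ
        · exact norm_rr_sub_le 0 q ξ
    _ = 4 * (‖rr 0 ξ‖ * ‖rr 0 ξ‖⁻¹) * (‖rr 1 ξ‖ * (‖ξ‖ ^ 2)⁻¹) := by ring
    _ ≤ 4 * 1 * wt ξ := by gcongr; exact (rr_one_mul_inv_normSq_le ξ).trans h2
    _ ≤ 10 * wt ξ := by linarith [wt_nonneg ξ]

lemma rr_mul_rb (j : Fin 2) (ξ : E) : rr j ξ * rb j ξ = (‖rr j ξ‖ ^ 2 : ℝ) := by
  rw [norm_rr_sq, rr, rb]; push_cast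
  ring_nf; rw [I_sq]; ring

lemma rr_ne_zero {j : Fin 2} {ξ : E} (h : X ξ j ≠ 0) : rr j ξ ≠ 0 := add_I_mul_ne_zero h _

lemma rb_ne_zero {j : Fin 2} {ξ : E} (h : X ξ j ≠ 0) : rb j ξ ≠ 0 := sub_I_mul_ne_zero h _

/-- Here `r, s, t, u` are `r_0, s_0, r_1, s_1` and `Q = |ξ|²`. The plane wave `a` uses `1/r -
ut/(rQ) = s/Q`, the decaying exponential `b` uses `(z - x)(z + x) = rs`, and the two occurrences of
the reflected wave `c` cancel. -/
lemma kernel_algebra₁ {r s t u z x Q : ℂ} (hr : r ≠ 0) (hQ0 : Q ≠ 0) (hzx : z - x ≠ 0)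
    (hQ : Q = r * s + t * u) (hz : (z - x) * (z + x) = r * s) (a b c e : ℂ) :
    e * (a / r + u / (r * Q) * ((z + x) * b - u * c) + u / (r * Q) * -(t * a - u * c)) =
      s / Q * (e * a) + s / Q * (u / (z - x)) * (e * b) := by
  have h1 : u / (r * Q) * (z + x) = s / Q * (u / (z - x)) := by
    field_simp
    linear_combination u * hz
  have h2 : 1 / r - u * t / (r * Q) = s / Q := by
    field_simp
    linear_combination hQ
  linear_combination e * b * h1 + e * a * h2

/-- The terms with `β = be` and with the reflected wave `c` cancel identically. Adding and
subtracting `β/(rt)` is what lets `R₂` vanish under integration in `η_0`. -/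
lemma kernel_algebra₂ {r s t u z Q β : ℂ} (hr : r ≠ 0) (ht : t ≠ 0) (hu : u ≠ 0)
    (a b c e : ℂ) :
    e * (β / (r * t) + u * (s / (z * Q) * b + s / (r * Q) * c - β / (r * (t * u))) +
      u / (r * Q) * (r * a - s * c)) = u / Q * (e * a) + u / Q * (s / z) * (e * b) := by
  have h1 : u * (β / (r * (t * u))) = β / (r * t) := by field_simp
  have h2 : u * (s / (z * Q)) = u / Q * (s / z) := by
    rw [div_mul_div_comm, mul_comm Q z, mul_div_assoc]
  have h3 : u / (r * Q) * r = u / Q := by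
    rw [div_mul_eq_mul_div, mul_comm u r, mul_div_mul_left _ _ hr]
  linear_combination e * a * h3 + e * b * h2 - e * h1

lemma zeta_sub_mul (j k : Fin 2) (h : k ≠ j) (ξ : E) :
    ((zeta j ξ - X ξ k : ℂ)) * (zeta j ξ + X ξ k) = rr j ξ * rb j ξ := by
  rw [rr_mul_rb, norm_rr_sq, ← ofReal_sub, ← ofReal_add, ← ofReal_mul]
  congr 1
  have := zeta_sq j ξ
  fin_cases j <;> fin_cases k <;> first | exact absurd rfl h | (simp at this ⊢; linear_combination this)

lemma normSq_eq_mul (ξ : E) :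
    ((‖ξ‖ ^ 2 : ℝ) : ℂ) = rr 0 ξ * rb 0 ξ + rr 1 ξ * rb 1 ξ := by
  rw [rr_mul_rb, rr_mul_rb, ← ofReal_add, norm_sq_eq_rr]

lemma integrableOn_mul_exp (G : 𝓢(E, ℂ)) (j : Fin 2) (ξ : E) {e : E → ℂ} (he : Measurable e)
    (hb : ∀ p ∈ Ω, ‖e p‖ ≤ 1) :
    IntegrableOn (fun p => G p * (ex p ξ * (ep j p ξ - em j p ξ) * e p)) Ω := by
  refine ((G.integrable.restrict (s := Ω)).bdd_mul (c := 2) (f := fun p =>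
    ex p ξ * (ep j p ξ - em j p ξ) * e p) (Measurable.aestronglyMeasurable (by fun_prop))
    ((ae_restrict_iff' measurableSet_Ω).2 (ae_of_all _ fun p hp => ?_))).congr
    (ae_of_all _ fun q => mul_comm _ _)
  rw [norm_mul, norm_mul, norm_ex, one_mul]
  have := mul_le_mul (norm_odd_le j p ξ) (hb p hp) (norm_nonneg _) zero_le_two
  linarith

lemma solutionSymbol_eq {j k : Fin 2} (hk : other j = k) {f : E → ℂ} {G : 𝓢(E, ℂ)}
    (hG : EqOn f G (closure Ω)) {ξ : E} {κ : E → ℂ}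
    (hκ : ∀ q ∈ Ω, κ q = rb j ξ / (‖ξ‖ ^ 2 : ℝ) * (ex q ξ * (ep j q ξ - em j q ξ) * ep k q ξ) +
      rb j ξ / (‖ξ‖ ^ 2 : ℝ) * (rb k ξ / (zeta j ξ - X ξ k)) *
        (ex q ξ * (ep j q ξ - em j q ξ) * cexp (-(zeta j ξ * Y q k : ℝ)))) :
    solutionSymbol j (fun p => -2 * f p) ξ * rb j ξ = 2 * ∫ q in Ω, G q * κ q := by
  have e1 : ∀ p : E, cexp (-I * (Y p (other j) * (Y ξ (other j) : ℂ))) = ep k p ξ := by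
    intro p; rw [ep, hk]; congr 2; push_cast; ring
  have e2 : ∀ p : E, cexp (-I * (Y p (other j) * (-I * (zeta j ξ : ℂ)))) =
      cexp (-(zeta j ξ * Y p k : ℝ)) := by
    intro p; rw [hk]; congr 1; push_cast
    ring_nf; rw [I_sq]; ring
  have b2 : ∀ p ∈ Ω, ‖cexp (-(zeta j ξ * Y p k : ℝ))‖ ≤ 1 := fun p hp =>
    norm_cexp_neg_le (mul_nonneg (zeta_nonneg j ξ) (hp k).le)
  have x1 := extFourier_eq j hG ξ (Y ξ (other j)) (fun p _ => by rw [e1]; simp)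
  have x2 := extFourier_eq j hG ξ (-I * zeta j ξ) (fun p hp => by rw [e2]; exact b2 p hp)
  simp only [e1] at x1
  simp only [e2] at x2
  have i1 := integrableOn_mul_exp G j ξ (e := fun p => ep k p ξ) (by fun_prop) (by simp)
  have i2 := integrableOn_mul_exp G j ξ (e := fun p => cexp (-(zeta j ξ * Y p k : ℝ)))
    (by fun_prop) b2
  have e3 : ∫ q in Ω, G q * κ q =
      rb j ξ / (‖ξ‖ ^ 2 : ℝ) * (∫ q in Ω, G q * (ex q ξ * (ep j q ξ - em j q ξ) * ep k q ξ)) +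
      rb j ξ / (‖ξ‖ ^ 2 : ℝ) * (rb k ξ / (zeta j ξ - X ξ k)) *
        ∫ q in Ω, G q * (ex q ξ * (ep j q ξ - em j q ξ) * cexp (-(zeta j ξ * Y q k : ℝ))) := by
    rw [← integral_const_mul, ← integral_const_mul,
      ← integral_add (i1.const_mul _) (i2.const_mul _)]
    refine setIntegral_congr_fun measurableSet_Ω fun q hq => ?_
    simp only [hκ q hq]
    ring
  rw [solutionSymbol, x1, x2, e3, hk]
  simp only [rb, ofReal_sub]
  ring

lemma solutionSymbol_zero {f : E → ℂ} {G : 𝓢(E, ℂ)} (hG : EqOn f G (closure Ω)) {ξ : E}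
    (h : ∀ i, ξ i ≠ 0) : solutionSymbol 0 (fun p => -2 * f p) ξ * rb 0 ξ =
      2 * ∫ q in Ω, G q * (W₁ q ξ + R₁ q ξ + Z₁ q ξ) := by
  refine solutionSymbol_eq (k := 1) (by decide) hG fun q _ => ?_
  have h0 : X ξ 0 ≠ 0 := h _
  have hz := zeta_sub_mul 0 1 (by decide) ξ
  have hzx : (zeta 0 ξ - X ξ 1 : ℂ) ≠ 0 := by
    intro h'; rw [h', zero_mul] at hz
    exact mul_ne_zero (rr_ne_zero h0) (rb_ne_zero h0) hz.symm
  have hQ0 : ((‖ξ‖ ^ 2 : ℝ) : ℂ) ≠ 0 := by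
    rw [ofReal_ne_zero]
    have : ξ ≠ 0 := by rintro rfl; exact h (Sum.inl 0) rfl
    positivity
  rw [← kernel_algebra₁ (rr_ne_zero h0) hQ0 hzx (normSq_eq_mul ξ) hz (ep 1 q ξ) _ (em 1 q ξ),
    W₁, R₁, Z₁]
  ring

lemma solutionSymbol_one {f : E → ℂ} {G : 𝓢(E, ℂ)} (hG : EqOn f G (closure Ω)) {ξ : E}
    (h : ∀ i, ξ i ≠ 0) : solutionSymbol 1 (fun p => -2 * f p) ξ * rb 1 ξ =
      2 * ∫ q in Ω, G q * (W₂ q ξ + R₂ q ξ + Z₂ q ξ) := by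
  refine solutionSymbol_eq (k := 0) (by decide) hG fun q _ => ?_
  rw [← kernel_algebra₂ (β := be 0 q ξ) (rr_ne_zero (h (Sum.inl 0))) (rr_ne_zero (h (Sum.inl 1)))
    (rb_ne_zero (h (Sum.inl 1))) (ep 0 q ξ) _ (em 0 q ξ),
    W₂, R₂, Z₂, rr_mul_rb]
  ring

lemma integrableOn_kernel_left {κ : E → E → ℂ} (hm : Measurable fun z : E × E => κ z.1 z.2)
    {C : ℝ} (hb : ∀ q ∈ Ω, ∀ ξ, ‖κ q ξ‖ ≤ C * wt ξ) (G : 𝓢(E, ℂ)) (ξ : E) :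
    IntegrableOn (fun q => G q * κ q ξ) Ω := by
  have : Measurable fun q => κ q ξ := hm.comp measurable_prodMk_right
  exact ((G.integrable.restrict (s := Ω)).bdd_mul (c := C * wt ξ) this.aestronglyMeasurable
    ((ae_restrict_iff' measurableSet_Ω).2 (ae_of_all _ fun q hq => hb q hq ξ))).congr
    (ae_of_all _ fun q => mul_comm _ _)

/-- `∂̄* N f` in terms of the kernels of the regular representation. -/
lemma dbarStar_N_eq {f : Fin 2 → E → ℂ} (hclosed : DbarClosed f) {G : Fin 2 → 𝓢(E, ℂ)}
    (hG : ∀ j, EqOn (f j) (G j) (closure Ω)) (hφ : IsTest φ) :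
    dbarStar (N f) φ = -2 * I * ((2 * Real.pi) ^ 4 : ℝ)⁻¹ *
      ((∫ ξ, (∫ q, G 0 q * K₁ q ξ) * ift φ ξ) + ∫ ξ, (∫ q, G 1 q * K₂ q ξ) * ift φ ξ) := by
  obtain ⟨C, _, hC⟩ := hφ.ift_bound
  have hm := hφ.continuous_ift.measurable
  have hWR₁ : ∀ q ∈ Ω, ∀ ξ, ‖W₁ q ξ + R₁ q ξ‖ ≤ 30 * wt ξ := fun q hq ξ =>
    (norm_add_le _ _).trans (by linarith [norm_W₁_le q ξ, norm_R₁_le hq ξ])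
  have hWR₂ : ∀ q ∈ Ω, ∀ ξ, ‖W₂ q ξ + R₂ q ξ‖ ≤ 30 * wt ξ := fun q hq ξ =>
    (norm_add_le _ _).trans (by linarith [norm_W₂_le q ξ, norm_R₂_le hq ξ])
  have mWR₁ := measurable_W₁.add measurable_R₁
  have mWR₂ := measurable_W₂.add measurable_R₂
  have iA₁ := (integral_kernel_swap (κ := fun q ξ => W₁ q ξ + R₁ q ξ) mWR₁ measurableSet_Ω hWR₁
    (G 0) hm hC).1
  have iA₂ := (integral_kernel_swap (κ := fun q ξ => W₂ q ξ + R₂ q ξ) mWR₂ measurableSet_Ω hWR₂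
    (G 1) hm hC).1
  have iZ₁ := (integral_kernel_swap measurable_Z₁ measurableSet_Ω (fun q _ => norm_Z₁_le q)
    (G 0) hm hC).1
  have iZ₂ := (integral_kernel_swap measurable_Z₂ measurableSet_Ω (fun q _ => norm_Z₂_le q)
    (G 1) hm hC).1
  -- The only place where `∂̄f = 0` enters.
  have hZ : ∀ ξ, ∫ q in Ω, G 1 q * Z₂ q ξ = -∫ q in Ω, G 0 q * Z₁ q ξ := by
    intro ξ
    have h := integral_closed hclosed hG ξ
    have e1 : ∫ q in Ω, G 0 q * Z₁ q ξ = -(rb 1 ξ / (rr 0 ξ * (‖ξ‖ ^ 2 : ℝ))) *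
        ∫ q in Ω, G 0 q * (ex q ξ * (ep 0 q ξ - em 0 q ξ) *
          (rr 1 ξ * ep 1 q ξ - rb 1 ξ * em 1 q ξ)) := by
      rw [← integral_const_mul]
      refine integral_congr_ae (ae_of_all _ fun q => ?_)
      simp only [Z₁]; ring
    have e2 : ∫ q in Ω, G 1 q * Z₂ q ξ = rb 1 ξ / (rr 0 ξ * (‖ξ‖ ^ 2 : ℝ)) *
        ∫ q in Ω, G 1 q * (ex q ξ * (ep 1 q ξ - em 1 q ξ) *
          (rr 0 ξ * ep 0 q ξ - rb 0 ξ * em 0 q ξ)) := by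
      rw [← integral_const_mul]
      refine integral_congr_ae (ae_of_all _ fun q => ?_)
      simp only [Z₂]; ring
    rw [e1, e2, h]; ring
  have s₁ : ∫ ξ, solutionSymbol 0 (fun p => -2 * f 0 p) ξ * ift (dz 0 φ) ξ =
      -I * ((∫ ξ, (∫ q in Ω, G 0 q * (W₁ q ξ + R₁ q ξ)) * ift φ ξ) +
        ∫ ξ, (∫ q in Ω, G 0 q * Z₁ q ξ) * ift φ ξ) := by
    rw [← integral_add iA₁ iZ₁, ← integral_const_mul]
    refine integral_congr_ae ?_
    filter_upwards [ae_ne_zero] with ξ hξ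
    have e := solutionSymbol_zero (hG 0) hξ
    have e' : ∫ q in Ω, G 0 q * (W₁ q ξ + R₁ q ξ + Z₁ q ξ) =
        (∫ q in Ω, G 0 q * (W₁ q ξ + R₁ q ξ)) + ∫ q in Ω, G 0 q * Z₁ q ξ := by
      rw [← integral_add (integrableOn_kernel_left (κ := fun q ξ => W₁ q ξ + R₁ q ξ) mWR₁ hWR₁ _ ξ)
        (integrableOn_kernel_left measurable_Z₁ (fun q _ => norm_Z₁_le q) _ ξ)]
      simp only [mul_add]
    rw [e'] at e
    rw [hφ.ift_dz]
    linear_combination -(I / 2) * ift φ ξ * e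
  have s₂ : ∫ ξ, solutionSymbol 1 (fun p => -2 * f 1 p) ξ * ift (dz 1 φ) ξ =
      -I * ((∫ ξ, (∫ q in Ω, G 1 q * (W₂ q ξ + R₂ q ξ)) * ift φ ξ) +
        ∫ ξ, (∫ q in Ω, G 1 q * Z₂ q ξ) * ift φ ξ) := by
    rw [← integral_add iA₂ iZ₂, ← integral_const_mul]
    refine integral_congr_ae ?_
    filter_upwards [ae_ne_zero] with ξ hξ
    have e := solutionSymbol_one (hG 1) hξ
    have e' : ∫ q in Ω, G 1 q * (W₂ q ξ + R₂ q ξ + Z₂ q ξ) =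
        (∫ q in Ω, G 1 q * (W₂ q ξ + R₂ q ξ)) + ∫ q in Ω, G 1 q * Z₂ q ξ := by
      rw [← integral_add (integrableOn_kernel_left (κ := fun q ξ => W₂ q ξ + R₂ q ξ) mWR₂ hWR₂ _ ξ)
        (integrableOn_kernel_left measurable_Z₂ (fun q _ => norm_Z₂_le q) _ ξ)]
      simp only [mul_add]
    rw [e'] at e
    rw [hφ.ift_dz]
    linear_combination -(I / 2) * ift φ ξ * e
  have hZ' : ∫ ξ, (∫ q in Ω, G 1 q * Z₂ q ξ) * ift φ ξ =
      -∫ ξ, (∫ q in Ω, G 0 q * Z₁ q ξ) * ift φ ξ := by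
    rw [← integral_neg]; simp only [hZ, neg_mul]
  have hN : ∀ j, N f j (dz j φ) = ((2 * Real.pi) ^ 4 : ℝ)⁻¹ *
      ∫ ξ, solutionSymbol j (fun p => -2 * f j p) ξ * ift (dz j φ) ξ := fun j => rfl
  rw [dbarStar, Fin.sum_univ_two, hN, hN, s₁, s₂, hZ', integral_K₁_eq hφ, integral_K₂_eq hφ]
  ring

end

section

variable {φ : E → ℂ}

/-! ### Smooth dependence of integrals on parameters -/

/-- Induction on the order, differentiating under the integral sign. The target space is general
because the derivative of `H ξ` takes values in a space of linear maps. -/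
lemma contDiff_integral_smul {K : E → ℂ} (hK : Measurable K) (n : ℕ) :
    ∀ {F : Type} [NormedAddCommGroup F] [NormedSpace ℝ F] [NormedSpace ℂ F] [SMulCommClass ℝ ℂ F]
      {H : E → E → F} (_ : ContDiff ℝ ∞ fun z : E × E => H z.1 z.2)
      (_ : ∀ m, ∃ B : E → ℝ, Integrable B ∧
        ∀ ξ p, ‖K ξ‖ * ‖iteratedFDeriv ℝ m (H ξ) p‖ ≤ B ξ),
      ContDiff ℝ n fun p => ∫ ξ, K ξ • H ξ p := by
  induction n with
  | zero =>
    intro F _ _ _ _ H hH hB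
    obtain ⟨B, hBi, hB⟩ := hB 0
    rw [Nat.cast_zero, contDiff_zero]
    have hc := hH.continuous
    refine continuous_of_dominated (bound := B) (fun p => ?_) (fun p => ae_of_all _ fun ξ => ?_) hBi
      (ae_of_all _ fun ξ => ?_)
    · exact hK.aestronglyMeasurable.smul
        (hc.comp (by fun_prop : Continuous fun ξ : E => (ξ, p))).aestronglyMeasurable
    · rw [norm_smul, ← norm_iteratedFDeriv_zero (𝕜 := ℝ) (f := H ξ)]
      exact hB ξ p
    · exact (hc.comp (by fun_prop : Continuous fun p : E => (ξ, p))).const_smul (K ξ)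
  | succ n ih =>
    intro F _ _ _ _ H hH hB
    have hξ : ∀ ξ, ContDiff ℝ ∞ (H ξ) := fun ξ =>
      hH.comp (by fun_prop : ContDiff ℝ ∞ fun p : E => (ξ, p))
    have hd : ContDiff ℝ ∞ fun z : E × E => fderiv ℝ (H z.1) z.2 :=
      ContDiff.fderiv (f := fun z : E × E => H z.1) (m := ∞) (n := ∞)
        (hH.comp (by fun_prop : ContDiff ℝ ∞ fun w : (E × E) × E => (w.1.1, w.2)))
        contDiff_snd (by simp)
    have hB' : ∀ m, ∃ B : E → ℝ, Integrable B ∧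
        ∀ ξ p, ‖K ξ‖ * ‖iteratedFDeriv ℝ m (fun p => fderiv ℝ (H ξ) p) p‖ ≤ B ξ := by
      intro m
      obtain ⟨B, hBi, hB⟩ := hB (m + 1)
      refine ⟨B, hBi, fun ξ p => ?_⟩
      have := hB ξ p
      rwa [← norm_iteratedFDeriv_fderiv] at this
    rw [Nat.cast_succ, contDiff_succ_iff_hasFDerivAt]
    refine ⟨fun p => ∫ ξ, K ξ • fderiv ℝ (H ξ) p, ih hd hB', fun p => ?_⟩
    obtain ⟨B₀, hB₀i, hB₀⟩ := hB 0
    obtain ⟨B₁, hB₁i, hB₁⟩ := hB' 0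
    have hm : ∀ p, AEStronglyMeasurable (fun ξ => K ξ • H ξ p) := fun p =>
      hK.aestronglyMeasurable.smul
        (hH.continuous.comp (by fun_prop : Continuous fun ξ : E => (ξ, p))).aestronglyMeasurable
    refine hasFDerivAt_integral_of_dominated_of_fderiv_le (𝕜 := ℝ) (bound := B₁)
      (F := fun p ξ => K ξ • H ξ p) (F' := fun p ξ => K ξ • fderiv ℝ (H ξ) p) (s := univ)
      Filter.univ_mem (Eventually.of_forall hm) ?_ ?_ (ae_of_all _ fun ξ q _ => ?_) hB₁i
      (ae_of_all _ fun ξ q _ => ?_)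
    · refine Integrable.mono' hB₀i (hm p) (ae_of_all _ fun ξ => ?_)
      rw [norm_smul, ← norm_iteratedFDeriv_zero (𝕜 := ℝ) (f := H ξ)]
      exact hB₀ ξ p
    · exact hK.aestronglyMeasurable.smul
        (hd.continuous.comp (by fun_prop : Continuous fun ξ : E => (ξ, p))).aestronglyMeasurable
    · rw [norm_smul]
      have := hB₁ ξ q
      rwa [norm_iteratedFDeriv_zero] at this
    · exact (((hξ ξ).differentiable (by simp)).differentiableAt.hasFDerivAt).const_smul (K ξ)

/-- Smooth functions of `p` depending smoothly on `ξ`, whose derivatives in `p` grow at most like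
powers of `ξ`. -/
structure Tame (H : E → E → ℂ) : Prop where
  smooth : ContDiff ℝ ∞ fun z : E × E => H z.1 z.2
  bound : ∀ n, ∃ C, 0 ≤ C ∧ ∀ ξ p, ‖iteratedFDeriv ℝ n (H ξ) p‖ ≤ C * (1 + ‖ξ‖) ^ n

namespace Tame

variable {H H' : E → E → ℂ}

lemma smooth_right (h : Tame H) (ξ : E) : ContDiff ℝ ∞ (H ξ) :=
  h.smooth.comp (by fun_prop : ContDiff ℝ ∞ fun p : E => (ξ, p))

lemma mul (h : Tame H) (h' : Tame H') : Tame fun ξ p => H ξ p * H' ξ p where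
  smooth := h.smooth.mul h'.smooth
  bound n := by
    choose C hC0 hC using h.bound
    choose D hD0 hD using h'.bound
    refine ⟨∑ i ∈ Finset.range (n + 1), (n.choose i : ℝ) * C i * D (n - i),
      Finset.sum_nonneg fun i _ => by have := hC0 i; have := hD0 (n - i); positivity,
      fun ξ p => ?_⟩
    refine (norm_iteratedFDeriv_mul_le (h.smooth_right ξ) (h'.smooth_right ξ) p
      (by exact_mod_cast le_top)).trans ?_
    rw [Finset.sum_mul]
    refine Finset.sum_le_sum fun i hi => ?_
    have hin : i + (n - i) = n := by have := Finset.mem_range.1 hi; omega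
    calc _ ≤ (n.choose i : ℝ) * (C i * (1 + ‖ξ‖) ^ i) * (D (n - i) * (1 + ‖ξ‖) ^ (n - i)) := by
          have := hC0 i
          gcongr
          · exact hC i ξ p
          · exact hD _ ξ p
      _ = (n.choose i : ℝ) * C i * D (n - i) * (1 + ‖ξ‖) ^ (i + (n - i)) := by ring
      _ = _ := by rw [hin]

/-- Each derivative in `p` brings out one factor `‖L ξ‖ ≤ ‖ξ‖`. -/
lemma comp_linear {ψ : ℝ → ℂ} (hψ : ContDiff ℝ ∞ ψ)
    (hb : ∀ n, ∃ C, ∀ t, ‖iteratedFDeriv ℝ n ψ t‖ ≤ C) {L : E → E →L[ℝ] ℝ}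
    (hL : ContDiff ℝ ∞ fun z : E × E => L z.1 z.2) (hLn : ∀ ξ, ‖L ξ‖ ≤ ‖ξ‖) :
    Tame fun ξ p => ψ (L ξ p) where
  smooth := hψ.comp hL
  bound n := by
    obtain ⟨C, hC⟩ := hb n
    have hC0 : 0 ≤ C := (norm_nonneg _).trans (hC 0)
    refine ⟨C, hC0, fun ξ p => ?_⟩
    have := (L ξ).iteratedFDeriv_comp_right hψ p (i := n) (by exact_mod_cast le_top)
    change ‖iteratedFDeriv ℝ n (ψ ∘ L ξ) p‖ ≤ _
    rw [this]
    refine (ContinuousMultilinearMap.norm_compContinuousLinearMap_le _ _).trans ?_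
    rw [Finset.prod_const, Finset.card_univ, Fintype.card_fin]
    gcongr
    · exact hC _
    · linarith [hLn ξ]

end Tame

lemma iteratedDeriv_cexp_mul (c : ℂ) (n : ℕ) (t : ℝ) :
    iteratedDeriv n (fun t : ℝ => cexp (c * t)) t = c ^ n * cexp (c * t) := by
  induction n generalizing t with
  | zero => simp
  | succ n ih =>
    rw [iteratedDeriv_succ, funext ih, ((hasDerivAt_cexp_mul c t).const_mul (c ^ n)).deriv]
    ring

lemma iteratedFDeriv_bound_exp_I (n : ℕ) :
    ∃ C, ∀ t, ‖iteratedFDeriv ℝ n (fun t : ℝ => cexp (I * t)) t‖ ≤ C := by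
  refine ⟨1, fun t => ?_⟩
  rw [norm_iteratedFDeriv_eq_norm_iteratedDeriv, iteratedDeriv_cexp_mul]
  simp [norm_exp]

/-- A smooth function with bounded derivatives that equals `e^{-t}` for `t > 0`. -/
def chi (t : ℝ) : ℝ := Real.exp (-t) * Real.smoothTransition (t + 1)

lemma chi_of_pos {t : ℝ} (h : 0 < t) : chi t = Real.exp (-t) := by
  rw [chi, Real.smoothTransition.one_of_one_le (by linarith), mul_one]

lemma contDiff_chi : ContDiff ℝ ∞ fun t => (chi t : ℂ) := by
  unfold chi
  exact Complex.ofRealCLM.contDiff.comp ((by fun_prop : ContDiff ℝ ∞ fun t : ℝ => Real.exp (-t)).mul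
    (Real.smoothTransition.contDiff.comp (by fun_prop)))

/-- `chi` is `e^{-t}` for `t > 0` and zero for `t < -1`; compactness covers the interval between. -/
lemma iteratedFDeriv_bound_chi (n : ℕ) :
    ∃ C, ∀ t, ‖iteratedFDeriv ℝ n (fun t => (chi t : ℂ)) t‖ ≤ C := by
  have hc : Continuous fun t => ‖iteratedDeriv n (fun t => (chi t : ℂ)) t‖ :=
    (contDiff_chi.continuous_iteratedDeriv n (by exact_mod_cast le_top)).norm
  obtain ⟨C, hC⟩ := (isCompact_Icc (a := (-1 : ℝ)) (b := 0)).exists_bound_of_continuousOn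
    hc.continuousOn
  refine ⟨max C 1, fun t => ?_⟩
  rw [norm_iteratedFDeriv_eq_norm_iteratedDeriv]
  rcases lt_or_ge 0 t with h | h
  · have e : (fun t => (chi t : ℂ)) =ᶠ[𝓝 t] fun t : ℝ => cexp (-1 * t) := by
      filter_upwards [lt_mem_nhds h] with s hs
      rw [chi_of_pos hs]; simp
    rw [(e.iteratedDeriv n).eq_of_nhds, iteratedDeriv_cexp_mul]
    refine le_trans ?_ (le_max_right _ _)
    simp only [norm_mul, norm_pow, norm_neg, norm_one, one_pow, one_mul, neg_mul]
    exact norm_cexp_neg_le h.le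
  rcases lt_or_ge t (-1) with h' | h'
  · have e : (fun t => (chi t : ℂ)) =ᶠ[𝓝 t] fun _ : ℝ => (0 : ℂ) := by
      filter_upwards [gt_mem_nhds h'] with s hs
      rw [chi, Real.smoothTransition.zero_of_nonpos (by linarith)]; simp
    rw [(e.iteratedDeriv n).eq_of_nhds]
    refine le_trans ?_ (le_max_right _ _)
    rw [iteratedDeriv_const]
    split_ifs <;> simp
  · refine le_trans ?_ (le_max_left _ _)
    have := hC t ⟨h', h⟩
    rwa [norm_norm] at this

/-- Integrals `∫ M(ξ) Γ(ξ) H(ξ, p) dξ` are smooth in `p`. -/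
lemma Tame.contDiff_integral {H : E → E → ℂ} (hH : Tame H) {M : E → ℂ} (hM : Measurable M) {C : ℝ}
    (hMC : ∀ ξ, ‖M ξ‖ ≤ C * wt ξ) (Γ : 𝓢(E, ℂ)) :
    ContDiff ℝ ∞ fun p => ∫ ξ, (M ξ * Γ ξ) * H ξ p := by
  rw [contDiff_infty]
  intro n
  refine contDiff_integral_smul (hM.mul Γ.continuous.measurable) n hH.smooth fun m => ?_
  obtain ⟨D, hD0, hD⟩ := hH.bound m
  obtain ⟨D', hD'0, hD'⟩ := exists_bound_schwartz Γ m
  refine ⟨fun ξ => (C * D * D') * (wt ξ * decay ξ), integrable_wt_mul_decay.const_mul _,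
    fun ξ p => ?_⟩
  have h0 : 0 ≤ C * wt ξ := (norm_nonneg _).trans (hMC ξ)
  rw [Pi.mul_apply, norm_mul]
  calc _ ≤ (C * wt ξ * ‖Γ ξ‖) * (D * (1 + ‖ξ‖) ^ m) := by
        gcongr
        · exact hMC ξ
        · exact hD ξ p
    _ = C * wt ξ * D * ((1 + ‖ξ‖) ^ m * ‖Γ ξ‖) := by ring
    _ ≤ C * wt ξ * D * (D' * decay ξ) := mul_le_mul_of_nonneg_left (hD' ξ) (by positivity)
    _ = _ := by ring

lemma IsTest.integrable (hφ : IsTest φ) : Integrable φ := by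
  obtain ⟨F, rfl⟩ := hφ.exists_schwartz
  exact F.integrable

lemma Tame.integral_swap {H : E → E → ℂ} (hH : Tame H) {M : E → ℂ} (hM : Measurable M) {C : ℝ}
    (hMC : ∀ ξ, ‖M ξ‖ ≤ C * wt ξ) (Γ : 𝓢(E, ℂ)) (hφ : IsTest φ) :
    Integrable (fun ξ => M ξ * Γ ξ * ∫ p, H ξ p * φ p) ∧
    ∫ p in Ω, (∫ ξ, M ξ * Γ ξ * H ξ p) * φ p = ∫ ξ, M ξ * Γ ξ * ∫ p, H ξ p * φ p := by
  obtain ⟨D, hD0, hD⟩ := hH.bound 0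
  obtain ⟨D', hD'0, hD'⟩ := exists_bound_schwartz Γ 0
  have hMΓ : Integrable fun ξ => M ξ * Γ ξ :=
    integrable_kernel hM hMC Γ.continuous.measurable (fun ξ => by simpa using hD' ξ)
  have hi : Integrable (fun z : E × E => (M z.1 * Γ z.1) * (H z.1 z.2 * φ z.2))
      (volume.prod volume) := by
    refine ((hMΓ.mul_prod hφ.integrable).bdd_mul (c := D) (f := fun z : E × E => H z.1 z.2)
      hH.smooth.continuous.aestronglyMeasurable (ae_of_all _ fun z => ?_)).congr
      (ae_of_all _ fun z => ?_)
    · simpa using hD z.1 z.2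
    · simp only []; ring
  have h1 := hi.integral_prod_left
  simp only [integral_const_mul] at h1
  refine ⟨h1, ?_⟩
  rw [setIntegral_eq_integral_of_forall_compl_eq_zero]
  · simp only [← integral_const_mul, ← integral_mul_const]
    rw [integral_integral_swap (f := fun ξ p => (M ξ * Γ ξ) * (H ξ p * φ p)) hi]
    refine integral_congr_ae (ae_of_all _ fun p => integral_congr_ae (ae_of_all _ fun ξ => ?_))
    simp only []; ring
  · intro p hp
    have : φ p = 0 := by
      by_contra h0
      exact hp (hφ.supp (subset_tsupport φ h0))
    rw [this, mul_zero]

end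

section

variable {φ : E → ℂ}

/-! ### Fourier–Laplace integrals on slices -/

/-- The Fourier–Laplace integral of `g` with the weight `e^{-a |p_i|}`. -/
def lap (i : Idx) (a : ℝ) (g : E → ℂ) (ξ : E) : ℂ :=
  ∫ p : E, cexp (-(a * |p i| : ℝ)) * (g p * cexp (I * (inner ℝ p (upd ξ i 0) : ℝ)))

lemma half_neg_upd (i : Idx) (a : ℝ) (g : E → ℂ) (ξ : E) (t : ℝ) :
    half i a g (-upd ξ i t) = half i a g (-ξ) := by
  simp only [half, neg_upd, upd_upd]

lemma lap_neg_upd (i : Idx) (a : ℝ) (g : E → ℂ) (ξ : E) (t : ℝ) :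
    lap i a g (-upd ξ i t) = lap i a g (-ξ) := by
  simp only [lap, neg_upd, upd_upd]

lemma IsTest.integral_div_add (hφ : IsTest φ) (ξ : E) (j : Fin 2) {a : ℝ} (ha : 0 < a) :
    ∫ t : ℝ, ift φ (upd ξ (Sum.inr j) t) / (a + I * t) =
      2 * Real.pi * half (Sum.inr j) a φ ξ := by
  simpa using (hφ.hasInt_add ξ j ha le_rfl).eq

namespace Sliceable

variable {i : Idx} {g : E → ℂ}

lemma integral_neg_div_sub (hg : Sliceable i g) {ξ : E}
    (hh : Integrable fun t => ift g (upd (-ξ) i t)) {a : ℝ} (ha : 0 < a) :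
    ∫ t : ℝ, ift g (-upd ξ i t) / (a - I * t) = 2 * Real.pi * half i a g (-ξ) := by
  have h := hg.integral_ift_div_add hh ha 0
  rw [← integral_neg_eq_self, half]
  simpa [neg_upd] using h

lemma integral_neg_div_add (hg : Sliceable i g) {ξ : E}
    (hh : Integrable fun t => ift g (upd (-ξ) i t)) {a : ℝ} (ha : 0 < a) :
    ∫ t : ℝ, ift g (-upd ξ i t) / (a + I * t) = 2 * Real.pi *
      ∫ p : E, expR a 0 (-p i) * (g p * cexp (I * (inner ℝ p (upd (-ξ) i 0) : ℝ))) := by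
  have h := hg.integral_ift_div_sub hh ha 0
  rw [← integral_neg_eq_self]
  simpa [neg_upd, sub_eq_add_neg] using h

lemma integrable_neg_div (hh : Integrable fun t => ift g (upd (-(ξ : E)) i t)) {a : ℝ}
    (ha : 0 < a) {ε : ℂ} (hε : ε = I ∨ ε = -I) :
    Integrable fun t : ℝ => ift g (-upd ξ i t) / (a + ε * t) := by
  have h1 : Integrable fun t : ℝ => ift g (-upd ξ i t) := by
    simpa [neg_upd] using hh.comp_neg
  simpa using integrable_mul_div h1 ha.ne' 0 ε hε

/-- `2a/(a² + t²)` is the sum of `1/(a - it)` and `1/(a + it)`, whose integrals are the Laplace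
integrals over the two half-lines; together they give the weight `e^{-a|p_i|}`. -/
lemma integral_poisson (hg : Sliceable i g) {ξ : E}
    (hh : Integrable fun t => ift g (upd (-ξ) i t)) {a : ℝ} (ha : 0 < a) :
    ∫ t : ℝ, (2 * a / (a ^ 2 + t ^ 2) : ℝ) * ift g (-upd ξ i t) =
      2 * Real.pi * lap i a g (-ξ) := by
  have e : ∀ t : ℝ, (2 * a / (a ^ 2 + t ^ 2) : ℝ) * ift g (-upd ξ i t) =
      ift g (-upd ξ i t) / (a - I * t) + ift g (-upd ξ i t) / (a + I * t) := by
    intro t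
    have h1 := add_I_mul_ne_zero ha.ne' t
    have h2 := sub_I_mul_ne_zero ha.ne' t
    have h3 : ((a ^ 2 + t ^ 2 : ℝ) : ℂ) = (a - I * t) * (a + I * t) := by
      push_cast; ring_nf; rw [I_sq]; ring
    rw [ofReal_div, h3]
    push_cast
    field_simp
    ring
  have h1 : Integrable fun t : ℝ => ift g (-upd ξ i t) / (a - I * t) := by
    simpa [sub_eq_add_neg] using integrable_neg_div hh ha (Or.inr rfl)
  have h2 := integrable_neg_div hh ha (Or.inl rfl)
  simp only [e]
  rw [integral_add h1 h2, hg.integral_neg_div_sub hh ha, hg.integral_neg_div_add hh ha, half, lap,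
    ← mul_add, ← integral_add (hg.integrable_aux (-ξ) (expR a 0) (by fun_prop)
      (norm_expR_le ha.le 0)) (hg.integrable_aux (-ξ) (fun t => expR a 0 (-t)) (by fun_prop)
      (fun t => norm_expR_le ha.le 0 (-t)))]
  congr 1
  refine integral_congr_ae ?_
  filter_upwards [ae_ne_zero] with p hp
  rcases lt_or_gt_of_ne (hp i) with h | h
  · rw [expR, expR, if_neg (by linarith), if_pos (by linarith), abs_of_neg h]
    simp
  · rw [expR, expR, if_pos (by linarith), if_neg (by linarith), abs_of_pos h]
    simp

end Sliceable

lemma integrable_slice_schwartz (G : 𝓢(E, ℂ)) (ξ : E) (i : Idx) :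
    Integrable fun t => ift G (upd ξ i t) := by
  obtain ⟨H, hH⟩ := exists_schwartz_ift G
  obtain ⟨C, _, hC⟩ := exists_bound_schwartz H 0
  have := integrable_slice_of_le_decay H.continuous.measurable (C := C)
    (fun ξ => by simpa using hC ξ) ξ i
  simpa only [hH] using this

lemma exists_schwartz_ift_neg (G : 𝓢(E, ℂ)) : ∃ H : 𝓢(E, ℂ), ∀ ξ, ift G (-ξ) = H ξ := by
  obtain ⟨H, hH⟩ := exists_schwartz_ift G
  refine ⟨SchwartzMap.compCLMOfContinuousLinearEquiv ℝ (ContinuousLinearEquiv.neg ℝ) H,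
    fun ξ => ?_⟩
  rw [hH]; rfl

/-! ### Plane waves -/

lemma contDiff_upd_zero (i : Idx) : ContDiff ℝ ∞ fun ξ : E => upd ξ i 0 := by
  have : (fun ξ : E => upd ξ i 0) = fun ξ => ξ - ξ i • EuclideanSpace.single i (1 : ℝ) := by
    funext ξ; ext k
    by_cases h : k = i <;> simp [upd_apply, h]
  rw [this]; fun_prop

lemma norm_upd_zero_le (ξ : E) (i : Idx) : ‖upd ξ i 0‖ ≤ ‖ξ‖ := by
  rw [EuclideanSpace.norm_eq, EuclideanSpace.norm_eq]
  refine Real.sqrt_le_sqrt (Finset.sum_le_sum fun k _ => ?_)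
  rw [upd_apply]
  split_ifs
  · simpa using sq_nonneg (ξ k)
  · exact le_rfl

lemma tame_wave {Λ : E → E} (hΛ : ContDiff ℝ ∞ Λ) (hn : ∀ ξ, ‖Λ ξ‖ ≤ ‖ξ‖) :
    Tame fun ξ p => cexp (I * (inner ℝ p (Λ ξ) : ℝ)) := by
  have := Tame.comp_linear (ψ := fun t : ℝ => cexp (I * t))
    (contDiff_const.mul Complex.ofRealCLM.contDiff).cexp iteratedFDeriv_bound_exp_I (L := fun ξ => innerSL ℝ (Λ ξ))
    (by simp only [innerSL_apply_apply]; exact (hΛ.comp contDiff_fst).inner ℝ contDiff_snd) (fun ξ => by simpa using hn ξ)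
  simpa only [innerSL_apply_apply, real_inner_comm] using this

lemma tame_chi (j : Fin 2) : Tame fun ξ p => (chi (X ξ j * Y p j) : ℂ) := by
  refine Tame.comp_linear (ψ := fun t => (chi t : ℂ)) contDiff_chi iteratedFDeriv_bound_chi
    (L := fun ξ => X ξ j • EuclideanSpace.proj (𝕜 := ℝ) (Sum.inr j)) ?_ (fun ξ => ?_)
  · simp only [X, _root_.smul_apply, PiLp.proj_apply, smul_eq_mul]
    fun_prop
  · refine ContinuousLinearMap.opNorm_le_bound _ (norm_nonneg _) fun p => ?_
    simp only [_root_.smul_apply, PiLp.proj_apply, norm_smul]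
    exact mul_le_mul (abs_X_le_norm j ξ) (PiLp.norm_apply_le p _) (norm_nonneg _) (norm_nonneg _)

lemma expR_zero_mul_eq (hφ : IsTest φ) (j : Fin 2) {a : ℝ} (p : E) :
    expR a 0 (Y p j) * φ p = cexp (-(a * Y p j : ℝ)) * φ p := by
  by_cases h : 0 < Y p j
  · rw [expR, if_pos h, sub_zero]
  · rw [hφ.eq_zero (not_lt.1 h), mul_zero, mul_zero]

/-- The growing side `y_j < 0` of `e^{-a y_j}` is invisible to `φ`, so the bounded, smooth `chi` may
stand in for it. -/
lemma chi_mul_eq (hφ : IsTest φ) (j : Fin 2) {a : ℝ} (ha : 0 < a) (p : E) :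
    (chi (a * Y p j) : ℂ) * φ p = expR a 0 (Y p j) * φ p := by
  rw [expR_zero_mul_eq hφ]
  by_cases h : 0 < Y p j
  · rw [chi_of_pos (mul_pos ha h)]; simp
  · rw [hφ.eq_zero (not_lt.1 h), mul_zero, mul_zero]

lemma IsTest.expR_mul (hφ : IsTest φ) (j : Fin 2) (a : ℝ) :
    IsTest fun p => expR a 0 (Y p j) * φ p := by
  simp only [expR_zero_mul_eq hφ]
  refine ⟨ContDiff.mul ?_ hφ.smooth, hφ.compact.mul_left,
    (closure_mono (Function.support_mul_subset_right _ _)).trans hφ.supp⟩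
  unfold Y
  exact (Complex.ofRealCLM.contDiff.comp
    (by fun_prop : ContDiff ℝ ∞ fun p : E => a * p (Sum.inr j))).neg.cexp

/-! ### Kernels represented by smooth functions -/

/-- The kernel `κ` maps Schwartz functions to functions that are smooth up to the boundary. -/
def Represented (κ : E → E → ℂ) : Prop :=
  ∀ G : 𝓢(E, ℂ), ∃ w : E → ℂ, ContDiff ℝ ∞ w ∧ ∀ φ, IsTest φ →
    Integrable (fun ξ => (∫ q, G q * κ q ξ) * ift φ ξ) ∧
    ∫ ξ, (∫ q, G q * κ q ξ) * ift φ ξ = ∫ p in Ω, w p * φ p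

lemma IsTest.integrable_mul (hφ : IsTest φ) {w : E → ℂ} (hw : ContDiff ℝ ∞ w) :
    Integrable fun p => w p * φ p :=
  (hw.continuous.mul hφ.smooth.continuous).integrable_of_hasCompactSupport hφ.compact.mul_left

lemma Represented.sub {κ κ' : E → E → ℂ} (h : Represented κ) (h' : Represented κ')
    (hi : ∀ (G : 𝓢(E, ℂ)) ξ, Integrable fun q => G q * κ q ξ)
    (hi' : ∀ (G : 𝓢(E, ℂ)) ξ, Integrable fun q => G q * κ' q ξ) :
    Represented fun q ξ => κ q ξ - κ' q ξ := by
  intro G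
  obtain ⟨w, hw, hwφ⟩ := h G
  obtain ⟨w', hw', hwφ'⟩ := h' G
  refine ⟨fun p => w p - w' p, hw.sub hw', fun φ hφ => ?_⟩
  obtain ⟨a, b⟩ := hwφ φ hφ
  obtain ⟨a', b'⟩ := hwφ' φ hφ
  simp only [mul_sub, integral_sub (hi G _) (hi' G _), sub_mul]
  refine ⟨a.sub a', ?_⟩
  rw [integral_sub a a', b, b', integral_sub (hφ.integrable_mul hw).integrableOn
    (hφ.integrable_mul hw').integrableOn]

lemma integrable_kernel_left {κ : E → E → ℂ} (hm : Measurable fun z : E × E => κ z.1 z.2) {C : ℝ}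
    (hb : ∀ q ξ, ‖κ q ξ‖ ≤ C * wt ξ) (G : 𝓢(E, ℂ)) (ξ : E) : Integrable fun q => G q * κ q ξ := by
  have : Measurable fun q => κ q ξ := hm.comp measurable_prodMk_right
  exact (G.integrable.bdd_mul (c := C * wt ξ) this.aestronglyMeasurable
    (ae_of_all _ fun q => hb q ξ)).congr (ae_of_all _ fun q => mul_comm _ _)

/-- The representing function is `∫ M(ξ) ift G(-ξ) H(ξ, p) dξ`. Only the equality of two integrals
over `ξ` is left to check; both integrabilities are handed to that check because comparison by
slices needs them. -/
lemma represented_of_tame {κ : E → E → ℂ} (hm : Measurable fun z : E × E => κ z.1 z.2) {C : ℝ}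
    (hb : ∀ q ξ, ‖κ q ξ‖ ≤ C * wt ξ) {H : E → E → ℂ} (hH : Tame H) {M : E → ℂ}
    (hM : Measurable M) {D : ℝ} (hMD : ∀ ξ, ‖M ξ‖ ≤ D * wt ξ)
    (h : ∀ (G : 𝓢(E, ℂ)) (φ : E → ℂ), IsTest φ →
      Integrable (fun ξ => (∫ q, G q * κ q ξ) * ift φ ξ) →
      Integrable (fun ξ => M ξ * ift G (-ξ) * ∫ p, H ξ p * φ p) →
      ∫ ξ, (∫ q, G q * κ q ξ) * ift φ ξ = ∫ ξ, M ξ * ift G (-ξ) * ∫ p, H ξ p * φ p) :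
    Represented κ := by
  intro G
  obtain ⟨Γ, hΓ⟩ := exists_schwartz_ift_neg G
  refine ⟨_, hH.contDiff_integral hM hMD Γ, fun φ hφ => ?_⟩
  obtain ⟨B, _, hB⟩ := hφ.ift_bound
  have hi := (integral_kernel_swap hm MeasurableSet.univ (fun q _ => hb q) G
    hφ.continuous_ift.measurable hB).1
  rw [Measure.restrict_univ] at hi
  obtain ⟨i1, i2⟩ := hH.integral_swap hM hMD Γ hφ
  refine ⟨hi, ?_⟩
  rw [i2]
  simp only [← hΓ] at i1 ⊢
  exact h G φ hφ hi i1

lemma cexp_inner_neg (q ξ : E) :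
    cexp (I * (inner ℝ q (-ξ) : ℝ)) = ex q ξ * ep 1 q ξ * ep 0 q ξ := by
  rw [ex, ep, ep, ← Complex.exp_add, ← Complex.exp_add, inner_eq_sum, Fintype.sum_sum_type]
  simp only [Fin.sum_univ_two, X, Y, PiLp.neg_apply]
  congr 1; push_cast; ring

lemma cexp_inner_upd_zero (q ξ : E) :
    cexp (I * (inner ℝ q (upd (-ξ) (Sum.inr 0) 0) : ℝ)) = ex q ξ * ep 1 q ξ := by
  rw [ex, ep, ← Complex.exp_add, inner_eq_sum, Fintype.sum_sum_type]
  simp only [Fin.sum_univ_two, X, Y, upd_apply, PiLp.neg_apply]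
  congr 1; simp; ring

lemma cexp_inner_upd_zero_one (q ξ : E) :
    cexp (I * (inner ℝ q (upd (upd (-ξ) (Sum.inr 0) 0) (Sum.inr 1) 0) : ℝ)) = ex q ξ := by
  rw [ex, inner_eq_sum, Fintype.sum_sum_type]
  simp only [Fin.sum_univ_two, X, upd_apply, PiLp.neg_apply]
  congr 1; simp; ring

/-- No contour change is needed: the integral over `q` is already `ift G(-ξ)/r_0`. -/
lemma represented_plane : Represented fun q ξ => ex q ξ * ep 1 q ξ * ep 0 q ξ / rr 0 ξ := by
  have hw : ∀ ξ, ‖(rr 0 ξ)⁻¹‖ ≤ 1 * wt ξ := fun ξ => by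
    rw [norm_inv, one_mul]; exact inv_le_wt 0 ξ
  refine represented_of_tame (C := 1) (by fun_prop)
    (fun q ξ => by simpa [div_eq_mul_inv] using hw ξ)
    (tame_wave (Λ := fun ξ => ξ) (by fun_prop) (fun ξ => le_rfl)) (M := fun ξ => (rr 0 ξ)⁻¹)
    (by fun_prop) hw fun G φ _ _ _ => ?_
  refine integral_congr_ae (ae_of_all _ fun ξ => ?_)
  have e1 : ∫ q, G q * (ex q ξ * ep 1 q ξ * ep 0 q ξ / rr 0 ξ) = ift G (-ξ) / rr 0 ξ := by
    rw [ift, ← integral_div]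
    refine integral_congr_ae (ae_of_all _ fun q => ?_)
    simp only [cexp_inner_neg]; ring
  have e2 : ∫ p, cexp (I * (inner ℝ p ξ : ℝ)) * φ p = ift φ ξ := by
    simp only [ift, mul_comm]
  simp only [e1, e2]
  ring

lemma rr_upd (ξ : E) (j : Fin 2) (t : ℝ) : rr j (upd ξ (Sum.inr j) t) = X ξ j + I * t := by
  rw [rr, X_upd, Y_upd_same]

/-- The Poisson weight `2 ξ_j / |ξ_j + i η_j|²` for `ξ_j > 0`, zero otherwise. -/
def pw (j : Fin 2) (ξ : E) : ℂ := if 0 < X ξ j then ((2 * X ξ j / ‖rr j ξ‖ ^ 2 : ℝ) : ℂ) else 0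

/-- The weight `2 ξ_1 / (ξ_1 - i η_1)` for `ξ_1 > 0`, zero otherwise. -/
def hw (ξ : E) : ℂ := if 0 < X ξ 0 then 2 * X ξ 0 / rb 0 ξ else 0

@[fun_prop] lemma measurable_pw (j : Fin 2) : Measurable (pw j) :=
  Measurable.ite (measurableSet_lt measurable_const (continuous_X j).measurable)
    (by fun_prop) measurable_const

@[fun_prop] lemma measurable_hw : Measurable hw :=
  Measurable.ite (measurableSet_lt measurable_const (continuous_X 0).measurable)
    (by fun_prop) measurable_const

lemma norm_pw_le (j : Fin 2) (ξ : E) : ‖pw j ξ‖ ≤ 2 * wt ξ := by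
  have h2 := inv_le_wt j ξ
  unfold pw
  split_ifs with h
  · have h1 := abs_X_le j ξ
    rw [abs_of_pos h] at h1
    have h3 : 0 < ‖rr j ξ‖ := h.trans_le h1
    rw [norm_real, Real.norm_of_nonneg (by positivity)]
    calc 2 * X ξ j / ‖rr j ξ‖ ^ 2 ≤ 2 * ‖rr j ξ‖ / ‖rr j ξ‖ ^ 2 := by gcongr
      _ = 2 * ‖rr j ξ‖⁻¹ := by field_simp
      _ ≤ 2 * wt ξ := by gcongr
  · simpa using wt_nonneg ξ

lemma norm_hw_le (ξ : E) : ‖hw ξ‖ ≤ 2 := by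
  unfold hw
  split_ifs with h
  · have h1 := abs_X_le 0 ξ
    have h3 : 0 < ‖rr 0 ξ‖ := (abs_pos.2 h.ne').trans_le h1
    rw [norm_div, norm_mul, norm_rb, norm_real, Real.norm_eq_abs, div_le_iff₀ h3]
    simpa using h1
  · simp

lemma pw_upd (ξ : E) (j : Fin 2) (t : ℝ) (h : 0 < X ξ j) :
    pw j (upd ξ (Sum.inr j) t) = (2 * X ξ j / (X ξ j ^ 2 + t ^ 2) : ℝ) := by
  rw [pw, norm_rr_sq, X_upd, Y_upd_same, if_pos h]

/-- The plane wave continued to `η_1 = i ξ_1`. -/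
def wave₀ (ξ p : E) : ℂ :=
  cexp (I * (inner ℝ p (upd ξ (Sum.inr 0) 0) : ℝ)) * chi (X ξ 0 * Y p 0)

lemma tame_wave₀ : Tame wave₀ :=
  (tame_wave (contDiff_upd_zero _) (fun ξ => norm_upd_zero_le ξ _)).mul (tame_chi 0)

lemma integral_wave₀ (hφ : IsTest φ) {ξ : E} (h : 0 < X ξ 0) :
    ∫ p, wave₀ ξ p * φ p = half (Sum.inr 0) (X ξ 0) φ ξ := by
  refine integral_congr_ae (ae_of_all _ fun p => ?_)
  have := chi_mul_eq hφ 0 h p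
  simp only [wave₀, Y] at this ⊢
  linear_combination cexp (I * (inner ℝ p (upd ξ (Sum.inr 0) 0) : ℝ)) * this

lemma half_upd (i : Idx) (a : ℝ) (g : E → ℂ) (ξ : E) (t : ℝ) :
    half i a g (upd ξ i t) = half i a g ξ := by
  simp only [half, upd_upd]

/-- The `q`-integral has no Schwartz decay in `η_0`, since `G` enters only through `lap`. On each
line both sides equal `2π · lap G · half φ`: the factor `1/(ξ_0 + iη_0)` integrated against `ift φ`
is traded for the Poisson weight integrated against `ift G`. -/
lemma represented_poisson : Represented fun q ξ => ex q ξ * ep 1 q ξ * pe 0 q ξ / rr 0 ξ := by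
  refine represented_of_tame (C := 1) (by fun_prop) (fun q ξ => ?_) tame_wave₀
    (measurable_pw 0) (norm_pw_le 0) fun G φ hφ hi hi' => ?_
  · rw [norm_div, norm_mul, norm_mul, norm_ex, norm_ep, one_mul, one_mul, div_eq_mul_inv]
    exact mul_le_mul (norm_pe_le 0 q ξ) (inv_le_wt 0 ξ) (by positivity) zero_le_one
  refine integral_eq_of_slices (Sum.inr 0) hi hi' fun ξ _ => ?_
  by_cases h : 0 < X ξ 0
  · have e1 : ∀ t : ℝ, ∫ q, G q * (ex q (upd ξ (Sum.inr 0) t) * ep 1 q (upd ξ (Sum.inr 0) t) *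
        pe 0 q (upd ξ (Sum.inr 0) t) / rr 0 (upd ξ (Sum.inr 0) t)) =
        lap (Sum.inr 0) (X ξ 0) G (-ξ) / (X ξ 0 + I * t) := by
      intro t
      rw [← lap_neg_upd _ _ _ _ t, lap, ← integral_div]
      refine integral_congr_ae (ae_of_all _ fun q => ?_)
      simp only [cexp_inner_upd_zero, pe, X_upd, if_pos h, rr_upd, Y]
      ring
    have e2 : ∀ t : ℝ, ∫ p, wave₀ (upd ξ (Sum.inr 0) t) p * φ p =
        half (Sum.inr 0) (X ξ 0) φ ξ := by
      intro t
      rw [integral_wave₀ hφ (by simpa using h), half_upd, X_upd]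
    simp only [e1, e2, pw_upd ξ 0 _ h]
    rw [integral_mul_const, (sliceable_schwartz _ G).integral_poisson
      (integrable_slice_schwartz G _ _) h]
    have e3 : ∀ t : ℝ, lap (Sum.inr 0) (X ξ 0) G (-ξ) / (X ξ 0 + I * t) *
        ift φ (upd ξ (Sum.inr 0) t) = lap (Sum.inr 0) (X ξ 0) G (-ξ) *
        (ift φ (upd ξ (Sum.inr 0) t) / (X ξ 0 + I * t)) := fun t => by ring
    simp only [e3]
    rw [integral_const_mul, hφ.integral_div_add ξ 0 h]
    ring
  · simp [pe, pw, h]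

/-- The same exchange with `1/(ξ_0 + iη_0)` on the side of `φ` and `1/(ξ_0 - iη_0)` on the side of
`G`; both integrals produce `half`. -/
lemma represented_boundary : Represented fun q ξ => be 0 q ξ * ex q ξ * ep 1 q ξ / (rr 0 ξ * rr 1 ξ) := by
  refine represented_of_tame (C := 10) (M := fun ξ => hw ξ / rr 1 ξ) (D := 2) (by fun_prop)
    (fun q ξ => norm_be_mul_le q ξ (by simp)) tame_wave₀
    (by fun_prop) (fun ξ => ?_) fun G φ hφ hi hi' => ?_
  · rw [norm_div, div_eq_mul_inv]
    exact mul_le_mul (norm_hw_le ξ) (inv_le_wt 1 ξ) (by positivity) zero_le_two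
  refine integral_eq_of_slices (Sum.inr 0) hi hi' fun ξ _ => ?_
  by_cases h : 0 < X ξ 0
  · have hr : ∀ t, rr 1 (upd ξ (Sum.inr 0) t) = rr 1 ξ := fun t => by simp [rr]
    have e1 : ∀ t : ℝ, (∫ q, G q * (be 0 q (upd ξ (Sum.inr 0) t) * ex q (upd ξ (Sum.inr 0) t) *
        ep 1 q (upd ξ (Sum.inr 0) t) / (rr 0 (upd ξ (Sum.inr 0) t) *
          rr 1 (upd ξ (Sum.inr 0) t)))) * ift φ (upd ξ (Sum.inr 0) t) =
        2 * X ξ 0 * half (Sum.inr 0) (X ξ 0) G (-ξ) / rr 1 ξ *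
          (ift φ (upd ξ (Sum.inr 0) t) / (X ξ 0 + I * t)) := by
      intro t
      have : ∫ q, G q * (be 0 q (upd ξ (Sum.inr 0) t) * ex q (upd ξ (Sum.inr 0) t) *
        ep 1 q (upd ξ (Sum.inr 0) t) / (rr 0 (upd ξ (Sum.inr 0) t) *
          rr 1 (upd ξ (Sum.inr 0) t))) = 2 * X ξ 0 / (rr 1 ξ * (X ξ 0 + I * t)) *
          half (Sum.inr 0) (X ξ 0) G (-ξ) := by
        rw [← half_neg_upd _ _ _ _ t, half, ← integral_const_mul]
        refine integral_congr_ae (ae_of_all _ fun q => ?_)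
        simp only [cexp_inner_upd_zero, be, X_upd, if_pos h, hr, rr_upd, Y]
        simp only [div_eq_mul_inv, mul_inv]
        ring
      rw [this]
      simp only [div_eq_mul_inv, mul_inv]
      ring
    have e2 : ∀ t : ℝ, hw (upd ξ (Sum.inr 0) t) / rr 1 (upd ξ (Sum.inr 0) t) *
        ift G (-upd ξ (Sum.inr 0) t) * ∫ p, wave₀ (upd ξ (Sum.inr 0) t) p * φ p =
        2 * X ξ 0 / rr 1 ξ * half (Sum.inr 0) (X ξ 0) φ ξ *
          (ift G (-upd ξ (Sum.inr 0) t) / (X ξ 0 - I * t)) := by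
      intro t
      rw [integral_wave₀ hφ (by simpa using h), half_upd, X_upd, hr, hw, X_upd, if_pos h, rb,
        X_upd, Y_upd_same]
      simp only [div_eq_mul_inv]
      ring
    simp only [e1, e2]
    rw [integral_const_mul, integral_const_mul, hφ.integral_div_add ξ 0 h,
      (sliceable_schwartz _ G).integral_neg_div_sub (integrable_slice_schwartz G _ _) h]
    ring
  · simp [be, hw, h]

/-- The plane wave continued to `η_1 = i ξ_1` and `η_2 = i ξ_2`. -/
def wave₀₁ (ξ p : E) : ℂ :=
  cexp (I * (inner ℝ p (upd (upd ξ (Sum.inr 0) 0) (Sum.inr 1) 0) : ℝ)) * chi (X ξ 0 * Y p 0) *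
    chi (X ξ 1 * Y p 1)

lemma tame_wave₀₁ : Tame wave₀₁ :=
  ((tame_wave ((contDiff_upd_zero _).comp (contDiff_upd_zero _))
    (fun ξ => (norm_upd_zero_le _ _).trans (norm_upd_zero_le ξ _))).mul (tame_chi 0)).mul
    (tame_chi 1)

/-- `g` damped by `e^{-a y_1}` and cut off to `y_1 > 0`. -/
def damp (a : ℝ) (g : E → ℂ) (p : E) : ℂ := expR a 0 (p (Sum.inr 0)) * g p

lemma half_zero_eq (a : ℝ) (g : E → ℂ) (ξ : E) :
    half (Sum.inr 0) a g ξ = ift (damp a g) (upd ξ (Sum.inr 0) 0) := by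
  simp only [half, ift, damp, mul_assoc]

lemma integral_wave₀₁ (hφ : IsTest φ) {ξ : E} (h0 : 0 < X ξ 0) (h1 : 0 < X ξ 1) :
    ∫ p, wave₀₁ ξ p * φ p =
      half (Sum.inr 1) (X ξ 1) (damp (X ξ 0) φ) (upd ξ (Sum.inr 0) 0) := by
  refine integral_congr_ae (ae_of_all _ fun p => ?_)
  have e0 := chi_mul_eq hφ 0 h0 p
  have e1 := chi_mul_eq (hφ.expR_mul 0 (X ξ 0)) 1 h1 p
  simp only [wave₀₁, damp, Y] at e0 e1 ⊢
  linear_combination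
    cexp (I * (inner ℝ p (upd (upd ξ (Sum.inr 0) 0) (Sum.inr 1) 0) : ℝ)) * e1 +
    cexp (I * (inner ℝ p (upd (upd ξ (Sum.inr 0) 0) (Sum.inr 1) 0) : ℝ)) *
      chi (X ξ 1 * p (Sum.inr 1)) * e0

lemma sliceable_damp (G : 𝓢(E, ℂ)) {a : ℝ} (ha : 0 ≤ a) : Sliceable (Sum.inr 1) (damp a G) where
  meas := by
    have := G.continuous.measurable
    unfold damp; fun_prop
  bound := by
    obtain ⟨C, hC⟩ := (sliceable_schwartz (Sum.inr 1) G).bound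
    refine ⟨C, fun p => le_trans ?_ (hC p)⟩
    rw [damp, norm_mul]
    exact mul_le_of_le_one_left (norm_nonneg _) (norm_expR_le ha _ _)
  cont r := by
    have h : ∀ t, ins (Sum.inr 1) t r (Sum.inr 0) = r ⟨Sum.inr 0, by simp⟩ := fun t =>
      ins_ne _ _ _ _
    simp only [damp, h]
    exact continuous_const.mul ((sliceable_schwartz _ G).cont r)

/-- The damped function is not Schwartz. Its transform is, up to `2π`, the `η_i`-integral of `ift
G/(a + iη_i)`, which is jointly integrable in the two variables. -/
lemma integrable_slice_half (G : 𝓢(E, ℂ)) {i j : Idx} (hij : i ≠ j) (ζ : E) {a : ℝ} (ha : 0 < a) :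
    Integrable fun s => half i a G (upd ζ j s) := by
  obtain ⟨H, hH⟩ := exists_schwartz_ift G
  obtain ⟨C, _, hC⟩ := exists_bound_schwartz H 0
  have hi : Integrable (fun z : ℝ × ℝ => H (upd (upd ζ j z.1) i z.2) / (a + I * z.2))
      (volume.prod volume) := by
    have hm : Measurable fun z : ℝ × ℝ => H (upd (upd ζ j z.1) i z.2) := by
      have h1 : Continuous fun z : ℝ × ℝ => upd ζ j z.1 :=
        (continuous_upd_right ζ j).comp continuous_fst
      exact (H.continuous.comp ((continuous_upd i).comp (h1.prodMk continuous_snd))).measurable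
    refine Integrable.mono' ((integrable_inv_one_add_sq.mul_prod
      integrable_inv_one_add_sq).const_mul (C * decay (upd (upd ζ j 0) i 0) * a⁻¹))
      (Measurable.aestronglyMeasurable (by fun_prop)) (ae_of_all _ fun z => ?_)
    have h1 : ‖H (upd (upd ζ j z.1) i z.2)‖ ≤
        C * ((1 + z.2 ^ 2)⁻¹ * ((1 + z.1 ^ 2)⁻¹ * decay (upd (upd ζ j 0) i 0))) := by
      have := hC (upd (upd ζ j z.1) i z.2)
      rwa [pow_zero, one_mul, decay_upd (upd ζ j z.1) i z.2,
        upd_comm ζ hij.symm z.1 0, decay_upd (upd ζ i 0) j z.1,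
        ← upd_comm ζ hij.symm 0 0] at this
    have h2 : ‖(a + I * z.2 : ℂ)‖⁻¹ ≤ a⁻¹ :=
      inv_anti₀ ha ((le_abs_self a).trans (abs_le_norm_add_I_mul a z.2))
    rw [norm_div, div_eq_mul_inv]
    calc _ ≤ C * ((1 + z.2 ^ 2)⁻¹ * ((1 + z.1 ^ 2)⁻¹ * decay (upd (upd ζ j 0) i 0))) * a⁻¹ :=
          mul_le_mul h1 h2 (by positivity) ((norm_nonneg _).trans h1)
      _ = _ := by ring
  refine (hi.integral_prod_left.const_mul (2 * Real.pi : ℂ)⁻¹).congr (ae_of_all _ fun s => ?_)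
  have h := (sliceable_schwartz i G).integral_ift_div_add
    (integrable_slice_schwartz G (upd ζ j s) i) ha 0
  simp only [ofReal_zero, mul_zero, Complex.exp_zero, mul_one, hH] at h
  simp only [h]
  have hpi : (2 * Real.pi : ℂ) ≠ 0 := by simp [Real.pi_ne_zero]
  rw [inv_mul_cancel_left₀ hpi, half]

/-- The two exchanges combined: as for `be` in `η_0`, then as for the Poisson factor in `η_1`,
applied to the functions already damped in `y_0`. On each plane both sides become `(2π)² · 2ξ_0`
times `lap` of the damped `G` times `half` of the damped `φ`. -/
lemma represented_boundary_poisson : Represented fun q ξ => be 0 q ξ * ex q ξ * pe 1 q ξ / (rr 0 ξ * rr 1 ξ) := by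
  refine represented_of_tame (C := 10) (M := fun ξ => hw ξ * pw 1 ξ) (D := 4) (by fun_prop)
    (fun q ξ => norm_be_mul_le q ξ ((norm_pe_le 1 q ξ).trans one_le_two)) tame_wave₀₁
    (by fun_prop) (fun ξ => ?_) fun G φ hφ hi hi' => ?_
  · rw [norm_mul]
    have := mul_le_mul (norm_hw_le ξ) (norm_pw_le 1 ξ) (norm_nonneg _) zero_le_two
    linarith
  have h01 : (Sum.inr 0 : Idx) ≠ Sum.inr 1 := by simp
  refine integral_eq_of_slices₂ h01 hi hi' fun ξ _ => ?_
  by_cases h0 : 0 < X ξ 0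
  · by_cases h1 : 0 < X ξ 1
    · set ζ := upd ξ (Sum.inr 0) 0 with hζ
      set c : ℂ := 2 * X ξ 0 * lap (Sum.inr 1) (X ξ 1) (damp (X ξ 0) G) (-ζ) with hc
      set h : ℂ := half (Sum.inr 1) (X ξ 1) (damp (X ξ 0) φ) ζ with hh
      have hφ' : IsTest (damp (X ξ 0) φ) := hφ.expR_mul 0 (X ξ 0)
      have hr : ∀ s t, rr 1 (upd (upd ξ (Sum.inr 1) s) (Sum.inr 0) t) = X ξ 1 + I * s :=
        fun s t => by simp [rr]
      have hp : ∀ s t, pw 1 (upd (upd ξ (Sum.inr 1) s) (Sum.inr 0) t) =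
          (2 * X ξ 1 / (X ξ 1 ^ 2 + s ^ 2) : ℝ) := fun s t => by
        rw [upd_comm _ h01.symm, pw_upd _ _ _ (by simpa using h1), X_upd]
      have hu : ∀ s t, upd (upd (-upd (upd ξ (Sum.inr 1) s) (Sum.inr 0) t) (Sum.inr 0) 0)
          (Sum.inr 1) 0 = upd (-ζ) (Sum.inr 1) 0 := fun s t => by
        rw [hζ, neg_upd, neg_upd, neg_upd, upd_upd, upd_comm _ h01.symm, upd_upd, neg_zero]
      have e1 : ∀ s t : ℝ, (∫ q, G q * (be 0 q (upd (upd ξ (Sum.inr 1) s) (Sum.inr 0) t) *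
          ex q (upd (upd ξ (Sum.inr 1) s) (Sum.inr 0) t) *
          pe 1 q (upd (upd ξ (Sum.inr 1) s) (Sum.inr 0) t) /
          (rr 0 (upd (upd ξ (Sum.inr 1) s) (Sum.inr 0) t) *
            rr 1 (upd (upd ξ (Sum.inr 1) s) (Sum.inr 0) t)))) *
            ift φ (upd (upd ξ (Sum.inr 1) s) (Sum.inr 0) t) =
          c / (X ξ 1 + I * s) *
            (ift φ (upd (upd ξ (Sum.inr 1) s) (Sum.inr 0) t) / (X ξ 0 + I * t)) := by
        intro s t
        have : ∫ q, G q * (be 0 q (upd (upd ξ (Sum.inr 1) s) (Sum.inr 0) t) *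
            ex q (upd (upd ξ (Sum.inr 1) s) (Sum.inr 0) t) *
            pe 1 q (upd (upd ξ (Sum.inr 1) s) (Sum.inr 0) t) /
            (rr 0 (upd (upd ξ (Sum.inr 1) s) (Sum.inr 0) t) *
              rr 1 (upd (upd ξ (Sum.inr 1) s) (Sum.inr 0) t))) =
            2 * X ξ 0 / ((X ξ 0 + I * t) * (X ξ 1 + I * s)) *
              lap (Sum.inr 1) (X ξ 1) (damp (X ξ 0) G) (-ζ) := by
          rw [lap, ← integral_const_mul]
          refine integral_congr_ae (ae_of_all _ fun q => ?_)
          simp only [← cexp_inner_upd_zero_one, hu, be, pe, X_upd, if_pos h0, if_pos h1, hr, rr_upd,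
            Y, damp]
          ring
        rw [this, hc]
        simp only [div_eq_mul_inv, mul_inv]
        ring
      have e2 : ∀ s t : ℝ, hw (upd (upd ξ (Sum.inr 1) s) (Sum.inr 0) t) *
          pw 1 (upd (upd ξ (Sum.inr 1) s) (Sum.inr 0) t) *
          ift G (-upd (upd ξ (Sum.inr 1) s) (Sum.inr 0) t) *
          ∫ p, wave₀₁ (upd (upd ξ (Sum.inr 1) s) (Sum.inr 0) t) p * φ p =
          2 * X ξ 0 * h * (2 * X ξ 1 / (X ξ 1 ^ 2 + s ^ 2) : ℝ) *
            (ift G (-upd (upd ξ (Sum.inr 1) s) (Sum.inr 0) t) / (X ξ 0 - I * t)) := by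
        intro s t
        rw [integral_wave₀₁ hφ (by simpa using h0) (by simpa using h1), upd_upd, X_upd, X_upd,
          X_upd, X_upd, upd_comm _ h01.symm s 0, half_upd, hp, hw, X_upd, X_upd, if_pos h0, rb,
          X_upd, X_upd, Y_upd_same, ← hζ, ← hh]
        simp only [div_eq_mul_inv]
        ring
      have e3 : ∀ s : ℝ, c / (X ξ 1 + I * s) *
          (2 * Real.pi * half (Sum.inr 0) (X ξ 0) φ (upd ξ (Sum.inr 1) s)) =
          c * (2 * Real.pi) * (ift (damp (X ξ 0) φ) (upd ζ (Sum.inr 1) s) / (X ξ 1 + I * s)) := by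
        intro s
        rw [half_zero_eq, upd_comm _ h01.symm, ← hζ]
        ring
      have e4 : ∀ s : ℝ, 2 * X ξ 0 * h * (2 * X ξ 1 / (X ξ 1 ^ 2 + s ^ 2) : ℝ) *
          (2 * Real.pi * half (Sum.inr 0) (X ξ 0) G (-upd ξ (Sum.inr 1) s)) =
          2 * X ξ 0 * h * (2 * Real.pi) * ((2 * X ξ 1 / (X ξ 1 ^ 2 + s ^ 2) : ℝ) *
            ift (damp (X ξ 0) G) (-upd ζ (Sum.inr 1) s)) := by
        intro s
        rw [half_zero_eq, neg_upd, upd_comm _ h01.symm, hζ, neg_upd, neg_upd, neg_zero]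
        ring
      have hs : Integrable fun s => ift (damp (X ξ 0) G) (upd (-ζ) (Sum.inr 1) s) := by
        refine (integrable_slice_half G h01 (-ξ) h0).congr (ae_of_all _ fun s => ?_)
        simp only [half_zero_eq]
        rw [upd_comm _ h01.symm, hζ, neg_upd, neg_zero]
      have i1 : ∀ s, ∫ t : ℝ, ift φ (upd (upd ξ (Sum.inr 1) s) (Sum.inr 0) t) / (X ξ 0 + I * t) =
          2 * Real.pi * half (Sum.inr 0) (X ξ 0) φ (upd ξ (Sum.inr 1) s) := fun s => by
        exact hφ.integral_div_add _ 0 h0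
      have i2 : ∀ s, ∫ t : ℝ, ift G (-upd (upd ξ (Sum.inr 1) s) (Sum.inr 0) t) /
          (X ξ 0 - I * t) = 2 * Real.pi * half (Sum.inr 0) (X ξ 0) G (-upd ξ (Sum.inr 1) s) :=
        fun s => (sliceable_schwartz _ G).integral_neg_div_sub (integrable_slice_schwartz G _ _) h0
      simp only [e1, e2, integral_const_mul, i1, i2, e3, e4]
      rw [hφ'.integral_div_add ζ 1 h1, (sliceable_damp G h0.le).integral_poisson hs h1, hc, hh]
      ring
    · simp [pe, pw, h1]
  · simp [be, hw, h0]

lemma represented_K₁ : Represented K₁ := by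
  have h := represented_plane.sub represented_poisson
    (integrable_kernel_left (C := 1) (by fun_prop) fun q ξ => by
      simpa [div_eq_mul_inv] using inv_le_wt 0 ξ)
    (integrable_kernel_left (C := 1) (by fun_prop) fun q ξ => by
      rw [norm_div, norm_mul, norm_mul, norm_ex, norm_ep, one_mul, one_mul, div_eq_mul_inv]
      exact mul_le_mul (norm_pe_le 0 q ξ) (inv_le_wt 0 ξ) (by positivity) zero_le_one)
  convert h using 3
  rw [K₁]; ring

lemma represented_K₂ : Represented K₂ := by
  have h := represented_boundary.sub represented_boundary_poisson
    (integrable_kernel_left (C := 10) (by fun_prop) fun q ξ => norm_be_mul_le q ξ (by simp))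
    (integrable_kernel_left (C := 10) (by fun_prop) fun q ξ =>
      norm_be_mul_le q ξ ((norm_pe_le 1 q ξ).trans one_le_two))
  convert h using 3
  rw [K₂]; ring

end

end BiHalfPlane

end


/-! ### Conclusion. -/

theorem mainTheorem6 (f : Fin 2 → BiHalfPlane.E → ℂ)
    (hf : ∀ j, BiHalfPlane.IsSchwartz (f j)) (hclosed : BiHalfPlane.DbarClosed f) :
    BiHalfPlane.SmoothUpToBoundary (BiHalfPlane.dbarStar (BiHalfPlane.N f)) := by
  choose G hG using hf
  obtain ⟨w₁, hw₁, h₁⟩ := BiHalfPlane.represented_K₁ (G 0)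
  obtain ⟨w₂, hw₂, h₂⟩ := BiHalfPlane.represented_K₂ (G 1)
  refine ⟨fun p => -2 * Complex.I * ((2 * Real.pi) ^ 4 : ℝ)⁻¹ * (w₁ p + w₂ p),
    (contDiff_const.mul (hw₁.add hw₂)).contDiffOn, fun φ hφ => ?_⟩
  rw [BiHalfPlane.dbarStar_N_eq hclosed hG hφ, (h₁ φ hφ).2, (h₂ φ hφ).2,
    ← MeasureTheory.integral_add (hφ.integrable_mul hw₁).integrableOn
      (hφ.integrable_mul hw₂).integrableOn, ← MeasureTheory.integral_const_mul]
  refine MeasureTheory.integral_congr_ae (MeasureTheory.ae_of_all _ fun p => ?_)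
  simp only []
  ring
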